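/- Let $R$ be a Dedekind domain of characteristic $0$ with field of fractions $F$, let $E$ be an extension field of $F$, and let $\mathfrak{A}$ be a commutative $R$-order (an $R$-algebra that is finitely generated and torsion-free as an $R$-module) for which $A:=F\otimes_R\mathfrak{A}$ is a separable $F$-algebra. Put $A_E:=E\otimes_F A$. For an $\mathfrak{A}$-module $M$ write $M_{\rm tor}$ for its $R$-torsion submodule, $F\cdot M:=F\otimes_R M$, and let ${\rm Fit}^a_{\mathfrak{A}}(M)$ denote the $a$-th Fitting ideal. Let $C$ be a strictly admissible complex of $\mathfrak{A}$-modules: $C$ is perfect, the Euler characteristic of $A\otimes_{\mathfrak{A}}C$ in $K_0(A)$ vanishes, $C$ is acyclic outside degrees one and two, and $H^1(C)$ is $R$-torsion-free. Let $\lambda: E\otimes_RH^1(C)\to E\otimes_RH^2(C)$ be an isomorphism of $A_E$-modules. Let $\mathcal{L}\in A_E^\times$ be a characteristic element for $(C,\lambda)$, that is, $\vartheta_\lambda({\rm Det}_{\mathfrak{A}}(C))=\mathfrak{A}\cdot\mathcal{L}$, where $$\vartheta_\lambda:{\rm Det}_{A_E}(E\otimes_RC)\cong {\rm Det}_{A_E}(E\otimes_RH^1(C))^{-1}\otimes{\rm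 Det}_{A_E}(E\otimes_RH^2(C))\cong{\rm Det}_{A_E}(E\otimes_RH^2(C))^{-1}\otimes{\rm Det}_{A_E}(E\otimes_RH^2(C))\cong A_E$$ is the composite of the passage to cohomology, ${\rm Det}_{A_E}(\lambda)^{-1}\otimes 1$ and the evaluation map. (Explicitly: let $C$ be represented by a bounded complex $P$ of finitely generated projective modules, so that ${\rm Det}_{\mathfrak{A}}(C)={\rm Det}_{\mathfrak{A}}(P^{\rm even})\otimes{\rm Det}_{\mathfrak{A}}(P^{\rm odd})^{-1}$. Splittings $E\otimes_R P^i\cong B^i\oplus (E\otimes_RH^i(C))\oplus B^{i+1}$, with $B^i$ the coboundaries, together with $\lambda$ give an isomorphism $\Phi:E\otimes_RP^{\rm odd}\cong E\otimes_RP^{\rm even}$, and $\vartheta_\lambda$ is induced by ${\rm Det}_{A_E}(\Phi)^{-1}$ and evaluation.) Let $a\ge 0$ be an integer. Let $e_{a}$, respectively $e_{(a)}$, be the sum of all primitive idempotents $e$ of $A$ for which the $Ae$-module $e(F\cdot H^2(C))$ has rank equal to $a$, respectively at least $a$. Let $\mathcal{X}=(x_1,\dots,x_a)$ be an ordered $a$-tuple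 of elements of $H^2(C)$. The higher special element $\eta$ of $(C,\lambda,\mathcal{L},\mathcal{X})$ is the unique element of $\bigwedge^a_{A_E}(E\otimes_RH^1(C))$ with $$({\textstyle\bigwedge}^a_{A_E}\lambda)(\eta)=e_{a}\cdot\mathcal{L}^{-1}\cdot(x_1\wedge\cdots\wedge x_a).$$ Let $I(\eta)\subseteq A_E$ be the $\mathfrak{A}$-submodule generated by the elements $(\varphi_1\wedge\cdots\wedge\varphi_a)(\eta)$ for all $\varphi_1,\dots,\varphi_a\in{\rm Hom}_{\mathfrak{A}}(H^1(C),\mathfrak{A})$. Put $\mathfrak{A}':=\mathfrak{A}e_{(a)}\subseteq A$. Then for every element $y$ of the ideal $${\rm Ann}_{\mathfrak{A}}({\rm Ext}^2_{\mathfrak{A}}(H^2(C),\mathfrak{A}))\cdot{\rm Ann}_{\mathfrak{A}}({\rm Ext}^2_{\mathfrak{A}'}(\mathfrak{A}'\otimes_{\mathfrak{A}}H^2(C),\mathfrak{A}'))$$ the following claims are valid. (i) If $H^2(C)'$ is any subquotient of the $\mathfrak{A}$-module $H^2(C)$ for which $F\cdot H^2(C)'$ has rank at least $a$ at each simple component of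 $Ae_{(a)}$, then for every $x\in\mathfrak{A}\cap\mathfrak{A}'$ one has $$xy^a\cdot I(\eta)\subseteq{\rm Fit}^a_{\mathfrak{A}}(H^2(C))\cap{\rm Ann}_{\mathfrak{A}}(H^2(C)'_{\rm tor}).$$ (ii) If $\mathcal{X}$ is separable, meaning that $x_1,\dots,x_a$ form a basis of a free direct summand of the $\mathfrak{A}$-module $H^2(C)$, then $e_{(a)}=1$ and both $$y^a\cdot I(\eta)\subseteq{\rm Fit}^a_{\mathfrak{A}}(H^2(C))\quad\text{and}\quad{\rm Fit}^a_{\mathfrak{A}}(H^2(C))\subseteq I(\eta).$$ -/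

import Mathlib

open CategoryTheory TensorProduct

universe u v

noncomputable section

namespace HigherSpecial

/-! Throughout, `R` is a Dedekind domain, `S` an `R`-order, `F` the fraction field of `R` and `E` an
extension field of `F`. -/

/-- The scalar extension `K ⊗ S` of the order `S`, with the factors written in the order that makes
it an `S`-algebra through the left factor. For `K = F` this is the algebra `A` spanned by `S`, for
`K = E` it is `A_E`. For an `S`-module `M` the `A_E`-module `E ⊗_R M` is
`OrderExt R E S ⊗[S] M`. -/
abbrev OrderExt (R K S : Type*) [CommRing R] [CommRing K] [CommRing S] [Algebra R K]
    [Algebra R S] : Type _ :=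
  S ⊗[R] K

/-- The canonical map `A → A_E`. -/
def extMap (R F E S : Type*) [CommRing R] [Field F] [Field E] [CommRing S] [Algebra R F]
    [Algebra R E] [Algebra F E] [IsScalarTower R F E] [Algebra R S] :
    OrderExt R F S →ₐ[S] OrderExt R E S :=
  Algebra.TensorProduct.map (AlgHom.id S S) (IsScalarTower.toAlgHom R F E)

/-- The `R`-torsion submodule of an `S`-module. -/
def rTorsion (R S : Type*) [CommRing R] [CommRing S] [Algebra R S] (M : Type*)
    [AddCommGroup M] [Module S M] : Submodule S M :=
  Submodule.torsion' S M (Algebra.algebraMapSubmonoid S (nonZeroDivisors R))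

/-! ### Idempotents -/

/-- Primitive idempotents of a commutative ring. -/
def IsPrimitiveIdem {B : Type*} [CommRing B] (e : B) : Prop :=
  IsIdempotentElem e ∧ e ≠ 0 ∧ ∀ f : B, IsIdempotentElem f → f * e = f → f = 0 ∨ f = e

/-- The rank over `A e` of `e (F ⊗_R M)`, for an idempotent `e` of `A`: here `A e` is written as
the quotient ring `A ⧸ (1 - e)` of `A`. -/
def rankAt (R F : Type*) {S : Type*} [CommRing R] [Field F] [CommRing S] [Algebra R F]
    [Algebra R S] (e : OrderExt R F S) (M : Type*) [AddCommGroup M] [Module S M] : ℕ :=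
  Module.finrank (OrderExt R F S ⧸ Ideal.span {1 - e})
    ((OrderExt R F S ⧸ Ideal.span {1 - e}) ⊗[S] M)

/-- `e_a`: the sum of the primitive idempotents of `A` at which `F ⊗_R M` has rank `a`. -/
def idemEq (R F : Type*) {S : Type*} [CommRing R] [Field F] [CommRing S] [Algebra R F]
    [Algebra R S] (M : Type*) [AddCommGroup M] [Module S M] (a : ℕ) : OrderExt R F S :=
  ∑ᶠ (e : OrderExt R F S) (_ : IsPrimitiveIdem e ∧ rankAt R F e M = a), e

/-- `e_(a)`: the sum of the primitive idempotents of `A` at which `F ⊗_R M` has rank at least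
`a`. -/
def idemGe (R F : Type*) {S : Type*} [CommRing R] [Field F] [CommRing S] [Algebra R F]
    [Algebra R S] (M : Type*) [AddCommGroup M] [Module S M] (a : ℕ) : OrderExt R F S :=
  ∑ᶠ (e : OrderExt R F S) (_ : IsPrimitiveIdem e ∧ a ≤ rankAt R F e M), e

/-- The ideal of those `b` in `S` with `b e = 0`. -/
def idemKer (R F : Type*) {S : Type*} [CommRing R] [Field F] [CommRing S] [Algebra R F]
    [Algebra R S] (e : OrderExt R F S) : Ideal S :=
  LinearMap.ker (LinearMap.toSpanSingleton S (OrderExt R F S) e)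

/-- The ring `S e`, for an idempotent `e` of `A`, written as the quotient of `S` by the kernel of
the surjective ring homomorphism `b ↦ b e`. -/
abbrev IdemOrder (R F : Type*) {S : Type*} [CommRing R] [Field F] [CommRing S] [Algebra R F]
    [Algebra R S] (e : OrderExt R F S) : Type _ :=
  S ⧸ idemKer R F e

/-! ### Fitting ideals -/

/-- The `a`-th Fitting ideal of a finitely generated module `M`: the ideal generated, for all
surjections `g : S ^ n → M`, by the minors of size `n - a` of the matrices whose rows are relations
in `ker g` (each single surjection yields the same ideal). A minor of size `n - a` with `n ≤ a` is
equal to `1`. -/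
def fittingIdeal (S : Type*) [CommRing S] (M : Type*) [AddCommGroup M] [Module S M] (a : ℕ) :
    Ideal S :=
  Ideal.span {z | ∃ (n : ℕ) (g : (Fin n → S) →ₗ[S] M), Function.Surjective g ∧
    ∃ (r : Fin (n - a) → LinearMap.ker g) (c : Fin (n - a) → Fin n),
      z = Matrix.det (Matrix.of fun i j => (r i : Fin n → S) (c j))}

/-! ### Annihilators of `Ext²` -/

/-- `Ann_S (Ext²_S (M, S))`. -/
def annExtTwo (S : Type u) [CommRing S] (M : Type u) [AddCommGroup M] [Module S M] : Ideal S :=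
  Module.annihilator S (Abelian.Ext (ModuleCat.of S M) (ModuleCat.of S S) 2)

/-- `Ann_S (Ext²_{S'} (S' ⊗_S M, S'))` for the ring `S' = S e`. -/
def annExtTwoIdem (R : Type*) (F : Type*) {S : Type u} [CommRing R] [Field F] [CommRing S]
    [Algebra R F] [Algebra R S] (e : OrderExt R F S) (M : Type u) [AddCommGroup M] [Module S M] :
    Ideal S :=
  (annExtTwo (IdemOrder R F e) (IdemOrder R F e ⊗[S] M)).comap
    (Ideal.Quotient.mk (idemKer R F e))

/-! ### Perfect and strictly admissible complexes -/

/-- A bounded complex of finitely generated projective modules. -/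
structure IsStrictlyPerfect {S : Type u} [CommRing S] (P : CochainComplex (ModuleCat.{u} S) ℤ) :
    Prop where
  finite (i : ℤ) : Module.Finite S (P.X i)
  projective (i : ℤ) : Module.Projective S (P.X i)
  bounded : ∃ n : ℕ, ∀ i : ℤ, (n : ℤ) < |i| → Subsingleton (P.X i)

/-- The direct sum of the terms of even degree. -/
abbrev EvenPart {S : Type u} [CommRing S] (P : CochainComplex (ModuleCat.{u} S) ℤ) : Type u :=
  DirectSum {i : ℤ // Even i} fun i => P.X i

/-- The direct sum of the terms of odd degree. -/
abbrev OddPart {S : Type u} [CommRing S] (P : CochainComplex (ModuleCat.{u} S) ℤ) : Type u :=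
  DirectSum {i : ℤ // Odd i} fun i => P.X i

/-- The Euler characteristic of `B ⊗_S P` vanishes in `K_0(B)`: the classes of the even and of the
odd part agree in the Grothendieck group, that is, these modules are stably isomorphic. -/
def EulerCharVanishes {S : Type u} [CommRing S] (B : Type*) [CommRing B] [Algebra S B]
    (P : CochainComplex (ModuleCat.{u} S) ℤ) : Prop :=
  ∃ n : ℕ, Nonempty
    (((B ⊗[S] EvenPart P) × (Fin n → B)) ≃ₗ[B] ((B ⊗[S] OddPart P) × (Fin n → B)))

/-- Strictly admissible perfect complexes of `S`-modules. In the derived category, `C` is isomorphic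
to a strictly perfect complex `P` exactly if there is a quasi-isomorphism `P ⟶ C`. -/
structure IsStrictlyAdmissible (R F : Type*) {S : Type u} [CommRing R] [Field F] [CommRing S]
    [Algebra R F] [Algebra R S] (C : CochainComplex (ModuleCat.{u} S) ℤ) : Prop where
  perfect : ∃ (P : CochainComplex (ModuleCat.{u} S) ℤ) (q : P ⟶ C),
    QuasiIso q ∧ IsStrictlyPerfect P ∧ EulerCharVanishes (OrderExt R F S) P
  acyclic (i : ℤ) : i ≠ 1 → i ≠ 2 → C.ExactAt i
  torsionFree : rTorsion R S (C.homology 1) = ⊥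

/-! ### Determinants -/

/-- The determinant of a finitely generated projective module `M`: the submodule of the exterior
algebra consisting of the elements that are killed by all `m ∧ -`. For `M` of constant rank `n` this
is `⋀^n M`, and in general it is the direct sum of the top exterior powers of `M` over the open and
closed parts of the spectrum on which the rank is constant. -/
def detLine (S : Type*) [CommRing S] (M : Type*) [AddCommGroup M] [Module S M] :
    Submodule S (ExteriorAlgebra S M) where
  carrier := {w | ∀ m : M, ExteriorAlgebra.ι S m * w = 0}
  add_mem' := fun ha hb m => by rw [mul_add, ha m, hb m, add_zero]
  zero_mem' := fun m => mul_zero _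
  smul_mem' := fun c w hw m => by rw [mul_smul_comm, hw m, smul_zero]

/-- The canonical map `⋀_S M → ⋀_B (B ⊗_S M)`. -/
def exteriorBaseChange {S : Type*} [CommRing S] (B : Type*) [CommRing B] [Algebra S B]
    (M : Type*) [AddCommGroup M] [Module S M] :
    ExteriorAlgebra S M →ₐ[S] ExteriorAlgebra B (B ⊗[S] M) :=
  ExteriorAlgebra.lift S
    ⟨((ExteriorAlgebra.ι B).restrictScalars S) ∘ₗ (TensorProduct.mk S B M 1),
      fun m => ExteriorAlgebra.ι_sq_zero (R := B) ((1 : B) ⊗ₜ[S] m)⟩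

/-- The map from cocycles of `P` in degree `i` to the cohomology of `C`, for a morphism
`q : P ⟶ C`. -/
def cocycleClass {S : Type u} [CommRing S] {P C : CochainComplex (ModuleCat.{u} S) ℤ}
    (q : P ⟶ C) (i : ℤ) : P.cycles i →ₗ[S] C.homology i :=
  (P.homologyπ i ≫ HomologicalComplex.homologyMap q i).hom

/-- Inclusion of the `i`-th term in the even part, after base change to `B`. -/
def evenIncl {S : Type u} [CommRing S] (B : Type*) [CommRing B] [Algebra S B]
    (P : CochainComplex (ModuleCat.{u} S) ℤ) (i : {i : ℤ // Even i}) :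
    B ⊗[S] P.X i →ₗ[B] B ⊗[S] EvenPart P :=
  (DirectSum.lof S {i : ℤ // Even i} (fun i => P.X i) i).baseChange B

/-- Inclusion of the `i`-th term in the odd part, after base change to `B`. -/
def oddIncl {S : Type u} [CommRing S] (B : Type*) [CommRing B] [Algebra S B]
    (P : CochainComplex (ModuleCat.{u} S) ℤ) (i : {i : ℤ // Odd i}) :
    B ⊗[S] P.X i →ₗ[B] B ⊗[S] OddPart P :=
  (DirectSum.lof S {i : ℤ // Odd i} (fun i => P.X i) i).baseChange B

/-- The boundaries in the `j`-th term of `B ⊗_S P` (here `j = i + 1`; otherwise this is `0`). -/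
abbrev boundaries {S : Type u} [CommRing S] (B : Type*) [CommRing B] [Algebra S B]
    (P : CochainComplex (ModuleCat.{u} S) ℤ) (i j : ℤ) : Submodule B (B ⊗[S] P.X j) :=
  LinearMap.range ((P.d i j).hom.baseChange B)

/-- Splittings of the complex `B ⊗_S P`, where `C` is acyclic outside degrees one and two and
`q : P ⟶ C` is a quasi-isomorphism: sections of the maps from the terms onto the boundaries, and of
the maps from the cocycles onto the cohomology in degrees one and two. They identify
`B ⊗ P^i` with `B^i ⊕ (B ⊗ H^i(C)) ⊕ B^(i+1)`, with `B^i` the boundaries in degree `i`. -/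
structure Splitting {S : Type u} [CommRing S] (B : Type*) [CommRing B] [Algebra S B]
    {P C : CochainComplex (ModuleCat.{u} S) ℤ} (q : P ⟶ C) where
  /-- the section of the differential -/
  rho (i j : ℤ) : boundaries B P i j →ₗ[B] B ⊗[S] P.X i
  d_rho (i j : ℤ) (b : boundaries B P i j) : (P.d i j).hom.baseChange B (rho i j b) = b
  /-- the section in cohomology -/
  sigma (i : ℤ) : B ⊗[S] C.homology i →ₗ[B] B ⊗[S] P.cycles i
  class_sigma (i : ℤ) (h : B ⊗[S] C.homology i) :
    (cocycleClass q i).baseChange B (sigma i h) = h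

/-- The cochain of degree `i` that represents a cohomology class, for a given splitting. -/
def Splitting.rep {S : Type u} [CommRing S] {B : Type*} [CommRing B] [Algebra S B]
    {P C : CochainComplex (ModuleCat.{u} S) ℤ} {q : P ⟶ C} (s : Splitting B q) (i : ℤ) :
    B ⊗[S] C.homology i →ₗ[B] B ⊗[S] P.X i :=
  (P.iCycles i).hom.baseChange B ∘ₗ s.sigma i

/-- The isomorphism `Φ` from the odd part to the even part of `B ⊗_S P` is induced by a splitting
and by the isomorphism `lam : B ⊗ H^1(C) ≃ B ⊗ H^2(C)`: on the summands of the odd part it is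
the identity of boundaries in all degrees, and `lam` on the cohomology. -/
structure IsInducedIso {S : Type u} [CommRing S] {B : Type*} [CommRing B] [Algebra S B]
    {P C : CochainComplex (ModuleCat.{u} S) ℤ} {q : P ⟶ C} (s : Splitting B q)
    (lam : (B ⊗[S] C.homology 1) ≃ₗ[B] (B ⊗[S] C.homology 2))
    (Φ : (B ⊗[S] OddPart P) ≃ₗ[B] (B ⊗[S] EvenPart P)) : Prop where
  map_boundary (i : {i : ℤ // Even i}) (j : {j : ℤ // Odd j}) (b : boundaries B P i j) :
    Φ (oddIncl B P j b) = evenIncl B P i (s.rho i j b)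
  map_section (i : {i : ℤ // Odd i}) (j : {j : ℤ // Even j}) (b : boundaries B P i j) :
    Φ (oddIncl B P i (s.rho i j b)) = evenIncl B P j b
  map_cohomology (h : B ⊗[S] C.homology 1) :
    Φ (oddIncl B P ⟨1, odd_one⟩ (s.rep 1 h)) = evenIncl B P ⟨2, even_two⟩ (s.rep 2 (lam h))

/-- The image of `Det_S(N) ⊗ Det_S(M)^(-1) = Hom_S (Det_S(M), Det_S(N))` in `B` under the
trivialisation of `Det_B(B ⊗ N) ⊗ Det_B(B ⊗ M)^(-1)` that an isomorphism
`Φ : B ⊗ M ≃ B ⊗ N` induces: a homomorphism `Det_S(M) → Det_S(N)` is sent to the scalar `c` for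
which it is `c` times the restriction of `Det_B(Φ)`. -/
def detLattice {S : Type*} [CommRing S] {B : Type*} [CommRing B] [Algebra S B]
    {M N : Type*} [AddCommGroup M] [Module S M] [AddCommGroup N] [Module S N]
    (Φ : (B ⊗[S] M) ≃ₗ[B] (B ⊗[S] N)) : Submodule S B where
  carrier := {c | ∀ w ∈ detLine S M, ∃ w' ∈ detLine S N,
    c • ExteriorAlgebra.map Φ.toLinearMap (exteriorBaseChange B M w) = exteriorBaseChange B N w'}
  add_mem' := by
    intro c d hc hd w hw
    obtain ⟨u, hu, hcu⟩ := hc w hw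
    obtain ⟨v, hv, hdv⟩ := hd w hw
    exact ⟨u + v, add_mem hu hv, by rw [add_smul, hcu, hdv, map_add]⟩
  zero_mem' := fun w _ => ⟨0, zero_mem _, by rw [zero_smul, map_zero]⟩
  smul_mem' := by
    intro s c hc w hw
    obtain ⟨u, hu, hcu⟩ := hc w hw
    exact ⟨s • u, Submodule.smul_mem _ s hu, by rw [smul_assoc, hcu, map_smul]⟩

/-- `L` is a characteristic element for the pair `(C, lam)`: it generates the image of `Det_S(C)`
under the isomorphism `Det_{A_E}(E ⊗_R C) ≅ A_E` that is induced by the passage to cohomology,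
by `lam` and by evaluation. Here `Det_S(C)` is computed as `Det(P^even) ⊗ Det(P^odd)^(-1)` for a
strictly perfect complex `P` that represents `C`; the image depends neither on `P` nor on the
splitting. -/
def IsCharacteristicElement (R E : Type*) {S : Type u} [CommRing R] [Field E] [CommRing S]
    [Algebra R E] [Algebra R S] (C : CochainComplex (ModuleCat.{u} S) ℤ)
    (lam : (OrderExt R E S ⊗[S] C.homology 1) ≃ₗ[OrderExt R E S]
      (OrderExt R E S ⊗[S] C.homology 2))
    (L : (OrderExt R E S)ˣ) : Prop :=
  ∃ (P : CochainComplex (ModuleCat.{u} S) ℤ) (q : P ⟶ C) (s : Splitting (OrderExt R E S) q)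
    (Φ : (OrderExt R E S ⊗[S] OddPart P) ≃ₗ[OrderExt R E S] (OrderExt R E S ⊗[S] EvenPart P)),
    QuasiIso q ∧ IsStrictlyPerfect P ∧ IsInducedIso s lam Φ ∧
      detLattice Φ = Submodule.span S {(L : OrderExt R E S)}

/-! ### Higher special elements -/

/-- The higher special element of `(C, lam, L, x)`, where `M = H^1(C)` and `N = H^2(C)`. -/
def higherSpecialElement (R F E : Type*) {S : Type*} [CommRing R] [Field F] [Field E] [CommRing S]
    [Algebra R F] [Algebra R E] [Algebra F E] [IsScalarTower R F E] [Algebra R S]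
    {M N : Type*} [AddCommGroup M] [Module S M] [AddCommGroup N] [Module S N]
    (lam : (OrderExt R E S ⊗[S] M) ≃ₗ[OrderExt R E S] (OrderExt R E S ⊗[S] N))
    (L : (OrderExt R E S)ˣ) {a : ℕ} (x : Fin a → N) :
    ⋀[OrderExt R E S]^a (OrderExt R E S ⊗[S] M) :=
  exteriorPower.map a lam.symm.toLinearMap
    ((extMap R F E S (idemEq R F N a) * ((L⁻¹ : (OrderExt R E S)ˣ) : OrderExt R E S)) •
      exteriorPower.ιMulti (OrderExt R E S) a fun i => (1 : OrderExt R E S) ⊗ₜ[S] x i)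

/-- The higher special element is the unique element with
`(⋀^a lam)(η) = e_a L⁻¹ (x_1 ∧ ... ∧ x_a)`. -/
theorem eq_higherSpecialElement_iff (R F E : Type*) {S : Type*} [CommRing R] [Field F] [Field E]
    [CommRing S] [Algebra R F] [Algebra R E] [Algebra F E] [IsScalarTower R F E] [Algebra R S]
    {M N : Type*} [AddCommGroup M] [Module S M] [AddCommGroup N] [Module S N]
    (lam : (OrderExt R E S ⊗[S] M) ≃ₗ[OrderExt R E S] (OrderExt R E S ⊗[S] N))
    (L : (OrderExt R E S)ˣ) {a : ℕ} (x : Fin a → N)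
    (η : ⋀[OrderExt R E S]^a (OrderExt R E S ⊗[S] M)) :
    η = higherSpecialElement R F E lam L x ↔
      exteriorPower.map a lam.toLinearMap η =
        (extMap R F E S (idemEq R F N a) * ((L⁻¹ : (OrderExt R E S)ˣ) : OrderExt R E S)) •
          exteriorPower.ιMulti (OrderExt R E S) a fun i => (1 : OrderExt R E S) ⊗ₜ[S] x i := by
  have h1 : ∀ z, exteriorPower.map a lam.toLinearMap
      (exteriorPower.map a lam.symm.toLinearMap z) = z := fun z => by
    rw [← LinearMap.comp_apply, ← exteriorPower.map_comp]
    simp [exteriorPower.map_id]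
  have h2 : ∀ z, exteriorPower.map a lam.symm.toLinearMap
      (exteriorPower.map a lam.toLinearMap z) = z := fun z => by
    rw [← LinearMap.comp_apply, ← exteriorPower.map_comp]
    simp [exteriorPower.map_id]
  constructor
  · rintro rfl
    exact h1 _
  · intro h
    rw [← h2 η, h]
    rfl

/-- `I(η)`: the `S`-submodule generated by the elements `(φ_1 ∧ ... ∧ φ_a)(η)`, where the `φ_i` run
over `Hom_S (M, S)`. -/
def evalIdeal {S : Type*} [CommRing S] {B : Type*} [CommRing B] [Algebra S B] {M : Type*}
    [AddCommGroup M] [Module S M] {a : ℕ} (η : ⋀[B]^a (B ⊗[S] M)) : Submodule S B :=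
  Submodule.span S (Set.range fun φ : Fin a → Module.Dual S M =>
    exteriorPower.pairingDual B (B ⊗[S] M) a
      (exteriorPower.ιMulti B a fun i => (φ i).baseChange B) η)

/-- The tuple `x` is separable: it is a basis of a direct summand of `N`. -/
def IsSeparableTuple (S : Type*) [CommRing S] {N : Type*} [AddCommGroup N] [Module S N] {a : ℕ}
    (x : Fin a → N) : Prop :=
  LinearIndependent S x ∧ ∃ K : Submodule S N, IsCompl (Submodule.span S (Set.range x)) K

end HigherSpecial

end

open HigherSpecial

/-!
Let `M = H^1(C)` and `N = H^2(C)`, and let `P → C` be a strictly perfect resolution for which the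
determinant of an isomorphism `Φ : E ⊗ P^odd ≃ E ⊗ P^even` generates the lattice of `L`. The
statement is reduced to a two-term complex of projective modules, over which everything becomes a
computation with bordered determinants.

*Two terms.* An injection of finitely generated projective modules over an `R`-order splits as soon
as its cokernel is `R`-torsion-free (`exists_retraction_of_torsionFree_coker`): modulo a maximal
ideal it stays injective, which is the case of the Auslander–Buchsbaum formula that is needed. As
`M` is torsion-free, all differentials of `P` with target in odd degree therefore split integrally
(`exists_splitting_of_odd`), and the sum of the differentials and of the splittings is a map
`P^odd → P^even` with kernel `M` and cokernel `N`. Over `A_E` it can be completed, by `λ`, to an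
isomorphism; this differs from `Φ` by a unipotent automorphism
(`IsInducedIso.isNilpotent_unipotentPart`), since a power of the difference lowers the filtration
by degree. The completed differential therefore has the same determinant as `Φ`, and this is
locally the inverse of `L` up to a unit of the order (`exists_localBasis_of_detLattice`).

*Bordered determinants.* Border the matrix of the differential by the coordinates of lifts
`z_1, …, z_a` of elements of `N`, by functionals `ψ_1, …, ψ_a`, and by an arbitrary square block.
The determinant of this matrix lies in `Fit^a(N)` (`exists_pow_mul_det_borderedMatrix_mem`). On the
other hand `A_E` is reduced, so that the determinant can be computed at its points with values in
fields: where the rank of `N` exceeds `a` it vanishes, and where the rank is `a` it is, up to sign,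
the determinant of the completed differential times the value of `ψ_1 ∧ … ∧ ψ_a` at
`λ⁻¹ z_1 ∧ … ∧ λ⁻¹ z_a` (`TwoTermModel.map_det_borderedMatrix`,
`TwoTermModel.mul_det_borderedMatrix`). For lifts of `x_1, …, x_a` this is, locally and up to a
unit, the value of `ψ_1 ∧ … ∧ ψ_a` at the higher special element, provided that the components of
rank less than `a` are removed, which multiplication by an element of `𝔄 ∩ 𝔄'` does. Functionals on
`M` need not extend to `P^odd`, but the obstruction lies in `Ext²(N, 𝔄)`
(`exists_extension_of_mem_annExtTwo`); extending all `a` of them costs the factor `y ^ a`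
(`TwoTermModel.smul_mem_map_of_fittingIdeal`).

*Torsion.* Multiplied by an element of `𝔄 ∩ 𝔄'`, the Fitting ideal annihilates the torsion of a
subquotient of sufficiently large rank (`mul_mem_annihilator_rTorsion`). By Cramer's rule a minor of
the relations maps a torsion element to a combination of larger minors, each of which involves a
further relation that holds rationally, and these vanish where the rank is at least `a`.

*Separable tuples.* If `x_1, …, x_a` is a basis of a direct summand, the dual functionals show that
the rank of `N` is at least `a` everywhere, and where it is `a` the tuple is a rational basis of
`N`, so that the values at any other tuple are multiples of the values at `x`
(`idemEq_mul_det_eq_of_dual`). It remains to see that the minors of the relations of an arbitrary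
presentation of `N` are combinations of bordered determinants (`exists_pow_mul_minor_mem_span`),
which gives the inclusion of the Fitting ideal (`TwoTermModel.map_fittingIdeal_le_evalIdeal`).
-/

noncomputable section

namespace HigherSpecial

/-! ### Determinants of bordered matrices -/

section Matrix

open Matrix

variable {T : Type*} [CommRing T] {m α ρ : Type*} [Fintype m] [DecidableEq m]
  [Fintype α] [DecidableEq α] [Fintype ρ] [DecidableEq ρ]

/-- A bordered determinant of `1 - i k` is a bordered determinant of the (usually much smaller)
matrix `1 - k i`. -/
theorem det_fromBlocks_one_sub_mul (i : Matrix m ρ T) (k : Matrix ρ m T) (X : Matrix m α T)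
    (p : Matrix α m T) (c : Matrix α α T) :
    (fromBlocks (1 - i * k) X p c).det =
      (fromBlocks (1 - k * i) (k * X) (p * i) (c - p * X)).det := by
  let U : Matrix (m ⊕ α) (ρ ⊕ α) T := fromBlocks i (-X) (-(p * i)) (1 - c + p * X)
  let V : Matrix (ρ ⊕ α) (m ⊕ α) T := fromBlocks k 0 0 1
  have hUV : U * V = fromBlocks (i * k) (-X) (-(p * i * k)) (1 - c + p * X) := by
    simp [U, V, fromBlocks_multiply]
  have hVU : V * U = fromBlocks (k * i) (-(k * X)) (-(p * i)) (1 - c + p * X) := by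
    simp [U, V, fromBlocks_multiply]
  have h1 : fromBlocks (1 - i * k) X p c = fromBlocks 1 0 p 1 * (1 - U * V) := by
    rw [hUV, ← fromBlocks_one, sub_eq_add_neg (fromBlocks _ _ _ _), fromBlocks_neg,
      fromBlocks_add, fromBlocks_multiply]
    congr 1 <;> simp [Matrix.mul_add, Matrix.mul_assoc, sub_eq_add_neg]
    abel
  have h2 : 1 - V * U = fromBlocks (1 - k * i) (k * X) (p * i) (c - p * X) := by
    rw [hVU, ← fromBlocks_one, sub_eq_add_neg (fromBlocks _ _ _ _), fromBlocks_neg,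
      fromBlocks_add]
    congr 1 <;> simp [sub_eq_add_neg]
    abel
  rw [h1, det_mul, det_fromBlocks_zero₁₂, det_one, det_one, one_mul, one_mul,
    det_one_sub_mul_comm, h2]

theorem det_fromBlocks_zero₁₁_same (b c d : Matrix α α T) :
    (fromBlocks 0 b c d).det = (-1) ^ Fintype.card α * (c.det * b.det) := by
  have h1 : fromBlocks 0 b c d = fromBlocks b 0 d c * fromBlocks 0 1 1 0 := by
    rw [fromBlocks_multiply]; simp
  have h2 : (fromBlocks 0 1 1 0 : Matrix (α ⊕ α) (α ⊕ α) T).det = (-1) ^ Fintype.card α := by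
    have h3 : (fromBlocks 0 1 1 0 : Matrix (α ⊕ α) (α ⊕ α) T) =
        fromBlocks 1 1 0 1 * (fromBlocks 1 0 (-1) 1 * (fromBlocks 1 1 0 1 *
          fromBlocks (-1) 0 0 1)) := by
      simp only [fromBlocks_multiply]
      congr 1 <;> simp
    rw [h3]
    simp [det_mul, det_neg]
  rw [h1, det_mul, h2, det_fromBlocks_zero₁₂]
  ring

/-- A block matrix over a field with a vanishing square block that is larger than the
complementary block is singular. -/
theorem det_fromBlocks_zero₁₁_of_card_lt {K : Type*} [Field K] (b : Matrix ρ α K)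
    (c : Matrix α ρ K) (d : Matrix α α K) (h : Fintype.card α < Fintype.card ρ) :
    (fromBlocks 0 b c d).det = 0 := by
  have h1 : ∃ v : ρ → K, v ≠ 0 ∧ c *ᵥ v = 0 := by
    by_contra! hc
    have hinj : Function.Injective c.mulVecLin := by
      rw [← LinearMap.ker_eq_bot, LinearMap.ker_eq_bot']
      intro v hv
      by_contra hv'
      exact hc v hv' hv
    have := LinearMap.finrank_le_finrank_of_injective hinj
    simp at this
    omega
  obtain ⟨v, hv, hcv⟩ := h1
  refine exists_mulVec_eq_zero_iff.mp ⟨Sum.elim v 0, fun h0 => hv ?_, ?_⟩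
  · funext i
    exact congrFun h0 (Sum.inl i)
  · rw [fromBlocks_mulVec]
    simp [hcv]

/-- In a reduced ring, nilpotent matrices do not contribute to determinants. -/
theorem det_smul_one_add_of_isNilpotent [IsReduced T] (s : T) (N : Matrix m m T)
    (hN : IsNilpotent N) : (s • (1 : Matrix m m T) + N).det = s ^ Fintype.card m := by
  have h1 : (-N).charpoly = Polynomial.X ^ Fintype.card m := by
    have := Matrix.isNilpotent_charpoly_sub_pow_of_isNilpotent hN.neg
    rw [Polynomial.isNilpotent_iff] at this
    ext j
    simpa [sub_eq_zero] using (this j).eq_zero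
  have h2 := Matrix.eval_charpoly (-N) s
  rw [h1, sub_neg_eq_add] at h2
  rw [Matrix.smul_one_eq_diagonal, ← Matrix.scalar_apply, ← h2]
  simp

/-- The field case of the determinant formula: `f` is, up to the scalar `s`, the product of the
invertible matrix `w` and the projector `1 - i k`, whose kernel has dimension `card ρ`. -/
theorem det_fromBlocks_of_projector {K : Type*} [Field K] {s : K} (hs : s ≠ 0)
    {f w : Matrix m m K} {i : Matrix m ρ K} {k : Matrix ρ m K} {X Z : Matrix m α K}
    (p : Matrix α m K) (c : Matrix α α K) (hki : k * i = s • (1 : Matrix ρ ρ K))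
    (hw : w * (s • (1 : Matrix m m K) - i * k) = s • f) (hX : w * X = s • Z) :
    (Fintype.card α < Fintype.card ρ → (fromBlocks f Z p c).det = 0) ∧
    (ρ ≃ α → (fromBlocks f Z p c).det =
      (-1) ^ Fintype.card α * (w.det * (s⁻¹ ^ 2 • (p * i * (k * X))).det)) := by
  have h1 : fromBlocks f Z p c = fromBlocks w 0 0 1 *
      fromBlocks (1 - (s⁻¹ • i) * k) (s⁻¹ • X) p c := by
    have hf : f = w * (1 - (s⁻¹ • i) * k) := by
      have : f = s⁻¹ • (s • f) := by rw [smul_smul, inv_mul_cancel₀ hs, one_smul]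
      rw [this, ← hw, ← Matrix.mul_smul, smul_sub, smul_smul, inv_mul_cancel₀ hs, one_smul,
        Matrix.smul_mul]
    have hZ : Z = w * (s⁻¹ • X) := by
      rw [Matrix.mul_smul, hX, smul_smul, inv_mul_cancel₀ hs, one_smul]
    rw [fromBlocks_multiply, ← hf, ← hZ]
    simp
  have h2 : (1 : Matrix ρ ρ K) - k * (s⁻¹ • i) = 0 := by
    rw [Matrix.mul_smul, hki, smul_smul, inv_mul_cancel₀ hs, one_smul, sub_self]
  have h3 := det_fromBlocks_one_sub_mul (s⁻¹ • i) k (s⁻¹ • X) p c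
  rw [h2] at h3
  constructor
  · intro h
    rw [h1, det_mul, h3, det_fromBlocks_zero₁₁_of_card_lt _ _ _ h, mul_zero]
  · intro e
    rw [h1, det_mul, h3, ← det_submatrix_equiv_self (e.symm.sumCongr (Equiv.refl α))]
    rw [show (fromBlocks (0 : Matrix ρ ρ K) (k * s⁻¹ • X) (p * s⁻¹ • i)
        (c - p * s⁻¹ • X)).submatrix (e.symm.sumCongr (Equiv.refl α))
          (e.symm.sumCongr (Equiv.refl α)) =
        fromBlocks 0 ((k * s⁻¹ • X).submatrix e.symm id) ((p * s⁻¹ • i).submatrix id e.symm)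
          (c - p * s⁻¹ • X) from by
      ext a b; rcases a with a | a <;> rcases b with b | b <;> rfl]
    rw [det_fromBlocks_zero₁₁_same, ← det_mul, det_fromBlocks_zero₁₂, det_one, mul_one,
      Matrix.submatrix_mul_equiv (p * s⁻¹ • i) (k * s⁻¹ • X) id e.symm id]
    rw [Matrix.mul_smul, Matrix.mul_smul, Matrix.smul_mul, Matrix.mul_smul, smul_smul,
      submatrix_id_id]
    ring_nf

end Matrix

section Matrix

open Matrix

variable {T : Type*} [CommRing T]

/-- If a multilinear form takes values in an ideal whenever its arguments lie in given sets, then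
also whenever they lie in the spans of these sets. -/
theorem _root_.MultilinearMap.mem_ideal_of_mem_span {ι M : Type*} [Finite ι] [AddCommGroup M]
    [Module T M] (f : MultilinearMap T (fun _ : ι => M) T) (I : Ideal T) (V : ι → Set M)
    (h : ∀ v : ι → M, (∀ i, v i ∈ V i) → f v ∈ I) (v : ι → M)
    (hv : ∀ i, v i ∈ Submodule.span T (V i)) : f v ∈ I := by
  classical
  have := Fintype.ofFinite ι
  suffices H : ∀ s : Finset ι, ∀ v : ι → M, (∀ i ∈ s, v i ∈ Submodule.span T (V i)) →
      (∀ i ∉ s, v i ∈ V i) → f v ∈ I from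
    H Finset.univ v (fun i _ => hv i) fun i hi => absurd (Finset.mem_univ i) hi
  intro s
  induction s using Finset.induction_on with
  | empty => exact fun v _ hv => h v fun i => hv i (Finset.notMem_empty i)
  | insert i s hi ih =>
    intro v hv1 hv2
    have key : ∀ w ∈ Submodule.span T (V i), f (Function.update v i w) ∈ I := by
      intro w hw
      induction hw using Submodule.span_induction with
      | mem w hw =>
        refine ih _ (fun j hj => ?_) fun j hj => ?_
        · rw [Function.update_of_ne (by rintro rfl; exact hi hj)]
          exact hv1 j (Finset.mem_insert_of_mem hj)
        · by_cases hji : j = i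
          · subst hji
            rwa [Function.update_self]
          · rw [Function.update_of_ne hji]
            exact hv2 j (by simp [hji, hj])
      | zero => rw [f.map_update_zero]; exact I.zero_mem
      | add x y _ _ hx hy => rw [f.map_update_add]; exact I.add_mem hx hy
      | smul c x _ hx => rw [f.map_update_smul]; exact I.mul_mem_left c hx
    have := key (v i) (hv1 i (Finset.mem_insert_self i s))
    rwa [Function.update_eq_self] at this

/-- Renumbering the rows and the columns independently changes a determinant by a sign. -/
theorem det_submatrix_equiv_eq_unit_mul {m n : Type*} [Fintype m] [DecidableEq m] [Fintype n]
    [DecidableEq n] (M : Matrix m m T) (r c : n ≃ m) :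
    ∃ ε : ℤˣ, (M.submatrix r c).det = ((ε : ℤ) : T) * M.det := by
  refine ⟨Equiv.Perm.sign (c.trans r.symm), ?_⟩
  have h1 : M.submatrix r c = (M.submatrix r r).submatrix id (c.trans r.symm) := by
    ext i j; simp
  rw [h1, det_permute', det_submatrix_equiv_self]

/-- The maximal minors of `(G R | Z)`, for `G` square, are combinations of the determinants
of `G` bordered by `Z` and further rows. -/
theorem det_fromCols_mul_mem_span {ν α β : Type*} [Fintype ν] [DecidableEq ν] [Fintype α]
    [DecidableEq α] [Fintype β] [DecidableEq β] (G : Matrix ν ν T) (Z : Matrix ν α T)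
    (R : Matrix ν β T) (e : β ⊕ α ≃ ν) :
    ((fromCols (G * R) Z).submatrix e id).det ∈
      Ideal.span (Set.range fun p : Matrix α ν T => (fromBlocks G Z p 0).det) := by
  rw [← det_transpose]
  let V : β ⊕ α → Set (β ⊕ α → T) := Sum.elim
    (fun _ => Set.range fun (n : ν) (j : β ⊕ α) => G (e j) n) fun a => {fun j => Z (e j) a}
  refine MultilinearMap.mem_ideal_of_mem_span
    (detRowAlternating (n := β ⊕ α) (R := T)).toMultilinearMap _ V ?_ _ ?_
  · intro v hv
    have hσ : ∀ b : β, ∃ n : ν, v (Sum.inl b) = fun j => G (e j) n := fun b => by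
      obtain ⟨n, hn⟩ := hv (Sum.inl b)
      exact ⟨n, hn.symm⟩
    choose σ hσ using hσ
    have hZ : ∀ a : α, v (Sum.inr a) = fun j => Z (e j) a := fun a => hv (Sum.inr a)
    change Matrix.det (Matrix.of v) ∈ _
    by_cases hinj : Function.Injective σ
    · -- the bordering rows are the coordinate functions of the columns that are not selected
      have hcard : Fintype.card α = Fintype.card ↥(Set.range σ)ᶜ := by
        rw [Fintype.card_compl_set, ← Fintype.card_congr e, Fintype.card_sum,
          Set.card_range_of_injective hinj]
        simp
      let τ := Fintype.equivOfCardEq hcard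
      let ε : β ⊕ α ≃ ν := ((Equiv.ofInjective σ hinj).sumCongr τ).trans
        (Equiv.Set.sumCompl (Set.range σ))
      have hε1 : ∀ b, ε (Sum.inl b) = σ b := fun b => by simp [ε]
      let π : (β ⊕ α) ⊕ α ≃ ν ⊕ α := (((Equiv.sumAssoc β α α).trans
        ((Equiv.refl β).sumCongr (Equiv.sumComm α α))).trans (Equiv.sumAssoc β α α).symm).trans
          (ε.sumCongr (Equiv.refl α))
      let p : Matrix α ν T := Matrix.of fun a n => if ε (Sum.inr a) = n then 1 else 0
      obtain ⟨u, hu⟩ := det_submatrix_equiv_eq_unit_mul (fromBlocks G Z p 0)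
        (e.sumCongr (Equiv.refl α)) π
      have h1 : (fromBlocks G Z p 0).submatrix (e.sumCongr (Equiv.refl α)) π =
          fromBlocks (Matrix.of v)ᵀ (Matrix.of fun j a => G (e j) (ε (Sum.inr a))) 0 1 := by
        ext x y
        rcases x with x | x <;> rcases y with (y | y) | y
        · simp [π, hε1, hσ]
        · simp [π, hZ]
        · simp [π]
        · have : ε (Sum.inr x) ≠ ε (Sum.inl y) := fun h => by simpa using ε.injective h
          simp [π, p, this]
        · simp [π]
        · simp [π, p, Matrix.one_apply]
      rw [h1, det_fromBlocks_zero₂₁, det_one, mul_one, det_transpose] at hu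
      rw [hu]
      exact Ideal.mul_mem_left _ _ (Ideal.subset_span ⟨p, rfl⟩)
    · rw [Function.not_injective_iff] at hinj
      obtain ⟨b, b', hbb, hne⟩ := hinj
      have h0 : Matrix.det (Matrix.of v) = 0 :=
        det_zero_of_row_eq (i := Sum.inl b) (j := Sum.inl b') (by simpa using hne)
          (show v _ = v _ by rw [hσ, hσ, hbb])
      rw [h0]
      exact Ideal.zero_mem _
  · rintro (b | a)
    · have : ((fromCols (G * R) Z).submatrix e id)ᵀ (Sum.inl b) =
          ∑ n, R n b • fun j => G (e j) n := by
        ext j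
        simp [Matrix.mul_apply, mul_comm]
      rw [this]
      exact Submodule.sum_mem _ fun n _ => Submodule.smul_mem _ _ (Submodule.subset_span ⟨n, rfl⟩)
    · exact Submodule.subset_span rfl

end Matrix

/-! ### Bases up to a scalar -/

/-- A basis of the module `O` up to the scalar `s`: vectors and coordinate functions that become
dual bases after inverting `s`. At a prime ideal that does not contain `s` these vectors form a
basis of the localisation of `O`. -/
structure LocalBasis (S : Type*) [CommRing S] (s : S) (D : ℕ) (O : Type*) [AddCommGroup O]
    [Module S O] where
  /-- the vectors of the basis -/
  vec : Fin D → O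
  /-- the coordinate functions, multiplied by `s` -/
  coord : Fin D → Module.Dual S O
  coord_vec (i j : Fin D) : coord i (vec j) = if i = j then s else 0
  sum_coord (o : O) : ∑ i, coord i o • vec i = s • o

section

variable {S : Type*} [CommRing S] {s : S} {D : ℕ} {O : Type*} [AddCommGroup O] [Module S O]

/-- Multiplying the coordinate functions by `t` gives a basis up to `t s`. -/
def LocalBasis.scale (b : LocalBasis S s D O) (t : S) : LocalBasis S (t * s) D O where
  vec := b.vec
  coord i := t • b.coord i
  coord_vec i j := by simp [b.coord_vec]
  sum_coord o := by
    simp only [LinearMap.smul_apply, smul_eq_mul, mul_smul]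
    rw [← Finset.smul_sum, b.sum_coord]

/-- A finitely generated projective module is locally free, in terms of bases up to a scalar. -/
theorem exists_localBasis [Module.Finite S O] [Module.Projective S O] (m : Ideal S)
    [hm : m.IsMaximal] : ∃ s ∉ m, ∃ D, Nonempty (LocalBasis S s D O) := by
  let _ : Field (S ⧸ m) := Ideal.Quotient.field m
  let Obar := O ⧸ (m • (⊤ : Submodule S O))
  let b := Module.finBasis (S ⧸ m) Obar
  set D := Module.finrank (S ⧸ m) Obar
  choose q hq using fun i => Submodule.mkQ_surjective (m • (⊤ : Submodule S O)) (b i)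
  have hF : ∀ i, ∃ F : O →ₗ[S] S, ∀ o, Ideal.Quotient.mk m (F o) =
      b.coord i ((m • (⊤ : Submodule S O)).mkQ o) := fun i => by
    obtain ⟨F, hF⟩ := Module.projective_lifting_property m.mkQ
      ((b.coord i).restrictScalars S ∘ₗ (m • (⊤ : Submodule S O)).mkQ) m.mkQ_surjective
    exact ⟨F, fun o => LinearMap.congr_fun hF o⟩
  choose F hF using hF
  let G : Matrix (Fin D) (Fin D) S := Matrix.of fun i j => F i (q j)
  have hG : Ideal.Quotient.mk m G.det = 1 := by
    have h1 : (Ideal.Quotient.mk m).mapMatrix G = 1 := by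
      ext i j
      simp only [RingHom.mapMatrix_apply, Matrix.map_apply, G, Matrix.of_apply, hF, hq,
        Module.Basis.coord_apply, Module.Basis.repr_self, Finsupp.single_apply, Matrix.one_apply]
      simp [eq_comm]
    rw [RingHom.map_det, h1, Matrix.det_one]
  have hsup : (⊤ : Submodule S O) ≤
      Submodule.span S (Set.range q) ⊔ m • (⊤ : Submodule S O) := by
    intro o _
    choose a ha using fun i => Ideal.Quotient.mk_surjective
      (b.repr ((m • (⊤ : Submodule S O)).mkQ o) i)
    have h1 : o - ∑ i, a i • q i ∈ m • (⊤ : Submodule S O) := by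
      rw [← Submodule.Quotient.mk_eq_zero, ← Submodule.mkQ_apply, map_sub, map_sum, sub_eq_zero,
        ← b.sum_repr ((m • (⊤ : Submodule S O)).mkQ o)]
      refine Finset.sum_congr rfl fun i _ => ?_
      rw [map_smul, hq, ← ha i]
      rfl
    rw [← add_sub_cancel (∑ i, a i • q i) o]
    exact Submodule.add_mem_sup (Submodule.sum_mem _ fun i _ =>
      Submodule.smul_mem _ _ (Submodule.subset_span ⟨i, rfl⟩)) h1
  obtain ⟨r, hr, hrle⟩ := Submodule.exists_sub_one_mem_and_smul_le_of_fg_of_le_sup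
    (Module.Finite.fg_top) le_rfl hsup
  let c : Fin D → Module.Dual S O := fun i => ∑ j, G.adjugate i j • F j
  have hc : ∀ i j, c i (q j) = if i = j then G.det else 0 := fun i j => by
    have := congrFun (congrFun G.adjugate_mul i) j
    simpa [Matrix.mul_apply, c, G, Matrix.one_apply] using this
  refine ⟨G.det * r, fun hmem => ?_, D, ⟨⟨q, fun i => r • c i, fun i j => ?_, fun o => ?_⟩⟩⟩
  · have h1 : Ideal.Quotient.mk m r = 1 := by
      rw [← sub_eq_zero, ← map_one (Ideal.Quotient.mk m), ← map_sub]
      exact Ideal.Quotient.eq_zero_iff_mem.mpr hr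
    have h2 := Ideal.Quotient.eq_zero_iff_mem.mpr hmem
    rw [map_mul, hG, h1] at h2
    simp at h2
  · rw [LinearMap.smul_apply, hc]
    split_ifs <;> simp [mul_comm]
  · have hro : r • o ∈ Submodule.span S (Set.range q) :=
      hrle (Submodule.smul_mem_pointwise_smul o r ⊤ trivial)
    obtain ⟨a, ha⟩ := (Submodule.mem_span_range_iff_exists_fun S).mp hro
    simp only [LinearMap.smul_apply]
    have h3 : ∀ i, r • c i o = G.det * a i := fun i => by
      rw [← map_smul, ← ha, map_sum]
      simp [hc, mul_comm]
    simp only [h3, mul_smul]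
    rw [← Finset.smul_sum, ha]

variable {B : Type*} [CommRing B] [Algebra S B] {V U : Type*} [AddCommGroup V] [Module S V]
  [AddCommGroup U] [Module S U] {D' D'' : ℕ}

theorem LocalBasis.sum_coord_baseChange (b : LocalBasis S s D O) (z : B ⊗[S] O) :
    ∑ i, (b.coord i).baseChange B z • (1 : B) ⊗ₜ[S] b.vec i = s • z := by
  induction z using TensorProduct.induction_on with
  | zero => simp
  | add x y hx hy => simp only [map_add, add_smul, Finset.sum_add_distrib, hx, hy, smul_add]
  | tmul c o =>
    rw [TensorProduct.smul_tmul', TensorProduct.smul_tmul, ← b.sum_coord, TensorProduct.tmul_sum]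
    refine Finset.sum_congr rfl fun i _ => ?_
    rw [Module.Dual.baseChange_apply_tmul, TensorProduct.smul_tmul', smul_eq_mul, mul_one,
      TensorProduct.smul_tmul]

theorem LocalBasis.sum_coord_mul (b : LocalBasis S s D O) (f : B ⊗[S] O →ₗ[B] B)
    (z : B ⊗[S] O) :
    ∑ i, f ((1 : B) ⊗ₜ[S] b.vec i) * (b.coord i).baseChange B z = algebraMap S B s * f z := by
  have h := congrArg f (b.sum_coord_baseChange z)
  rw [map_sum, algebra_compatible_smul B s z, map_smul] at h
  rw [← smul_eq_mul (algebraMap S B s), ← h]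
  exact Finset.sum_congr rfl fun i _ => by rw [map_smul, smul_eq_mul, mul_comm]

/-- The matrix of a linear map with respect to bases up to a scalar. -/
def LocalBasis.toMatrix (b : LocalBasis S s D O) (b' : LocalBasis S s D' V)
    (f : B ⊗[S] O →ₗ[B] B ⊗[S] V) : Matrix (Fin D') (Fin D) B :=
  Matrix.of fun i j => (b'.coord i).baseChange B (f ((1 : B) ⊗ₜ[S] b.vec j))

theorem LocalBasis.toMatrix_mul (b : LocalBasis S s D O) (b' : LocalBasis S s D' V)
    (b'' : LocalBasis S s D'' U) (f : B ⊗[S] O →ₗ[B] B ⊗[S] V) (g : B ⊗[S] V →ₗ[B] B ⊗[S] U) :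
    b'.toMatrix b'' g * b.toMatrix b' f = algebraMap S B s • b.toMatrix b'' (g ∘ₗ f) := by
  ext i j
  rw [Matrix.mul_apply, Matrix.smul_apply, smul_eq_mul]
  exact b'.sum_coord_mul ((b''.coord i).baseChange B ∘ₗ g) (f ((1 : B) ⊗ₜ[S] b.vec j))

theorem LocalBasis.toMatrix_id (b : LocalBasis S s D O) :
    b.toMatrix b (LinearMap.id : B ⊗[S] O →ₗ[B] B ⊗[S] O) =
      algebraMap S B s • (1 : Matrix (Fin D) (Fin D) B) := by
  ext i j
  simp only [LocalBasis.toMatrix, LinearMap.id_apply, Matrix.of_apply,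
    Module.Dual.baseChange_apply_tmul, b.coord_vec, Matrix.smul_apply, Matrix.one_apply]
  split_ifs <;> simp [Algebra.smul_def]

theorem LocalBasis.toMatrix_add (b : LocalBasis S s D O) (b' : LocalBasis S s D' V)
    (f g : B ⊗[S] O →ₗ[B] B ⊗[S] V) :
    b.toMatrix b' (f + g) = b.toMatrix b' f + b.toMatrix b' g := by
  ext i j
  simp [LocalBasis.toMatrix]

theorem LocalBasis.toMatrix_sub (b : LocalBasis S s D O) (b' : LocalBasis S s D' V)
    (f g : B ⊗[S] O →ₗ[B] B ⊗[S] V) :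
    b.toMatrix b' (f - g) = b.toMatrix b' f - b.toMatrix b' g := by
  ext i j
  simp [LocalBasis.toMatrix]

theorem LocalBasis.toMatrix_baseChange (b : LocalBasis S s D O) (b' : LocalBasis S s D' V)
    (f : O →ₗ[S] V) : b.toMatrix b' (f.baseChange B) =
      (Matrix.of fun i j => b'.coord i (f (b.vec j))).map (algebraMap S B) := by
  ext i j
  simp [LocalBasis.toMatrix, Algebra.smul_def]

theorem LocalBasis.toMatrix_mul_toMatrix_symm (b : LocalBasis S s D O)
    (b' : LocalBasis S s D' V) (e : (B ⊗[S] O) ≃ₗ[B] (B ⊗[S] V)) :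
    b.toMatrix b' e.toLinearMap * b'.toMatrix b e.symm.toLinearMap =
      algebraMap S B s ^ 2 • (1 : Matrix (Fin D') (Fin D') B) := by
  rw [LocalBasis.toMatrix_mul, LinearEquiv.comp_symm, LocalBasis.toMatrix_id, smul_smul, sq]

/-- Modules that become isomorphic over `B` have the same local ranks. -/
theorem LocalBasis.rank_eq (b : LocalBasis S s D O) (b' : LocalBasis S s D' V)
    (e : (B ⊗[S] O) ≃ₗ[B] (B ⊗[S] V)) (hs : ¬ IsNilpotent (algebraMap S B s)) : D = D' := by
  have h1 : ∃ p : Ideal B, p.IsPrime ∧ algebraMap S B s ∉ p := by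
    by_contra! h
    refine hs (mem_nilradical.mp ?_)
    rw [nilradical_eq_sInf]
    exact Ideal.mem_sInf.mpr fun {p} hp => h p hp
  obtain ⟨p, hp, hsp⟩ := h1
  let f : B →+* p.ResidueField := algebraMap B p.ResidueField
  have hfs : f (algebraMap S B s) ≠ 0 := fun h => hsp (by simpa [f] using h)
  have key : ∀ {n k : ℕ} (X : Matrix (Fin n) (Fin k) B) (Y : Matrix (Fin k) (Fin n) B),
      X * Y = algebraMap S B s ^ 2 • (1 : Matrix (Fin n) (Fin n) B) → n ≤ k := by
    intro n k X Y h
    have h2 : X.map f * Y.map f =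
        f (algebraMap S B s) ^ 2 • (1 : Matrix (Fin n) (Fin n) p.ResidueField) := by
      rw [← Matrix.map_mul, h]
      ext i j
      simp [Matrix.one_apply, apply_ite f]
    have h3 : (X.map f * Y.map f).rank = n := by
      rw [h2, Matrix.rank_of_isUnit, Fintype.card_fin]
      rw [Matrix.isUnit_iff_isUnit_det, Matrix.det_smul, Matrix.det_one, mul_one]
      exact (IsUnit.mk0 _ hfs).pow 2 |>.pow _
    calc n = (X.map f * Y.map f).rank := h3.symm
      _ ≤ (X.map f).rank := Matrix.rank_mul_le_left _ _
      _ ≤ Fintype.card (Fin k) := Matrix.rank_le_card_width _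
      _ = k := Fintype.card_fin k
  exact le_antisymm (key _ _ (b'.toMatrix_mul_toMatrix_symm b e.symm))
    (key _ _ (b.toMatrix_mul_toMatrix_symm b' e))

end

/-! ### Determinant lines in terms of bases up to a scalar -/

section

variable {S : Type*} [CommRing S] {O : Type*} [AddCommGroup O] [Module S O]

theorem _root_.AlternatingMap.map_matrix_sum {N ι : Type*} [AddCommGroup N] [Module S N]
    [Fintype ι] [DecidableEq ι] (g : O [⋀^ι]→ₗ[S] N) (v : ι → O) (A : Matrix ι ι S) :
    g (fun j => ∑ i, A i j • v i) = A.det • g v := by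
  let f1 : (ι → S) [⋀^ι]→ₗ[S] N := g.compLinearMap (Fintype.linearCombination S v)
  let f2 : (ι → S) [⋀^ι]→ₗ[S] N :=
    (LinearMap.toSpanSingleton S N (g v)).compAlternatingMap Matrix.detRowAlternating
  have h : f1 = f2 := by
    refine Module.Basis.ext_alternating (Pi.basisFun S ι) fun w hw => ?_
    let σ : Equiv.Perm ι := Equiv.ofBijective w (Finite.injective_iff_bijective.mp hw)
    have h1 : f1 (fun i => Pi.basisFun S ι (w i)) = g (v ∘ σ) := by
      simp only [f1, AlternatingMap.compLinearMap_apply]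
      congr 1
      ext i
      simp [σ]
    have h2 : f2 (fun i => Pi.basisFun S ι (w i)) =
        ((1 : Matrix ι ι S).submatrix σ id).det • g v := by
      simp only [f2, LinearMap.compAlternatingMap_apply, LinearMap.toSpanSingleton_apply]
      congr 1
      change Matrix.det _ = _
      congr 1
      ext i j
      simp [σ, Pi.single_apply, Matrix.one_apply, eq_comm]
    rw [h1, h2, g.map_perm, Matrix.det_permute, Matrix.det_one, mul_one]
    rw [Units.smul_def, Int.cast_smul_eq_zsmul]
  have := DFunLike.congr_fun h A.transpose
  rw [← Matrix.det_transpose]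
  exact this

theorem ιMulti_mul_ι (n : ℕ) (v : Fin n → O) (m : O) :
    ∃ c : S, ExteriorAlgebra.ιMulti S n v * ExteriorAlgebra.ι S m =
      c • (ExteriorAlgebra.ι S m * ExteriorAlgebra.ιMulti S n v) := by
  induction n with
  | zero => exact ⟨1, by simp⟩
  | succ n ih =>
    obtain ⟨c, hc⟩ := ih (Matrix.vecTail v)
    refine ⟨-c, ?_⟩
    rw [ExteriorAlgebra.ιMulti_succ_apply, mul_assoc, hc, mul_smul_comm, ← mul_assoc, ← mul_assoc,
      eq_neg_of_add_eq_zero_left (ExteriorAlgebra.ι_add_mul_swap (v 0) m), neg_mul, smul_neg,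
      neg_smul]

/-- An element of the exterior algebra that is annihilated by all vectors is multiplied by the
scalar part of an arbitrary element. -/
theorem detLine_mul_of_mul_ι {w : ExteriorAlgebra S O}
    (hw : ∀ m, w * ExteriorAlgebra.ι S m = 0) (x : ExteriorAlgebra S O) :
    w * x = ExteriorAlgebra.algebraMapInv x • w := by
  induction x using ExteriorAlgebra.induction with
  | algebraMap r =>
    rw [ExteriorAlgebra.algebraMap_leftInverse, ← Algebra.commutes, ← Algebra.smul_def]
  | ι m => simp [hw, ExteriorAlgebra.algebraMapInv]
  | mul a b ha hb =>
    rw [← mul_assoc, ha, smul_mul_assoc, hb, smul_smul, map_mul]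
  | add a b ha hb => rw [mul_add, ha, hb, map_add, add_smul]

/-- Contraction with coordinate functions shows that an element of the determinant line is
divisible by the corresponding exterior product, up to a power of the scalar. -/
theorem exists_pow_smul_eq_ιMulti_mul {s : S} (n : ℕ) (q : Fin n → O)
    (c : Fin n → Module.Dual S O) (hc : ∀ i j, c i (q j) = if i = j then s else 0)
    (w : ExteriorAlgebra S O) (hw : ∀ i, ExteriorAlgebra.ι S (q i) * w = 0) :
    ∃ w' : ExteriorAlgebra S O, s ^ n • w = ExteriorAlgebra.ιMulti S n q * w' := by
  induction n generalizing w with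
  | zero => exact ⟨w, by simp⟩
  | succ n ih =>
    have hcon : ∀ i, c 0 (q i) • w = ExteriorAlgebra.ι S (q i) *
        CliffordAlgebra.contractLeft (c 0) w := fun i => by
      have h := CliffordAlgebra.contractLeft_ι_mul (Q := (0 : QuadraticForm S O)) (c 0) (q i) w
      have hw' : CliffordAlgebra.ι (0 : QuadraticForm S O) (q i) * w = 0 := hw i
      rw [hw', map_zero] at h
      exact sub_eq_zero.mp h.symm
    obtain ⟨w', hw'⟩ := ih (fun i => q i.succ) (fun i => c i.succ)
      (fun i j => by rw [hc]; simp [Fin.succ_inj])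
      (CliffordAlgebra.contractLeft (c 0) w) (fun i => by
        rw [← hcon, hc]
        simp [(Fin.succ_ne_zero i).symm])
    refine ⟨w', ?_⟩
    have h0 := hcon 0
    rw [hc, if_pos rfl] at h0
    rw [pow_succ, mul_smul, h0, ← mul_smul_comm, hw', ExteriorAlgebra.ιMulti_succ_apply, mul_assoc]
    rfl

variable {s : S} {D : ℕ}

theorem LocalBasis.smul_ι_mul_ιMulti (b : LocalBasis S s D O) (m : O) :
    s • (ExteriorAlgebra.ι S m * ExteriorAlgebra.ιMulti S D b.vec) = 0 := by
  rw [← smul_mul_assoc, ← map_smul, ← b.sum_coord, map_sum, Finset.sum_mul]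
  refine Finset.sum_eq_zero fun i _ => ?_
  rw [map_smul, smul_mul_assoc, ExteriorAlgebra.ιMulti_apply, ExteriorAlgebra.ι_mul_prod_list,
    smul_zero]

theorem LocalBasis.smul_ιMulti_mem_detLine (b : LocalBasis S s D O) :
    s • ExteriorAlgebra.ιMulti S D b.vec ∈ detLine S O := fun m => by
  rw [mul_smul_comm, b.smul_ι_mul_ιMulti]

/-- The exterior product of a basis up to a scalar generates the determinant line up to a power
of that scalar. -/
theorem LocalBasis.exists_smul_eq_of_mem_detLine (b : LocalBasis S s D O)
    {w : ExteriorAlgebra S O} (hw : w ∈ detLine S O) :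
    ∃ c : S, s ^ (D + 1) • w = c • s • ExteriorAlgebra.ιMulti S D b.vec := by
  obtain ⟨w', hw'⟩ := exists_pow_smul_eq_ιMulti_mul D b.vec b.coord b.coord_vec w
    fun i => hw (b.vec i)
  refine ⟨ExteriorAlgebra.algebraMapInv w', ?_⟩
  rw [pow_succ', mul_smul, hw', ← smul_mul_assoc, detLine_mul_of_mul_ι]
  intro m
  obtain ⟨c, hc⟩ := ιMulti_mul_ι (S := S) D b.vec m
  rw [smul_mul_assoc, hc, smul_comm, b.smul_ι_mul_ιMulti, smul_zero]

variable {B : Type*} [CommRing B] [Algebra S B] {V : Type*} [AddCommGroup V] [Module S V]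

theorem exteriorBaseChange_ιMulti (n : ℕ) (v : Fin n → O) :
    exteriorBaseChange B O (ExteriorAlgebra.ιMulti S n v) =
      ExteriorAlgebra.ιMulti B n fun i => (1 : B) ⊗ₜ[S] v i := by
  rw [ExteriorAlgebra.ιMulti_apply, ExteriorAlgebra.ιMulti_apply, map_list_prod, List.map_ofFn]
  congr 2
  ext i
  exact ExteriorAlgebra.lift_ι_apply _ _ _ _

/-- The top coefficient with respect to coordinate functions. -/
def topCoeff (D : ℕ) (c : Fin D → Module.Dual S O) : ExteriorAlgebra S O →ₗ[S] S :=
  ExteriorAlgebra.liftAlternating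
    (Pi.single D (Matrix.detRowAlternating.compLinearMap (LinearMap.pi c)))

theorem topCoeff_ιMulti (c : Fin D → Module.Dual S O) (v : Fin D → O) :
    topCoeff D c (ExteriorAlgebra.ιMulti S D v) = (Matrix.of fun i j => c j (v i)).det := by
  rw [topCoeff, ExteriorAlgebra.liftAlternating_apply_ιMulti, Pi.single_eq_same]
  rfl

theorem topCoeff_exteriorBaseChange (c : Fin D → Module.Dual S O) (w : ExteriorAlgebra S O) :
    topCoeff D (fun i => (c i).baseChange B) (exteriorBaseChange B O w) =
      algebraMap S B (topCoeff D c w) := by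
  have h : ((topCoeff D (fun i => (c i).baseChange B)).restrictScalars S) ∘ₗ
      (exteriorBaseChange B O).toLinearMap = Algebra.linearMap S B ∘ₗ topCoeff D c := by
    refine ExteriorAlgebra.lhom_ext fun n => ?_
    ext v
    simp only [LinearMap.compAlternatingMap_apply, LinearMap.comp_apply,
      AlgHom.toLinearMap_apply, exteriorBaseChange_ιMulti, LinearMap.restrictScalars_apply,
      Algebra.linearMap_apply]
    by_cases hn : n = D
    · subst hn
      rw [topCoeff_ιMulti, topCoeff_ιMulti, RingHom.map_det]
      congr 1
      ext i j
      simp [Algebra.smul_def]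
    · rw [topCoeff, topCoeff, ExteriorAlgebra.liftAlternating_apply_ιMulti,
        ExteriorAlgebra.liftAlternating_apply_ιMulti, Pi.single_eq_of_ne hn,
        Pi.single_eq_of_ne hn]
      simp
  exact LinearMap.congr_fun h w

/-- An element of the lattice of `e`, multiplied by the determinant of `e`, is locally integral. -/
theorem LocalBasis.mul_det_toMatrix_mem (b : LocalBasis S s D O) (b' : LocalBasis S s D V)
    (e : (B ⊗[S] O) ≃ₗ[B] (B ⊗[S] V)) {c : B} (hc : c ∈ detLattice e) :
    ∃ g : S, algebraMap S B s * (c * (b.toMatrix b' e.toLinearMap).det) = algebraMap S B g := by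
  obtain ⟨w', -, hw'⟩ := hc _ b.smul_ιMulti_mem_detLine
  refine ⟨topCoeff D b'.coord w', ?_⟩
  rw [← topCoeff_exteriorBaseChange, ← hw', map_smul (exteriorBaseChange B O),
    exteriorBaseChange_ιMulti, algebra_compatible_smul B s, map_smul, map_smul, map_smul,
    ExteriorAlgebra.map_apply_ιMulti, topCoeff_ιMulti, ← Matrix.det_transpose]
  simp only [smul_eq_mul]
  rw [mul_left_comm]
  rfl

/-- A generator of the lattice of `e`, multiplied by the determinant of `e`, is locally a unit. -/
theorem LocalBasis.exists_pow_eq_mul_det_toMatrix (b : LocalBasis S s D O)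
    (b' : LocalBasis S s D V) (e : (B ⊗[S] O) ≃ₗ[B] (B ⊗[S] V)) {L : B}
    (hL : detLattice e = Submodule.span S {L}) :
    ∃ g : S, algebraMap S B s ^ (4 * D + 1) =
      algebraMap S B g * (L * (b.toMatrix b' e.toLinearMap).det) := by
  set σ := algebraMap S B s
  set W := b.toMatrix b' e.toLinearMap
  set W' := b'.toMatrix b e.symm.toLinearMap
  have hWW : W.det * W'.det = σ ^ (2 * D) := by
    rw [← Matrix.det_mul, b.toMatrix_mul_toMatrix_symm b' e, Matrix.det_smul, Matrix.det_one,
      mul_one, Fintype.card_fin, pow_mul]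
  have hmap : σ ^ D • ExteriorAlgebra.map e.toLinearMap
      (exteriorBaseChange B O (ExteriorAlgebra.ιMulti S D b.vec)) =
      W.det • exteriorBaseChange B V (ExteriorAlgebra.ιMulti S D b'.vec) := by
    rw [exteriorBaseChange_ιMulti, exteriorBaseChange_ιMulti, ExteriorAlgebra.map_apply_ιMulti,
      ← AlternatingMap.map_matrix_sum]
    have := (ExteriorAlgebra.ιMulti B D).map_smul_univ (fun _ => σ)
      (e.toLinearMap ∘ fun i => (1 : B) ⊗ₜ[S] b.vec i)
    rw [Finset.prod_const, Finset.card_univ, Fintype.card_fin] at this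
    rw [← this]
    congr 1
    ext j
    rw [← algebra_compatible_smul, ← b'.sum_coord_baseChange]
    rfl
  have hmem : σ ^ (2 * D + 1) * W'.det ∈ detLattice e := by
    intro w hw
    obtain ⟨c, hc⟩ := b.exists_smul_eq_of_mem_detLine hw
    refine ⟨(s ^ (2 * D) * c) • s • ExteriorAlgebra.ιMulti S D b'.vec,
      Submodule.smul_mem _ _ b'.smul_ιMulti_mem_detLine, ?_⟩
    have h1 : σ ^ (D + 1) • exteriorBaseChange B O w = (algebraMap S B c * σ) •
        exteriorBaseChange B O (ExteriorAlgebra.ιMulti S D b.vec) := by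
      have := congrArg (exteriorBaseChange B O) hc
      rw [map_smul, map_smul, map_smul, algebra_compatible_smul B, map_pow,
        algebra_compatible_smul B c, algebra_compatible_smul B s, smul_smul] at this
      exact this
    calc (σ ^ (2 * D + 1) * W'.det) • ExteriorAlgebra.map e.toLinearMap (exteriorBaseChange B O w)
        = (W'.det * σ ^ D) • ExteriorAlgebra.map e.toLinearMap
            (σ ^ (D + 1) • exteriorBaseChange B O w) := by
          rw [map_smul, smul_smul]; congr 1; ring
      _ = (W'.det * (algebraMap S B c * σ)) • σ ^ D • ExteriorAlgebra.map e.toLinearMap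
            (exteriorBaseChange B O (ExteriorAlgebra.ιMulti S D b.vec)) := by
          rw [h1, map_smul, smul_smul, smul_smul]; congr 1; ring
      _ = ((W.det * W'.det) * (algebraMap S B c * σ)) •
            exteriorBaseChange B V (ExteriorAlgebra.ιMulti S D b'.vec) := by
          rw [hmap, smul_smul]; congr 1; ring
      _ = _ := by
          rw [hWW, map_smul, map_smul, algebra_compatible_smul B (s ^ (2 * D) * c),
            algebra_compatible_smul B s, smul_smul, map_mul, map_pow]
          congr 1; ring
  rw [hL, Submodule.mem_span_singleton] at hmem
  obtain ⟨g, hg⟩ := hmem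
  refine ⟨g, ?_⟩
  rw [← mul_assoc, ← Algebra.smul_def, hg]
  linear_combination (-σ ^ (2 * D + 1)) * hWW

end

/-! ### Scalar extensions of the order -/

/-- Differentials vanish on separable elements; the algebra need not be a field. -/
theorem formallyUnramified_of_algebra_isSeparable (F A : Type*) [Field F] [CommRing A]
    [Algebra F A] [Algebra.IsSeparable F A] : Algebra.FormallyUnramified F A := by
  refine ⟨?_⟩
  refine subsingleton_of_forall_eq 0 fun w => ?_
  have hw : w ∈ Submodule.span A (Set.range (KaehlerDifferential.D F A)) := by
    rw [KaehlerDifferential.span_range_derivation]; trivial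
  induction hw using Submodule.span_induction with
  | zero => rfl
  | add x y _ _ hx hy => rw [hx, hy, add_zero]
  | smul c x _ hx => rw [hx, smul_zero]
  | mem w hw =>
    obtain ⟨x, rfl⟩ := hw
    have h1 := (KaehlerDifferential.D F A).map_aeval (minpoly F x) x
    rw [minpoly.aeval, map_zero] at h1
    obtain ⟨a, b, hab⟩ := Algebra.IsSeparable.isSeparable F x
    have h2 := congrArg (Polynomial.aeval x) hab
    rw [map_add, map_mul, map_mul, minpoly.aeval, mul_zero, zero_add, map_one] at h2
    rw [← one_smul A (KaehlerDifferential.D F A x), ← h2, mul_smul, ← h1, smul_zero]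

section

variable (R F E S : Type*) [CommRing R] [Field F] [Algebra R F] [Field E] [Algebra R E]
  [Algebra F E] [IsScalarTower R F E] [CommRing S] [Algebra R S]

/-- `A_E` is unramified over the field `E`. -/
theorem isReduced_orderExt [Module.Finite R S] [Algebra.IsSeparable F (F ⊗[R] S)] :
    IsReduced (OrderExt R E S) := by
  have := formallyUnramified_of_algebra_isSeparable F (F ⊗[R] S)
  have h1 : IsReduced (E ⊗[F] (F ⊗[R] S)) :=
    Algebra.FormallyUnramified.isReduced_of_field E (E ⊗[F] (F ⊗[R] S))
  let e1 := Algebra.TensorProduct.cancelBaseChange R F E E S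
  let e2 := Algebra.TensorProduct.comm R S E
  exact isReduced_of_injective (e1.symm.toRingHom.comp e2.toRingHom)
    (e1.symm.injective.comp e2.injective)

include F in
theorem algebraMap_orderExt_injective [IsDedekindDomain R] [IsFractionRing R F]
    [Module.IsTorsionFree R S] :
    Function.Injective (algebraMap S (OrderExt R E S)) := by
  have h1 : Function.Injective (Algebra.linearMap R E) := by
    change Function.Injective (algebraMap R E)
    rw [IsScalarTower.algebraMap_eq R F E]
    exact (algebraMap F E).injective.comp (IsFractionRing.injective R F)
  have h2 := Module.Flat.lTensor_preserves_injective_linearMap (M := S) (Algebra.linearMap R E) h1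
  intro x y hxy
  have h3 := @h2 (x ⊗ₜ[R] 1) (y ⊗ₜ[R] 1) (by simpa using hxy)
  simpa using congrArg (TensorProduct.rid R S) h3

instance flat_orderExt [IsFractionRing R F] : Module.Flat S (OrderExt R F S) :=
  have : Module.Flat R F := IsLocalization.flat F (nonZeroDivisors R)
  inferInstance

include F in
theorem flat_orderExt_of_field [IsFractionRing R F] : Module.Flat S (OrderExt R E S) :=
  have : Module.Flat R F := IsLocalization.flat F (nonZeroDivisors R)
  have : Module.Flat R E := Module.Flat.trans R F E
  inferInstance

instance isArtinianRing_orderExt [Module.Finite R S] : IsArtinianRing (OrderExt R F S) := by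
  have : IsArtinianRing (F ⊗[R] S) := IsArtinianRing.of_finite F _
  exact (Algebra.TensorProduct.comm R F S).toRingEquiv.surjective.isArtinianRing
    (f := (Algebra.TensorProduct.comm R F S).toRingEquiv.toRingHom)

end

/-! ### Primitive idempotents and points with values in fields -/

section

theorem exists_primitiveIdem_of_isMaximal {A : Type*} [CommRing A] [IsReduced A]
    [IsArtinianRing A] (n : Ideal A) [hn : n.IsMaximal] :
    ∃ e : A, IsPrimitiveIdem e ∧ n = Ideal.span {1 - e} := by
  have hidem : IsIdempotentElem n := by
    classical
    let eqv := IsArtinianRing.equivPi A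
    refine le_antisymm Ideal.mul_le_left fun x hx => ?_
    let y : A := eqv.symm fun I => if I.asIdeal = n then 0 else 1
    have hy : y ∈ n := by
      have := congrFun (eqv.apply_symm_apply
        fun I : MaximalSpectrum A => if I.asIdeal = n then (0 : A ⧸ I.asIdeal) else 1) ⟨n, hn⟩
      simp only [if_true] at this
      exact Ideal.Quotient.eq_zero_iff_mem.mp this
    have hxy : x = x * y := by
      refine eqv.injective (funext fun I => ?_)
      rw [map_mul, Pi.mul_apply, eqv.apply_symm_apply]
      split_ifs with h
      · rw [mul_zero]
        exact Ideal.Quotient.eq_zero_iff_mem.mpr (h ▸ hx)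
      · rw [mul_one]
    rw [hxy]
    exact Ideal.mul_mem_mul hx hy
  obtain ⟨f, hf, hnf⟩ := (Ideal.isIdempotentElem_iff_of_fg n (IsNoetherian.noetherian n)).mp hidem
  refine ⟨1 - f, ⟨hf.one_sub, ?_, ?_⟩, by rw [sub_sub_cancel, hnf]⟩
  · intro h
    refine hn.ne_top ((Ideal.eq_top_iff_one n).mpr ?_)
    rw [sub_eq_zero.mp h, hnf]
    exact Ideal.mem_span_singleton_self f
  · intro g hg hgf
    have hgg : g * (1 - g) ∈ n := by rw [mul_sub, mul_one, hg.eq, sub_self]; exact n.zero_mem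
    have hmem : ∀ x ∈ n, x * (1 - f) = 0 := fun x hx => by
      rw [hnf] at hx
      obtain ⟨c, rfl⟩ := Ideal.mem_span_singleton'.mp hx
      rw [mul_assoc, mul_sub, mul_one, hf.eq, sub_self, mul_zero]
    rcases hn.isPrime.mem_or_mem hgg with h | h
    · left; rw [← hgf, hmem g h]
    · right
      have := hmem _ h
      rw [sub_mul, one_mul, hgf] at this
      exact (sub_eq_zero.mp this).symm

variable {A : Type*} [CommRing A]

theorem IsPrimitiveIdem.mul_eq_zero_of_ne {e e' : A} (he : IsPrimitiveIdem e)
    (he' : IsPrimitiveIdem e') (h : e ≠ e') : e * e' = 0 := by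
  have hid : IsIdempotentElem (e * e') := he.1.mul he'.1
  rcases he.2.2 _ hid (by rw [mul_assoc, mul_comm e' e, ← mul_assoc, he.1.eq]) with h1 | h1
  · exact h1
  · rcases he'.2.2 _ hid (by rw [mul_assoc, he'.1.eq]) with h2 | h2
    · exact h2
    · exact absurd (h1.symm.trans h2) h

theorem finite_setOf_isPrimitiveIdem [IsArtinianRing A] : {e : A | IsPrimitiveIdem e}.Finite := by
  have h1 : ∀ e : {e : A | IsPrimitiveIdem e}, ∃ n : MaximalSpectrum A, (1 - e : A) ∈ n.asIdeal :=
    fun e => by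
      have hne : Ideal.span {1 - (e : A)} ≠ ⊤ := by
        rw [Ne, Ideal.span_singleton_eq_top]
        intro hu
        refine e.2.2.1 (hu.mul_left_cancel ?_)
        rw [mul_zero, sub_mul, one_mul, e.2.1.eq, sub_self]
      obtain ⟨n, hn, hle⟩ := Ideal.exists_le_maximal _ hne
      exact ⟨⟨n, hn⟩, hle (Ideal.mem_span_singleton_self _)⟩
  choose n hn using h1
  have hinj : Function.Injective n := fun e e' h => by
    by_contra hne
    have h0 := e.2.mul_eq_zero_of_ne e'.2 fun h => hne (Subtype.ext h)
    refine (n e).isMaximal.ne_top ((Ideal.eq_top_iff_one _).mpr ?_)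
    have h2 : (1 : A) = (1 - e) + e * (1 - e') := by rw [mul_sub, h0]; ring
    rw [h2]
    exact add_mem (hn e) (Ideal.mul_mem_left _ _ (h ▸ hn e'))
  exact Set.finite_coe_iff.mp (Finite.of_injective n hinj)

theorem map_finsum_primitiveIdem [IsArtinianRing A] {K : Type*} [Field K] (f : A →+* K) {e : A}
    (he : IsPrimitiveIdem e) (hfe : f e = 1) (q : A → Prop) [Decidable (q e)] :
    f (∑ᶠ (e : A) (_ : IsPrimitiveIdem e ∧ q e), e) = if q e then 1 else 0 := by
  classical
  have hfin : {e : A | IsPrimitiveIdem e ∧ q e}.Finite :=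
    finite_setOf_isPrimitiveIdem.subset fun e h => h.1
  have h0 : ∀ e' : A, IsPrimitiveIdem e' → e' ≠ e → f e' = 0 := fun e' he' hne => by
    have := congrArg f (he'.mul_eq_zero_of_ne he hne)
    rwa [map_mul, hfe, mul_one, map_zero] at this
  rw [show (∑ᶠ (e : A) (_ : IsPrimitiveIdem e ∧ q e), e) =
    ∑ᶠ (e : A) (_ : e ∈ {e : A | IsPrimitiveIdem e ∧ q e}), e from rfl,
    finsum_mem_eq_finite_toFinset_sum _ hfin, map_sum]
  split_ifs with h
  · rw [Finset.sum_eq_single e, hfe]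
    · intro e' he' hne
      exact h0 e' ((hfin.mem_toFinset.mp he').1) hne
    · exact fun hn => absurd (hfin.mem_toFinset.mpr ⟨he, h⟩) hn
  · refine Finset.sum_eq_zero fun e' he' => ?_
    have hm := hfin.mem_toFinset.mp he'
    exact h0 e' hm.1 fun h' => h (h' ▸ hm.2)

end

section

variable {R F S : Type*} [CommRing R] [Field F] [Algebra R F] [IsFractionRing R F] [CommRing S]
  [Algebra R S] [Module.Finite R S]

theorem finrank_tensorProduct_of_field {S : Type*} [CommRing S] (Q K : Type*) [Field Q] [Field K]
    [Algebra S Q] [Algebra S K] [Algebra Q K] [IsScalarTower S Q K] (M : Type*) [AddCommGroup M]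
    [Module S M] : Module.finrank Q (Q ⊗[S] M) = Module.finrank K (K ⊗[S] M) := by
  rw [← Module.finrank_baseChange (R := K) (S := Q)]
  exact (AlgebraTensorModule.cancelBaseChange S Q K K M).finrank_eq

/-- A point of `A` with values in a field lies on exactly one simple component of `A`, and the
ranks at that component are dimensions of base changes to the field. -/
theorem exists_primitiveIdem_of_ringHom [IsReduced (OrderExt R F S)] {K : Type*} [Field K]
    [Algebra S K] (f : OrderExt R F S →ₐ[S] K) :
    ∃ e : OrderExt R F S, IsPrimitiveIdem e ∧ f e = 1 ∧
      (∀ (M : Type*) [AddCommGroup M] [Module S M],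
        rankAt R F e M = Module.finrank K (K ⊗[S] M)) ∧
      Module.Flat S (OrderExt R F S ⧸ Ideal.span {1 - e}) := by
  have hmax : (RingHom.ker f.toRingHom).IsMaximal :=
    have := RingHom.ker_isPrime f.toRingHom
    inferInstance
  obtain ⟨e, he, hker⟩ := exists_primitiveIdem_of_isMaximal (RingHom.ker f.toRingHom)
  have hfe : f e = 1 := by
    have : 1 - e ∈ RingHom.ker f.toRingHom := hker ▸ Ideal.mem_span_singleton_self _
    have h2 : f (1 - e) = 0 := this
    rw [map_sub, map_one] at h2
    exact (sub_eq_zero.mp h2).symm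
  refine ⟨e, he, hfe, fun M _ _ => ?_, ?_⟩
  · rw [hker] at hmax
    let _ : Field (OrderExt R F S ⧸ Ideal.span {1 - e}) := Ideal.Quotient.field _
    let g : (OrderExt R F S ⧸ Ideal.span {1 - e}) →ₐ[S] K :=
      Ideal.Quotient.liftₐ _ f fun a ha => by
        rw [← hker] at ha
        exact ha
    let _ : Algebra (OrderExt R F S ⧸ Ideal.span {1 - e}) K := g.toRingHom.toAlgebra
    have : IsScalarTower S (OrderExt R F S ⧸ Ideal.span {1 - e}) K :=
      IsScalarTower.of_algebraMap_eq fun r => (g.commutes r).symm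
    exact finrank_tensorProduct_of_field (OrderExt R F S ⧸ Ideal.span {1 - e}) K M
  · -- the quotient is a direct summand of the ring
    let σ : (OrderExt R F S ⧸ Ideal.span {1 - e}) →ₗ[OrderExt R F S] OrderExt R F S :=
      Submodule.liftQ _ (LinearMap.toSpanSingleton _ _ e) (by
        rw [Ideal.span, Submodule.span_le, Set.singleton_subset_iff]
        change (1 - e) * e = 0
        rw [sub_mul, one_mul, he.1.eq, sub_self])
    have hσ : (Submodule.mkQ (Ideal.span {1 - e})) ∘ₗ σ = LinearMap.id := by
      refine Submodule.linearMap_qext _ (LinearMap.ext fun x => ?_)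
      change Submodule.Quotient.mk (x * e) = Submodule.Quotient.mk x
      rw [Submodule.Quotient.eq]
      exact Ideal.mem_span_singleton'.mpr ⟨-x, by ring⟩
    have : Module.Projective (OrderExt R F S) (OrderExt R F S ⧸ Ideal.span {1 - e}) :=
      Module.Projective.of_split σ _ hσ
    exact Module.Flat.trans S (OrderExt R F S) _

end

/-! ### The bordered determinant of a two-term complex -/

/-- A two-term complex `diff : O → V` with cohomology `M` and `N`, together with an isomorphism
`B ⊗ O ≃ B ⊗ V` that is assembled from `diff`, from the isomorphism `lam : B ⊗ M ≃ B ⊗ N`, from a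
retraction of `B ⊗ M → B ⊗ O` and from a section of `B ⊗ V → B ⊗ N`. -/
structure TwoTermModel {S B M N : Type*} [CommRing S] [CommRing B] [Algebra S B]
    [AddCommGroup M] [Module S M] [AddCommGroup N] [Module S N]
    (lam : (B ⊗[S] M) ≃ₗ[B] (B ⊗[S] N)) (O V : Type*) [AddCommGroup O] [Module S O]
    [AddCommGroup V] [Module S V] where
  /-- the differential -/
  diff : O →ₗ[S] V
  /-- the inclusion of the kernel -/
  incl : M →ₗ[S] O
  /-- the projection to the cokernel -/
  proj : V →ₗ[S] N
  incl_injective : Function.Injective incl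
  exact_left : Function.Exact incl diff
  exact_right : Function.Exact diff proj
  proj_surjective : Function.Surjective proj
  /-- the retraction of `B ⊗ M → B ⊗ O` -/
  retr : B ⊗[S] O →ₗ[B] B ⊗[S] M
  /-- the isomorphism of the two terms over `B` -/
  iso : (B ⊗[S] O) ≃ₗ[B] (B ⊗[S] V)
  diff_eq : diff.baseChange B =
    iso.toLinearMap ∘ₗ (LinearMap.id - incl.baseChange B ∘ₗ retr)
  retr_incl : retr ∘ₗ incl.baseChange B = LinearMap.id
  proj_iso : proj.baseChange B ∘ₗ iso.toLinearMap = lam.toLinearMap ∘ₗ retr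

section Point

variable {S B K : Type*} [CommRing S] [CommRing B] [Algebra S B] [Field K] [Algebra S K]
  (g : B →ₐ[S] K) {N : Type*} [AddCommGroup N] [Module S N]

/-- Evaluation of elements of `B ⊗ N` at a point `g` of `B`. -/
def pointEval (N : Type*) [AddCommGroup N] [Module S N] : B ⊗[S] N →ₗ[S] K ⊗[S] N :=
  g.toLinearMap.rTensor N

theorem pointEval_tmul (c : B) (n : N) : pointEval g N (c ⊗ₜ[S] n) = g c ⊗ₜ[S] n := rfl

theorem pointEval_smul (c : B) (x : B ⊗[S] N) :
    pointEval g N (c • x) = g c • pointEval g N x := by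
  induction x using TensorProduct.induction_on with
  | zero => simp
  | add x y hx hy => rw [smul_add, map_add, hx, hy, map_add, smul_add]
  | tmul d n =>
    rw [TensorProduct.smul_tmul', smul_eq_mul, pointEval_tmul, pointEval_tmul, map_mul,
      TensorProduct.smul_tmul', smul_eq_mul]

/-- The functional on `K ⊗ N` that a functional on `B ⊗ N` induces at a point `g` of `B`. -/
def pointDual (φ : B ⊗[S] N →ₗ[B] B) : K ⊗[S] N →ₗ[K] K :=
  AlgebraTensorModule.lift ((LinearMap.toSpanSingleton K (N →ₗ[S] K)
    (g.toLinearMap ∘ₗ φ.restrictScalars S ∘ₗ TensorProduct.mk S B N 1)))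

theorem pointDual_pointEval (φ : B ⊗[S] N →ₗ[B] B) (x : B ⊗[S] N) :
    pointDual g φ (pointEval g N x) = g (φ x) := by
  induction x using TensorProduct.induction_on with
  | zero => simp
  | add x y hx hy => rw [map_add, map_add, hx, hy, map_add, map_add]
  | tmul c n =>
    have h : c ⊗ₜ[S] n = c • ((1 : B) ⊗ₜ[S] n) := by
      rw [TensorProduct.smul_tmul', smul_eq_mul, mul_one]
    have h2 : pointDual g φ (pointEval g N (c ⊗ₜ[S] n)) = g c * g (φ ((1 : B) ⊗ₜ[S] n)) := rfl
    rw [h2, h, map_smul, smul_eq_mul, map_mul]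

theorem linearMap_ext_pointEval {P : Type*} [AddCommGroup P] [Module K P] [Module S P]
    [IsScalarTower S K P] {f₁ f₂ : K ⊗[S] N →ₗ[K] P}
    (h : ∀ x, f₁ (pointEval g N x) = f₂ (pointEval g N x)) :
    f₁ = f₂ := by
  refine AlgebraTensorModule.curry_injective (LinearMap.ext_ring (LinearMap.ext fun n => ?_))
  have := h ((1 : B) ⊗ₜ[S] n)
  rw [pointEval_tmul, map_one] at this
  exact this

end Point

section

open Matrix

variable {S B : Type*} [CommRing S] [CommRing B] [Algebra S B] {M N O V : Type*}
  [AddCommGroup M] [Module S M] [AddCommGroup N] [Module S N] [AddCommGroup O] [Module S O]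
  [AddCommGroup V] [Module S V] {s : S} {D a : ℕ}

/-- The matrix of `diff`, bordered by the vectors `z` and the functionals `ψ`. -/
def borderedMatrix (diff : O →ₗ[S] V) (b : LocalBasis S s D O) (b' : LocalBasis S s D V)
    (ψ : Fin a → Module.Dual S O) (z : Fin a → V) (c : Matrix (Fin a) (Fin a) S) :
    Matrix (Fin D ⊕ Fin a) (Fin D ⊕ Fin a) S :=
  fromBlocks (of fun i j => b'.coord i (diff (b.vec j))) (of fun i j => b'.coord i (z j))
    (of fun i j => ψ i (b.vec j)) c

variable {lam : (B ⊗[S] M) ≃ₗ[B] (B ⊗[S] N)} (d : TwoTermModel lam O V)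

/-- The values `ψ (lam⁻¹ (proj z))`. -/
def TwoTermModel.valueMatrix (ψ : Fin a → Module.Dual S O) (z : Fin a → V) :
    Matrix (Fin a) (Fin a) B :=
  of fun i j => (ψ i).baseChange B
    (d.incl.baseChange B (lam.symm ((1 : B) ⊗ₜ[S] d.proj (z j))))

/-- The bordered determinant at a point of `B`: it vanishes if the rank of `N` exceeds `a`, and is
the value of `ψ₁ ∧ ... ∧ ψₐ` at `lam⁻¹ (z₁ ∧ ... ∧ zₐ)`, up to a determinant, if the rank is `a`. -/
theorem TwoTermModel.map_det_borderedMatrix [Module.Finite S N] {K : Type*} [Field K] [Algebra S K]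
    (g : B →ₐ[S] K) (b : LocalBasis S s D O) (b' : LocalBasis S s D V)
    (hs : algebraMap S K s ≠ 0) (ψ : Fin a → Module.Dual S O) (z : Fin a → V)
    (c : Matrix (Fin a) (Fin a) S) :
    (a < Module.finrank K (K ⊗[S] N) →
      algebraMap S K (borderedMatrix d.diff b b' ψ z c).det = 0) ∧
    (Module.finrank K (K ⊗[S] N) = a →
      algebraMap S K (borderedMatrix d.diff b b' ψ z c).det =
        (-1) ^ a * (g (b.toMatrix b' d.iso.toLinearMap).det * g (d.valueMatrix ψ z).det)) := by
  set σ := algebraMap S K s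
  have hσ : g (algebraMap S B s) = σ := g.commutes s
  let bas := Module.finBasis K (K ⊗[S] N)
  set r := Module.finrank K (K ⊗[S] N)
  let φ : Fin D → B ⊗[S] N →ₗ[B] B := fun i =>
    (b.coord i).baseChange B ∘ₗ d.incl.baseChange B ∘ₗ lam.symm.toLinearMap
  let w : Matrix (Fin D) (Fin D) K := (b.toMatrix b' d.iso.toLinearMap).map g
  let P : Matrix (Fin D) (Fin D) B := b.toMatrix b (d.incl.baseChange B ∘ₗ d.retr)
  let k : Matrix (Fin r) (Fin D) K :=
    of fun l i => bas.repr (pointEval g N (lam (d.retr ((1 : B) ⊗ₜ[S] b.vec i)))) l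
  let i : Matrix (Fin D) (Fin r) K := of fun i l => pointDual g (φ i) (bas l)
  let X : Matrix (Fin D) (Fin a) B :=
    of fun i j => (b.coord i).baseChange B (d.iso.symm ((1 : B) ⊗ₜ[S] z j))
  have hrepr : ∀ (θ : K ⊗[S] N →ₗ[K] K) (x : K ⊗[S] N), ∑ l, θ (bas l) * bas.repr x l = θ x := by
    intro θ x
    conv_rhs => rw [← bas.sum_repr x, map_sum]
    exact Finset.sum_congr rfl fun l _ => by rw [map_smul, smul_eq_mul, mul_comm]
  have hik : i * k = P.map g := by
    ext x y
    simp only [Matrix.mul_apply, i, k, of_apply, hrepr, pointDual_pointEval, Matrix.map_apply]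
    simp [φ, P, LocalBasis.toMatrix]
  -- `k i` is multiplication by `s` since the retraction splits the inclusion
  have hki : k * i = σ • (1 : Matrix (Fin r) (Fin r) K) := by
    have h1 : ∑ x, (pointDual g (φ x)).smulRight
        (pointEval g N (lam (d.retr ((1 : B) ⊗ₜ[S] b.vec x)))) = σ • LinearMap.id := by
      refine linearMap_ext_pointEval g fun x => ?_
      rw [LinearMap.sum_apply]
      simp only [LinearMap.smulRight_apply, pointDual_pointEval, ← pointEval_smul,
        LinearMap.smul_apply, LinearMap.id_apply]
      rw [← map_sum, ← hσ, ← pointEval_smul]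
      simp only [← map_smul, ← map_sum]
      congr 1
      have h2 := b.sum_coord_baseChange (d.incl.baseChange B (lam.symm x))
      simp only [φ, LinearMap.comp_apply, LinearEquiv.coe_coe]
      rw [h2, algebra_compatible_smul B s, map_smul, map_smul]
      have h3 := LinearMap.congr_fun d.retr_incl (lam.symm x)
      rw [LinearMap.comp_apply, LinearMap.id_apply] at h3
      rw [h3, lam.apply_symm_apply]
    ext l m
    have h2 := congrArg (fun y => bas.repr y l) (LinearMap.congr_fun h1 (bas m))
    simp only [LinearMap.sum_apply, LinearMap.smulRight_apply, map_sum, map_smul,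
      Finsupp.coe_finsetSum, Finset.sum_apply, Finsupp.smul_apply, smul_eq_mul,
      LinearMap.smul_apply, LinearMap.id_apply, Module.Basis.repr_self] at h2
    rw [Matrix.smul_apply, Matrix.one_apply, smul_eq_mul, Matrix.mul_apply]
    rw [Finsupp.single_apply] at h2
    simp only [k, i, of_apply]
    rw [show (if l = m then (1 : K) else 0) = if m = l then 1 else 0 from by simp [eq_comm], ← h2]
    exact Finset.sum_congr rfl fun x _ => mul_comm _ _
  have hw : w * (σ • (1 : Matrix (Fin D) (Fin D) K) - i * k) =
      σ • (of fun i j => b'.coord i (d.diff (b.vec j))).map (algebraMap S K) := by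
    have h1 : b.toMatrix b (LinearMap.id - d.incl.baseChange B ∘ₗ d.retr) =
        algebraMap S B s • (1 : Matrix (Fin D) (Fin D) B) - P := by
      rw [LocalBasis.toMatrix_sub, LocalBasis.toMatrix_id]
    have h2 := b.toMatrix_mul b b' (LinearMap.id - d.incl.baseChange B ∘ₗ d.retr)
      d.iso.toLinearMap
    rw [← d.diff_eq, LocalBasis.toMatrix_baseChange, h1] at h2
    have h3 := congrArg (fun Y => Y.map g) h2
    simp only [Matrix.map_mul] at h3
    rw [hik]
    convert h3 using 1
    · congr 1
      ext x y
      simp only [Matrix.map_apply, Matrix.sub_apply, Matrix.smul_apply, smul_eq_mul, map_sub,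
        map_mul, hσ, Matrix.one_apply, apply_ite g, map_one, map_zero]
    · ext x y
      simp only [Matrix.map_apply, Matrix.smul_apply, smul_eq_mul, map_mul, hσ, AlgHom.commutes]
  have hX : w * X.map g = σ • (of fun i j => b'.coord i (z j)).map (algebraMap S K) := by
    rw [← Matrix.map_mul]
    ext x y
    have h1 := b.sum_coord_mul ((b'.coord x).baseChange B ∘ₗ d.iso.toLinearMap)
      (d.iso.symm ((1 : B) ⊗ₜ[S] z y))
    have h2 : (b.toMatrix b' d.iso.toLinearMap * X) x y =
        algebraMap S B s * algebraMap S B (b'.coord x (z y)) := by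
      rw [Matrix.mul_apply]
      refine Eq.trans h1 ?_
      simp [Algebra.smul_def]
    rw [Matrix.map_apply, h2]
    simp [hσ]
  have hT : algebraMap S K (borderedMatrix d.diff b b' ψ z c).det =
      (fromBlocks ((of fun i j => b'.coord i (d.diff (b.vec j))).map (algebraMap S K))
        ((of fun i j => b'.coord i (z j)).map (algebraMap S K))
        ((of fun i j => ψ i (b.vec j)).map (algebraMap S K)) (c.map (algebraMap S K))).det := by
    rw [RingHom.map_det, RingHom.mapMatrix_apply, borderedMatrix, fromBlocks_map]
  have hfield := det_fromBlocks_of_projector hs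
    ((of fun i j => ψ i (b.vec j)).map (algebraMap S K)) (c.map (algebraMap S K)) hki hw hX
  rw [← hT, Fintype.card_fin, Fintype.card_fin] at hfield
  refine ⟨hfield.1, fun hr => ?_⟩
  rw [hfield.2 (finCongr hr), AlgHom.map_det, AlgHom.map_det]
  congr 3
  rw [inv_pow, inv_smul_eq_iff₀ (pow_ne_zero 2 hs), Matrix.mul_assoc, ← Matrix.mul_assoc i k]
  rw [hik, ← Matrix.map_mul]
  have hpsi : (of fun i j => ψ i (b.vec j)).map (algebraMap S K) =
      ((of fun i j => ψ i (b.vec j)).map (algebraMap S B)).map g := by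
    ext x y; simp
  rw [hpsi, ← Matrix.map_mul]
  have hPX : ∀ x y, (P * X) x y = algebraMap S B s * (b.coord x).baseChange B
      (d.incl.baseChange B (lam.symm ((1 : B) ⊗ₜ[S] d.proj (z y)))) := fun x y => by
    have h1 := b.sum_coord_mul ((b.coord x).baseChange B ∘ₗ d.incl.baseChange B ∘ₗ d.retr)
      (d.iso.symm ((1 : B) ⊗ₜ[S] z y))
    have h2 := LinearMap.congr_fun d.proj_iso (d.iso.symm ((1 : B) ⊗ₜ[S] z y))
    simp only [LinearMap.comp_apply, LinearEquiv.coe_coe, LinearEquiv.apply_symm_apply,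
      LinearMap.baseChange_tmul] at h2
    rw [Matrix.mul_apply]
    refine Eq.trans h1 ?_
    rw [h2, lam.symm_apply_apply]
    rfl
  ext x y
  have h4 := b.sum_coord_mul ((ψ x).baseChange B)
    (d.incl.baseChange B (lam.symm ((1 : B) ⊗ₜ[S] d.proj (z y))))
  rw [Matrix.map_apply, Matrix.mul_apply, Matrix.smul_apply]
  simp only [hPX]
  have h5 : ∑ j, ((of fun i j => ψ i (b.vec j)).map (algebraMap S B)) x j *
      (algebraMap S B s * (b.coord j).baseChange B
        (d.incl.baseChange B (lam.symm ((1 : B) ⊗ₜ[S] d.proj (z y))))) =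
      algebraMap S B s ^ 2 * d.valueMatrix ψ z x y := by
    rw [sq, mul_assoc, TwoTermModel.valueMatrix, of_apply, ← h4, Finset.mul_sum]
    refine Finset.sum_congr rfl fun j _ => ?_
    simp only [Matrix.map_apply, of_apply, Module.Dual.baseChange_apply_tmul, Algebra.smul_def]
    ring
  rw [h5]
  simp [hσ]

end

/-! ### Fitting ideals -/

section

open Matrix

variable {S N : Type*} [CommRing S] [AddCommGroup N] [Module S N]

/-- The generators of the Fitting ideal with arbitrary finite index types. -/
theorem minor_mem_fittingIdeal {ι κ : Type*} [Fintype ι] [DecidableEq ι] [Fintype κ] {a : ℕ}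
    (g : (κ → S) →ₗ[S] N) (hg : Function.Surjective g)
    (hcard : Fintype.card κ = Fintype.card ι + a) (r : ι → LinearMap.ker g) (c : ι → κ) :
    (of fun i j => (r i : κ → S) (c j)).det ∈ fittingIdeal S N a := by
  classical
  let n := Fintype.card κ
  let e : κ ≃ Fin n := Fintype.equivFin κ
  have hn : n - a = Fintype.card ι := by omega
  let f : ι ≃ Fin (n - a) := (Fintype.equivFin ι).trans (finCongr hn.symm)
  let g' : (Fin n → S) →ₗ[S] N := g ∘ₗ LinearMap.funLeft S S e
  refine Ideal.subset_span ⟨n, g', hg.comp (LinearMap.funLeft_surjective_of_injective S S e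
    e.injective), fun i => ⟨fun j => (r (f.symm i) : κ → S) (e.symm j), ?_⟩,
    fun j => e (c (f.symm j)), ?_⟩
  · have h1 : LinearMap.funLeft S S e (fun j => (r (f.symm i) : κ → S) (e.symm j)) =
        (r (f.symm i) : κ → S) := by
      ext j; simp [LinearMap.funLeft_apply]
    rw [LinearMap.mem_ker, LinearMap.comp_apply, h1]
    exact (r (f.symm i)).2
  · rw [← det_submatrix_equiv_self f.symm]
    congr 1
    ext i j
    simp

/-- Bordered determinants of a presentation up to a scalar lie in the Fitting ideal up to a power
of that scalar: adding the images of the bordering vectors, and any finite set of generators, to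
the generators of the presentation turns them into minors of relations. -/
theorem exists_pow_mul_det_borderedMatrix_mem [Module.Finite S N] {O V : Type*} [AddCommGroup O]
    [Module S O] [AddCommGroup V] [Module S V] {s : S} {D a : ℕ} (diff : O →ₗ[S] V)
    (proj : V →ₗ[S] N) (hex : Function.Exact diff proj) (hproj : Function.Surjective proj)
    (b : LocalBasis S s D O) (b' : LocalBasis S s D V) :
    ∃ m : ℕ, ∀ (ψ : Fin a → Module.Dual S O) (z : Fin a → V) (c : Matrix (Fin a) (Fin a) S),
      s ^ m * (borderedMatrix diff b b' ψ z c).det ∈ fittingIdeal S N a := by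
  obtain ⟨m, gen, hgen⟩ := Module.Finite.exists_fin (R := S) (M := N)
  choose y hy using fun k => hproj (gen k)
  refine ⟨m, fun ψ z c => ?_⟩
  let w : ((Fin D ⊕ Fin a) ⊕ Fin m) ⊕ Fin a → N := Sum.elim
    (Sum.elim (Sum.elim (fun i => proj (b'.vec i)) fun _ => 0) gen) fun j => proj (z j)
  let g := Fintype.linearCombination S w
  have hg : Function.Surjective g := by
    rw [← LinearMap.range_eq_top, Fintype.range_linearCombination, eq_top_iff, ← hgen]
    refine Submodule.span_mono ?_
    rintro _ ⟨k, rfl⟩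
    exact ⟨Sum.inl (Sum.inr k), rfl⟩
  have hcoord : ∀ v : V, ∑ i, b'.coord i v • proj (b'.vec i) = s • proj v := fun v => by
    rw [← map_smul, ← b'.sum_coord, map_sum]
    simp
  let rel : (Fin D ⊕ Fin a) ⊕ Fin m → (((Fin D ⊕ Fin a) ⊕ Fin m) ⊕ Fin a → S) := Sum.elim
    (Sum.elim
      (fun j => Sum.elim (Sum.elim (Sum.elim (fun i => b'.coord i (diff (b.vec j)))
        fun i => ψ i (b.vec j)) 0) 0)
      (fun j => Sum.elim (Sum.elim (Sum.elim (fun i => b'.coord i (z j))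
        fun i => c i j) 0) (Pi.single j (-s))))
    (fun k => Sum.elim (Sum.elim (Sum.elim (fun i => -b'.coord i (y k)) 0)
      (Pi.single k s)) 0)
  have hrel : ∀ i, rel i ∈ LinearMap.ker g := by
    intro i
    rw [LinearMap.mem_ker, Fintype.linearCombination_apply]
    rcases i with (j | j) | k
    · simp [rel, w, hcoord, hex.apply_apply_eq_zero]
    · simp [rel, w, hcoord, Pi.single_apply, ite_smul]
    · simp [rel, w, hcoord, Pi.single_apply, ite_smul, hy]
  have hdet := minor_mem_fittingIdeal (a := a) g hg (by simp) (fun i => ⟨rel i, hrel i⟩) Sum.inl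
  rw [← det_transpose] at hdet
  have hT : (of fun i j => rel i (Sum.inl j)).transpose = fromBlocks
      (borderedMatrix diff b b' ψ z c) (of fun i k => Sum.elim (fun i => -b'.coord i (y k)) 0 i)
      0 (s • (1 : Matrix (Fin m) (Fin m) S)) := by
    ext i j
    rcases i with (i | i) | i <;> rcases j with (j | j) | j <;>
      simp [rel, borderedMatrix, Pi.single_apply, Matrix.one_apply]
  rw [hT, det_fromBlocks_zero₂₁, det_smul, det_one, mul_one, Fintype.card_fin, mul_comm] at hdet
  exact hdet

theorem fittingIdeal_le_of_surjective {N' : Type*} [AddCommGroup N'] [Module S N']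
    (f : N →ₗ[S] N') (hf : Function.Surjective f) (a : ℕ) :
    fittingIdeal S N a ≤ fittingIdeal S N' a := by
  refine Ideal.span_le.mpr ?_
  rintro _ ⟨n, g, hg, r, c, rfl⟩
  refine Ideal.subset_span ⟨n, f ∘ₗ g, hf.comp hg, fun i => ⟨r i, ?_⟩, c, rfl⟩
  rw [LinearMap.mem_ker, LinearMap.comp_apply, (r i).2, map_zero]

/-- More than `n - r` vectors that span relations of rank `n - r` have vanishing minors. -/
theorem det_eq_zero_of_relations {K : Type*} [Field K] [Algebra S K] {n : ℕ}
    (g : (Fin n → S) →ₗ[S] N) (hg : Function.Surjective g) {ι : Type*} [Fintype ι]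
    [DecidableEq ι] (v : ι → Fin n → S)
    (hv : ∀ i, (1 : K) ⊗ₜ[S] g (v i) = 0) (c : ι → Fin n)
    (hcard : n < Fintype.card ι + Module.finrank K (K ⊗[S] N)) :
    algebraMap S K (of fun i j => v i (c j)).det = 0 := by
  let gK : (Fin n → K) →ₗ[K] K ⊗[S] N :=
    Fintype.linearCombination K fun j => (1 : K) ⊗ₜ[S] g (Pi.single j 1)
  have hgK : ∀ w : Fin n → S, gK (algebraMap S K ∘ w) = (1 : K) ⊗ₜ[S] g w := fun w => by
    have h1 : w = ∑ j, w j • Pi.single j (1 : S) := by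
      ext i; simp [Finset.sum_apply, Pi.single_apply]
    conv_rhs => rw [h1, map_sum, TensorProduct.tmul_sum]
    rw [Fintype.linearCombination_apply]
    refine Finset.sum_congr rfl fun j _ => ?_
    rw [map_smul, TensorProduct.tmul_smul, Function.comp_apply, ← algebra_compatible_smul]
  have hsurj : Function.Surjective gK := by
    rw [← LinearMap.range_eq_top, eq_top_iff]
    rintro x -
    induction x using TensorProduct.induction_on with
    | zero => exact zero_mem _
    | add x y hx hy => exact add_mem hx hy
    | tmul k m =>
      obtain ⟨w, rfl⟩ := hg m
      have : k ⊗ₜ[S] g w = k • ((1 : K) ⊗ₜ[S] g w) := by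
        rw [TensorProduct.smul_tmul', smul_eq_mul, mul_one]
      rw [this, ← hgK]
      exact Submodule.smul_mem _ _ ⟨_, rfl⟩
  have hker : Module.finrank K (LinearMap.ker gK) + Module.finrank K (K ⊗[S] N) = n := by
    have h1 := LinearMap.finrank_range_add_finrank_ker gK
    rw [LinearMap.range_eq_top.mpr hsurj, finrank_top, Module.finrank_fin_fun] at h1
    omega
  have hdep : ¬ LinearIndependent K fun i => (⟨algebraMap S K ∘ v i, by
      rw [LinearMap.mem_ker, hgK, hv]⟩ : LinearMap.ker gK) := fun h => by
    have := h.fintype_card_le_finrank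
    omega
  rw [Fintype.not_linearIndependent_iff] at hdep
  obtain ⟨k, hk, i, hi⟩ := hdep
  rw [RingHom.map_det]
  refine exists_vecMul_eq_zero_iff.mp ⟨k, fun h => hi (congrFun h i), ?_⟩
  ext j
  have h2 := congrFun (congrArg Subtype.val hk) (c j)
  simpa [Matrix.vecMul, dotProduct] using h2

/-- Cramer's rule: a minor of relations, times any vector, is a relation up to the bordered
minors, which are larger by one. -/
theorem det_mul_mem_ker_of_bordered {n : ℕ} (g : (Fin n → S) →ₗ[S] N) {ι : Type*} [Fintype ι]
    [DecidableEq ι] (r : ι → LinearMap.ker g) (c : ι → Fin n) (w : Fin n → S) (t : S)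
    (h : ∀ j, t * (of fun i k => (Sum.elim (fun i => (r i : Fin n → S)) (fun _ : Unit => w) i)
      (Sum.elim c (fun _ => j) k)).det = 0) :
    g ((t * (of fun i j => (r i : Fin n → S) (c j)).det) • w) = 0 := by
  set P : Matrix ι ι S := of fun i j => (r i : Fin n → S) (c j)
  -- the cofactors of the last column of the bordered matrix do not depend on that column
  let M : Matrix (ι ⊕ Unit) (ι ⊕ Unit) S := fromBlocks P 0 (of fun _ k => w (c k)) 0
  have hM : ∀ col : ι ⊕ Unit → S, (M.updateCol (Sum.inr ()) col).det =
      ∑ i, M.adjugate (Sum.inr ()) (Sum.inl i) * col (Sum.inl i) +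
        M.adjugate (Sum.inr ()) (Sum.inr ()) * col (Sum.inr ()) := fun col => by
    rw [← cramer_apply, cramer_eq_adjugate_mulVec]
    simp [Matrix.mulVec, dotProduct]
  have hP : M.adjugate (Sum.inr ()) (Sum.inr ()) = P.det := by
    have h1 := hM (Pi.single (Sum.inr ()) 1)
    have h2 : M.updateCol (Sum.inr ()) (Pi.single (Sum.inr ()) 1) =
        fromBlocks P 0 (of fun _ k => w (c k)) 1 := by
      ext i k
      rcases i with i | i <;> rcases k with k | k <;>
        simp [M]
    rw [h2, det_fromBlocks_zero₁₂, det_one, mul_one] at h1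
    rw [h1]
    simp
  let q : Fin n → S := -∑ i, M.adjugate (Sum.inr ()) (Sum.inl i) • (r i : Fin n → S)
  have hq : g q = 0 := by
    have : q ∈ LinearMap.ker g :=
      neg_mem (Submodule.sum_mem _ fun i _ => Submodule.smul_mem _ _ (r i).2)
    exact this
  have key : ∀ j, (of fun i k => (Sum.elim (fun i => (r i : Fin n → S)) (fun _ : Unit => w) i)
      (Sum.elim c (fun _ => j) k)).det = P.det * w j - q j := by
    intro j
    have h1 := hM (Sum.elim (fun i => (r i : Fin n → S) j) fun _ => w j)
    have h2 : M.updateCol (Sum.inr ()) (Sum.elim (fun i => (r i : Fin n → S) j) fun _ => w j) =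
        of fun i k => (Sum.elim (fun i => (r i : Fin n → S)) (fun _ : Unit => w) i)
          (Sum.elim c (fun _ => j) k) := by
      ext i k
      rcases i with i | i <;> rcases k with k | k <;>
        simp [M, P]
    rw [← h2, h1, hP]
    simp [q, Finset.sum_apply]
    ring
  have h2 : (t * P.det) • w = t • q := by
    ext j
    have := h j
    rw [key] at this
    simp only [Pi.smul_apply, smul_eq_mul]
    linear_combination this
  rw [h2, map_smul, hq, smul_zero]

end

/-! ### The integral consequences of the bordered determinant formula -/

theorem eq_zero_of_forall_residueField {B : Type*} [CommRing B] [IsReduced B] (x : B)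
    (h : ∀ (p : Ideal B) [p.IsPrime], algebraMap B p.ResidueField x = 0) : x = 0 := by
  refine (mem_nilradical.mp ?_ : IsNilpotent x).eq_zero
  rw [nilradical_eq_sInf]
  exact Ideal.mem_sInf.mpr fun {p} (hp : p.IsPrime) => by simpa using h p

/-- Membership in a submodule can be checked locally. -/
theorem mem_of_forall_isMaximal_exists_smul_mem {S B : Type*} [CommRing S] [AddCommGroup B]
    [Module S B] (W : Submodule S B) (w : B)
    (h : ∀ m : Ideal S, m.IsMaximal → ∃ s ∉ m, s • w ∈ W) : w ∈ W := by
  let J : Ideal S := W.comap (LinearMap.toSpanSingleton S B w)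
  have hJ : J = ⊤ := by
    by_contra hne
    obtain ⟨m, hm, hle⟩ := Ideal.exists_le_maximal J hne
    obtain ⟨s, hs, hsw⟩ := h m hm
    exact hs (hle hsw)
  have h1 : (1 : S) ∈ J := hJ ▸ trivial
  simpa [J] using h1

section

variable {R F E S : Type*} [CommRing R] [Field F] [Algebra R F]
  [IsFractionRing R F] [CommRing S] [Algebra R S] [Module.Finite R S]

/-- The value of `e_(a)` at a point of `A` tells whether the rank of `N` there is at least `a`. -/
theorem map_idemGe [IsReduced (OrderExt R F S)] (N : Type*) [AddCommGroup N]
    [Module S N] (a : ℕ) {K : Type*} [Field K] [Algebra S K] (f : OrderExt R F S →ₐ[S] K) :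
    f (idemGe R F N a) = if a ≤ Module.finrank K (K ⊗[S] N) then 1 else 0 := by
  classical
  obtain ⟨e, he, hfe, hrank, -⟩ := exists_primitiveIdem_of_ringHom f
  have h1 := map_finsum_primitiveIdem f.toRingHom he hfe fun e => a ≤ rankAt R F e N
  rw [← hrank N]
  exact h1

/-- The value of an element `t` of `S ∩ S e_(a)` at a point of `A` can only be nonzero if the rank
of `N` at that point is at least `a`. -/
theorem map_eq_zero_or_le_finrank [IsReduced (OrderExt R F S)] {N : Type*} [AddCommGroup N]
    [Module S N] {a : ℕ} {K : Type*} [Field K] [Algebra S K] (f : OrderExt R F S →ₐ[S] K) {t : S}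
    (ht : ∃ b : S, algebraMap S (OrderExt R F S) t =
      algebraMap S (OrderExt R F S) b * idemGe R F N a) :
    algebraMap S K t = 0 ∨ a ≤ Module.finrank K (K ⊗[S] N) := by
  obtain ⟨b, hb⟩ := ht
  have h2 := congrArg f hb
  rw [map_mul, AlgHom.commutes, AlgHom.commutes, map_idemGe] at h2
  split_ifs at h2 with h
  · exact Or.inr h
  · exact Or.inl (h2.trans (mul_zero _))

/-- The value of `e_a` at a point of `A` tells whether the rank of `N` there is `a`. -/
theorem map_idemEq [IsReduced (OrderExt R F S)] (N : Type*) [AddCommGroup N]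
    [Module S N] (a : ℕ) {K : Type*} [Field K] [Algebra S K] (f : OrderExt R F S →ₐ[S] K) :
    f (idemEq R F N a) = if Module.finrank K (K ⊗[S] N) = a then 1 else 0 := by
  classical
  obtain ⟨e, he, hfe, hrank, -⟩ := exists_primitiveIdem_of_ringHom f
  have h1 := map_finsum_primitiveIdem f.toRingHom he hfe fun e => rankAt R F e N = a
  rw [← hrank N]
  exact h1

theorem idemGe_eq_one_of_forall_le [IsReduced (OrderExt R F S)] (N : Type*)
    [AddCommGroup N] [Module S N] (a : ℕ)
    (h : ∀ (p : Ideal (OrderExt R F S)) [p.IsPrime],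
      a ≤ Module.finrank p.ResidueField (p.ResidueField ⊗[S] N)) :
    idemGe R F N a = (1 : OrderExt R F S) := by
  rw [← sub_eq_zero]
  refine eq_zero_of_forall_residueField _ fun p _ => ?_
  let f : OrderExt R F S →ₐ[S] p.ResidueField := IsScalarTower.toAlgHom S _ _
  change f _ = 0
  rw [map_sub, map_one, map_idemGe, if_pos (h p), sub_self]

/-- The Fitting ideal of `H`, multiplied by an element of `S ∩ S e_(a)`, annihilates the torsion
of subquotients of sufficiently large rank. -/
theorem mul_mem_annihilator_rTorsion [IsDedekindDomain R] [Module.IsTorsionFree R S]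
    [IsReduced (OrderExt R F S)] {H : Type*} [AddCommGroup H] [Module S H]
    [Module.Finite S H] {a : ℕ} (V : Submodule S H) (Q : Submodule S V)
    (hrk : ∀ e : OrderExt R F S, IsPrimitiveIdem e → e * idemGe R F H a = e →
      a ≤ rankAt R F e (V ⧸ Q)) {t u : S}
    (ht : ∃ b : S, algebraMap S (OrderExt R F S) t =
      algebraMap S (OrderExt R F S) b * idemGe R F H a) (hu : u ∈ fittingIdeal S H a) :
    t * u ∈ Module.annihilator S (rTorsion R S (V ⧸ Q)) := by
  classical
  let H' := H ⧸ Q.map V.subtype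
  let i : V ⧸ Q →ₗ[S] H' := Submodule.mapQ Q _ V.subtype fun x hx => ⟨x, hx, rfl⟩
  have hi : Function.Injective i := by
    rw [← LinearMap.ker_eq_bot, LinearMap.ker_eq_bot']
    intro x hx
    obtain ⟨x, rfl⟩ := Submodule.mkQ_surjective Q x
    have h1 : (V.subtype x) ∈ Q.map V.subtype := (Submodule.Quotient.mk_eq_zero _).mp hx
    obtain ⟨y, hy, hyx⟩ := h1
    rw [← V.injective_subtype hyx]
    exact (Submodule.Quotient.mk_eq_zero _).mpr hy
  have hu' : u ∈ fittingIdeal S H' a :=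
    fittingIdeal_le_of_surjective (Submodule.mkQ _) (Submodule.mkQ_surjective _) a hu
  clear hu
  rw [Module.mem_annihilator]
  rintro ⟨q, hq⟩
  obtain ⟨⟨_, ρ, hρ, rfl⟩, hρq⟩ := (Submodule.mem_torsion'_iff _ _).mp hq
  refine Subtype.ext (hi ?_)
  rw [Submodule.coe_smul, map_smul, Submodule.coe_zero, map_zero]
  have hρq' : algebraMap R S ρ • i q = 0 := by
    rw [← map_smul]
    exact (congrArg i hρq).trans (map_zero i)
  generalize i q = q' at hρq'
  induction hu' using Submodule.span_induction with
  | zero => rw [mul_zero, zero_smul]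
  | add x y _ _ hx hy => rw [mul_add, add_smul, hx, hy, add_zero]
  | smul c x _ hx => rw [smul_eq_mul, mul_left_comm, mul_smul, hx, smul_zero]
  | mem u hu =>
    obtain ⟨n, g, hg, r, c, rfl⟩ := hu
    obtain ⟨w, rfl⟩ := hg q'
    rw [← map_smul]
    -- by Cramer it suffices that the minor bordered by the rational relation `w` vanishes
    refine det_mul_mem_ker_of_bordered g r c w t fun j => ?_
    refine algebraMap_orderExt_injective R F F S ?_
    rw [map_zero]
    refine eq_zero_of_forall_residueField _ fun p _ => ?_
    let K := p.ResidueField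
    let f : OrderExt R F S →ₐ[S] K := IsScalarTower.toAlgHom S _ _
    rw [← IsScalarTower.algebraMap_apply, map_mul]
    obtain h0 | h0 := map_eq_zero_or_le_finrank f ht
    · rw [h0, zero_mul]
    · obtain ⟨e, he, hfe, hrank, hflat⟩ := exists_primitiveIdem_of_ringHom f
      have hnt : Nontrivial (OrderExt R F S ⧸ Ideal.span {1 - e}) := by
        refine Ideal.Quotient.nontrivial_iff.mpr fun htop => ?_
        have h1 : (1 : OrderExt R F S) ∈ Ideal.span {1 - e} := htop ▸ trivial
        obtain ⟨d, hd⟩ := Ideal.mem_span_singleton'.mp h1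
        have h2 := congrArg f hd
        rw [map_mul, map_sub, map_one, hfe, sub_self, mul_zero] at h2
        exact zero_ne_one h2
      have hge : a ≤ rankAt R F e (V ⧸ Q) := by
        refine hrk e he ?_
        have hid : IsIdempotentElem (idemGe R F H a : OrderExt R F S) := by
          refine sub_eq_zero.mp (eq_zero_of_forall_residueField _ fun p _ => ?_)
          let f' : OrderExt R F S →ₐ[S] p.ResidueField := IsScalarTower.toAlgHom S _ _
          change f' _ = 0
          rw [map_sub, map_mul, map_idemGe H a f']
          split_ifs <;> simp
        rcases he.2.2 (e * idemGe R F H a) (he.1.mul hid) (by rw [mul_right_comm, he.1.eq])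
          with h2 | h2
        · exfalso
          have h4 := congrArg f h2
          rw [map_mul, hfe, one_mul, map_zero, map_idemGe, if_pos h0] at h4
          exact one_ne_zero h4
        · exact h2
      have hle : a ≤ Module.finrank K (K ⊗[S] H') := by
        rw [← hrank H']
        refine hge.trans (LinearMap.finrank_le_finrank_of_injective
          (f := i.baseChange (OrderExt R F S ⧸ Ideal.span {1 - e})) ?_)
        exact Module.Flat.lTensor_preserves_injective_linearMap i hi
      have hrel : ∀ k, (1 : K) ⊗ₜ[S] g (Sum.elim (fun i => (r i : Fin n → S))
          (fun _ : Unit => w) k) = 0 := by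
        rintro (k | k)
        · rw [Sum.elim_inl, (r k).2, TensorProduct.tmul_zero]
        · rw [Sum.elim_inr]
          have hunit : algebraMap S K (algebraMap R S ρ) ≠ 0 := by
            have h1 : IsUnit (algebraMap S (OrderExt R F S) (algebraMap R S ρ)) := by
              have h2 : algebraMap S (OrderExt R F S) (algebraMap R S ρ) =
                  (Algebra.TensorProduct.includeRight : F →ₐ[R] OrderExt R F S)
                    (algebraMap R F ρ) := by
                rw [AlgHom.commutes]
                exact (IsScalarTower.algebraMap_apply R S (OrderExt R F S) ρ).symm
              rw [h2]
              exact (IsLocalization.map_units F ⟨ρ, hρ⟩).map _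
            have h3 := (h1.map f).ne_zero
            rwa [AlgHom.commutes] at h3
          have h4 : algebraMap S K (algebraMap R S ρ) • ((1 : K) ⊗ₜ[S] g w) = 0 := by
            rw [← algebra_compatible_smul, ← TensorProduct.tmul_smul, hρq', TensorProduct.tmul_zero]
          exact (smul_eq_zero.mp h4).resolve_left hunit
      rw [det_eq_zero_of_relations (K := K) g hg _ hrel (Sum.elim c fun _ => j) (by
        rw [Fintype.card_sum, Fintype.card_fin, Fintype.card_unit]
        omega), mul_zero]

end

section

variable {R F E S : Type*} [CommRing R] [Field F] [Algebra R F] [IsFractionRing R F]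
  [Field E] [Algebra R E] [Algebra F E] [IsScalarTower R F E]
  [CommRing S] [Algebra R S] [Module.Finite R S]
  {M N O V : Type*} [AddCommGroup M] [Module S M] [AddCommGroup N] [Module S N]
  [AddCommGroup O] [Module S O] [AddCommGroup V] [Module S V]
  {lam : (OrderExt R E S ⊗[S] M) ≃ₗ[OrderExt R E S] (OrderExt R E S ⊗[S] N)}

/-- The bordered determinant formula over `A_E`, on the components where the rank of `N` is at
least `a`. -/
theorem TwoTermModel.mul_det_borderedMatrix [IsReduced (OrderExt R F S)]
    [IsReduced (OrderExt R E S)] [Module.Finite S N] (d : TwoTermModel lam O V) {s : S} {D a : ℕ}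
    (b : LocalBasis S s D O) (b' : LocalBasis S s D V) (ψ : Fin a → Module.Dual S O)
    (z : Fin a → V) (c : Matrix (Fin a) (Fin a) S) {t : S}
    (ht : ∃ b : S, algebraMap S (OrderExt R F S) t =
      algebraMap S (OrderExt R F S) b * idemGe R F N a) :
    algebraMap S (OrderExt R E S) (s * t * (borderedMatrix d.diff b b' ψ z c).det) =
      algebraMap S (OrderExt R E S) (s * t * (-1) ^ a) *
        ((b.toMatrix b' d.iso.toLinearMap).det *
          (extMap R F E S (idemEq R F N a) * (d.valueMatrix ψ z).det)) := by
  rw [← sub_eq_zero]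
  refine eq_zero_of_forall_residueField _ fun p _ => ?_
  let K := p.ResidueField
  let g : OrderExt R E S →ₐ[S] K := IsScalarTower.toAlgHom S _ _
  let f : OrderExt R F S →ₐ[S] K := g.comp (extMap R F E S)
  change g _ = 0
  rw [map_sub, sub_eq_zero, AlgHom.commutes, map_mul g, AlgHom.commutes, map_mul g, map_mul g,
    show g (extMap R F E S (idemEq R F N a)) = _ from map_idemEq N a f]
  simp only [map_mul]
  by_cases hs : algebraMap S K s = 0
  · rw [hs]; ring
  obtain h0 | h0 := map_eq_zero_or_le_finrank f ht
  · rw [h0]; ring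
  have hCF := d.map_det_borderedMatrix g b b' hs ψ z c
  rcases h0.lt_or_eq with h | h
  · rw [hCF.1 h, if_neg h.ne']
    ring
  · rw [hCF.2 h.symm, if_pos h.symm, map_pow, map_neg, map_one]
    ring

omit [IsFractionRing R F] [Module.Finite R S] in
/-- The values of the higher special element are determinants of values of `λ⁻¹`. -/
theorem pairingDual_higherSpecialElement (L : (OrderExt R E S)ˣ) {a : ℕ} (x : Fin a → N)
    (φ : Fin a → Module.Dual S M) :
    exteriorPower.pairingDual (OrderExt R E S) (OrderExt R E S ⊗[S] M) a
      (exteriorPower.ιMulti (OrderExt R E S) a fun i => (φ i).baseChange (OrderExt R E S))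
      (higherSpecialElement R F E lam L x) =
    extMap R F E S (idemEq R F N a) * ((L⁻¹ : (OrderExt R E S)ˣ) : OrderExt R E S) *
      (Matrix.of fun i j => (φ i).baseChange (OrderExt R E S)
        (lam.symm ((1 : OrderExt R E S) ⊗ₜ[S] x j))).det := by
  rw [higherSpecialElement, map_smul, map_smul, smul_eq_mul, exteriorPower.map_apply_ιMulti,
    exteriorPower.pairingDual_ιMulti_ιMulti, ← Matrix.det_transpose]
  rfl

/-- The isomorphism of a model may be replaced by one that differs from it by a unipotent
automorphism. -/
theorem LocalBasis.pow_mul_det_toMatrix_eq {B : Type*} [CommRing B] [IsReduced B] [Algebra S B]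
    {s : S} {D : ℕ} (b : LocalBasis S s D O) (b' : LocalBasis S s D V)
    (e e' : (B ⊗[S] O) ≃ₗ[B] (B ⊗[S] V))
    (h : IsNilpotent (e.symm.toLinearMap ∘ₗ e'.toLinearMap - LinearMap.id)) :
    algebraMap S B s ^ D * (b.toMatrix b' e'.toLinearMap).det =
      algebraMap S B s ^ D * (b.toMatrix b' e.toLinearMap).det := by
  set n := e.symm.toLinearMap ∘ₗ e'.toLinearMap - LinearMap.id with hn
  have hpow : ∀ k : ℕ, (b.toMatrix b n) ^ (k + 1) =
      algebraMap S B s ^ k • b.toMatrix b (n ^ (k + 1) : Module.End B (B ⊗[S] O)) := by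
    intro k
    induction k with
    | zero => simp
    | succ k ih =>
      rw [pow_succ, ih, Matrix.smul_mul, b.toMatrix_mul b b, smul_smul, ← pow_succ,
        pow_succ n (k + 1)]
      rfl
  have hnil : IsNilpotent (b.toMatrix b n) := by
    obtain ⟨k, hk⟩ := h
    refine ⟨k + 1, ?_⟩
    rw [hpow, pow_succ, hk, zero_mul]
    ext i j
    simp [LocalBasis.toMatrix]
  have h1 := b.toMatrix_mul b b' (e.symm.toLinearMap ∘ₗ e'.toLinearMap) e.toLinearMap
  rw [← LinearMap.comp_assoc, LinearEquiv.comp_symm, LinearMap.id_comp,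
    show e.symm.toLinearMap ∘ₗ e'.toLinearMap = LinearMap.id + n from by rw [hn]; abel,
    LocalBasis.toMatrix_add, LocalBasis.toMatrix_id] at h1
  have h2 := congrArg Matrix.det h1
  rw [Matrix.det_mul, det_smul_one_add_of_isNilpotent _ _ hnil, Matrix.det_smul,
    Fintype.card_fin] at h2
  rw [← h2, mul_comm]

/-- Locally, `L⁻¹` is a unit multiple of the determinant of the isomorphism of the model. -/
theorem exists_localBasis_of_detLattice {B : Type*} [CommRing B] [IsReduced B] [Algebra S B]
    (hinj : Function.Injective (algebraMap S B)) [Module.Finite S O] [Module.Projective S O]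
    [Module.Finite S V] [Module.Projective S V] (e e' : (B ⊗[S] O) ≃ₗ[B] (B ⊗[S] V))
    (h : IsNilpotent (e.symm.toLinearMap ∘ₗ e'.toLinearMap - LinearMap.id)) (L : Bˣ)
    (hL : detLattice e = Submodule.span S {(L : B)}) (m : Ideal S) [hm : m.IsMaximal] :
    ∃ s ∉ m, ∃ (D : ℕ) (b : LocalBasis S s D O) (b' : LocalBasis S s D V) (k : ℕ) (g g' : S),
      algebraMap S B s ^ k * ((L⁻¹ : Bˣ) : B) =
        algebraMap S B g * (b.toMatrix b' e'.toLinearMap).det ∧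
      algebraMap S B s ^ k * (b.toMatrix b' e'.toLinearMap).det =
        algebraMap S B g' * ((L⁻¹ : Bˣ) : B) := by
  obtain ⟨s₁, hs₁, D, ⟨b₁⟩⟩ := exists_localBasis (O := O) m
  obtain ⟨s₂, hs₂, D', ⟨b₂⟩⟩ := exists_localBasis (O := V) m
  obtain ⟨b⟩ : Nonempty (LocalBasis S (s₁ * s₂) D O) := ⟨mul_comm s₂ s₁ ▸ b₁.scale s₂⟩
  obtain ⟨b'₀⟩ : Nonempty (LocalBasis S (s₁ * s₂) D' V) := ⟨b₂.scale s₁⟩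
  have hs : s₁ * s₂ ∉ m := fun h' => (hm.isPrime.mem_or_mem h').elim hs₁ hs₂
  have hD : D = D' := b.rank_eq b'₀ e fun ⟨n, hn⟩ => by
    rw [← map_pow] at hn
    have h0 : (s₁ * s₂) ^ n = 0 := hinj (hn.trans (map_zero _).symm)
    exact hs (hm.isPrime.mem_of_pow_mem n (h0 ▸ m.zero_mem))
  subst hD
  obtain ⟨g', hg'⟩ := b.mul_det_toMatrix_mem b'₀ e
    (hL ▸ Submodule.mem_span_singleton_self (L : B))
  obtain ⟨g, hg⟩ := b.exists_pow_eq_mul_det_toMatrix b'₀ e hL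
  have hdet := b.pow_mul_det_toMatrix_eq b'₀ e e' h
  have hLL : (L : B) * ((L⁻¹ : Bˣ) : B) = 1 := L.mul_inv
  generalize s₁ * s₂ = s at *
  refine ⟨s, hs, D, b, b'₀, 5 * D + 1, g * s ^ D, g' * s ^ (5 * D), ?_, ?_⟩
  · rw [map_mul, map_pow, mul_assoc, hdet]
    have h5 : algebraMap S B s ^ (5 * D + 1) =
        algebraMap S B s ^ D * algebraMap S B s ^ (4 * D + 1) := by
      rw [← pow_add]; congr 1; ring
    rw [h5, hg]
    linear_combination (algebraMap S B s ^ D * algebraMap S B g *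
      (b.toMatrix b'₀ e.toLinearMap).det) * hLL
  · have h5 : algebraMap S B s ^ (5 * D + 1) * (b.toMatrix b'₀ e'.toLinearMap).det =
        algebraMap S B s ^ (4 * D + 1) *
          (algebraMap S B s ^ D * (b.toMatrix b'₀ e'.toLinearMap).det) := by
      rw [← mul_assoc, ← pow_add]; congr 2; ring
    rw [h5, hdet, map_mul, map_pow, ← hg']
    have h6 : algebraMap S B s ^ (5 * D) = algebraMap S B s ^ (4 * D) * algebraMap S B s ^ D := by
      rw [← pow_add]; congr 1; ring
    rw [h6, pow_succ]
    linear_combination (-algebraMap S B s * (b.toMatrix b'₀ e.toLinearMap).det *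
      (algebraMap S B s ^ (4 * D) * algebraMap S B s ^ D)) * hLL

end

/-! ### The multiple of the values of the higher special element in the Fitting ideal -/

section

variable {R F E S : Type*} [CommRing R] [Field F] [Algebra R F] [IsFractionRing R F]
  [Field E] [Algebra R E] [Algebra F E] [IsScalarTower R F E]
  [CommRing S] [Algebra R S] [Module.Finite R S]
  {M N O V : Type*} [AddCommGroup M] [Module S M] [AddCommGroup N] [Module S N]
  [AddCommGroup O] [Module S O] [AddCommGroup V] [Module S V]
  {lam : (OrderExt R E S ⊗[S] M) ≃ₗ[OrderExt R E S] (OrderExt R E S ⊗[S] N)}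

omit [Module.Finite R S] in
theorem TwoTermModel.valueMatrix_apply {B : Type*} [CommRing B] [Algebra S B]
    {lam : (B ⊗[S] M) ≃ₗ[B] (B ⊗[S] N)} (d : TwoTermModel lam O V) {a : ℕ}
    (ψ : Fin a → Module.Dual S O) (z : Fin a → V) (i j : Fin a) :
    d.valueMatrix ψ z i j =
      Module.Dual.baseChange B (ψ i ∘ₗ d.incl) (lam.symm ((1 : B) ⊗ₜ[S] d.proj (z j))) := by
  have h (w : B ⊗[S] M) : Module.Dual.baseChange B (ψ i ∘ₗ d.incl) w =
      Module.Dual.baseChange B (ψ i) (d.incl.baseChange B w) := by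
    induction w using TensorProduct.induction_on with
    | zero => simp
    | add x y hx hy => rw [map_add, hx, hy, map_add, map_add]
    | tmul c x => simp
  rw [h]
  rfl

/-- If `y` annihilates the obstruction to extending functionals from `M` to `O`, then `t y ^ a`
multiplies the values of the higher special element into any ideal that contains `t` times the
Fitting ideal. -/
theorem TwoTermModel.smul_mem_map_of_fittingIdeal [IsReduced (OrderExt R F S)]
    [IsReduced (OrderExt R E S)] [Module.Finite S N]
    (hinj : Function.Injective (algebraMap S (OrderExt R E S)))
    [Module.Finite S O] [Module.Projective S O] [Module.Finite S V] [Module.Projective S V]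
    (d : TwoTermModel lam O V)
    (e : (OrderExt R E S ⊗[S] O) ≃ₗ[OrderExt R E S] (OrderExt R E S ⊗[S] V))
    (he : IsNilpotent (e.symm.toLinearMap ∘ₗ d.iso.toLinearMap - LinearMap.id))
    (L : (OrderExt R E S)ˣ) (hL : detLattice e = Submodule.span S {(L : OrderExt R E S)})
    {a : ℕ} (x : Fin a → N) {y : S}
    (hy : ∀ φ : Module.Dual S M, ∃ ψ : Module.Dual S O, ψ ∘ₗ d.incl = y • φ) {t : S}
    (ht : ∃ b : S, algebraMap S (OrderExt R F S) t =
      algebraMap S (OrderExt R F S) b * idemGe R F N a)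
    (J : Ideal S) (hJ : ∀ u ∈ fittingIdeal S N a, t * u ∈ J) (z : OrderExt R E S)
    (hz : z ∈ evalIdeal (higherSpecialElement R F E lam L x)) :
    (t * y ^ a) • z ∈ Submodule.map (Algebra.linearMap S (OrderExt R E S)) J := by
  induction hz using Submodule.span_induction with
  | zero => rw [smul_zero]; exact zero_mem _
  | add z w _ _ hz hw => rw [smul_add]; exact add_mem hz hw
  | smul c z _ hz => rw [smul_comm]; exact Submodule.smul_mem _ c hz
  | mem z hz =>
    obtain ⟨φ, rfl⟩ := hz
    choose ψ hψ using fun i => hy (φ i)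
    choose x' hx' using fun i => d.proj_surjective (x i)
    refine mem_of_forall_isMaximal_exists_smul_mem _ _ fun m hm => ?_
    obtain ⟨s, hs, D, b, b', k, g, -, hg, -⟩ :=
      exists_localBasis_of_detLattice hinj e d.iso he L hL m
    obtain ⟨n, hn⟩ := exists_pow_mul_det_borderedMatrix_mem (a := a) d.diff d.proj d.exact_right
      d.proj_surjective b b'
    refine ⟨s ^ (k + 1 + n), fun h => hs (hm.isPrime.mem_of_pow_mem _ h),
      t * ((-1) ^ a * g * s * (s ^ n * (borderedMatrix d.diff b b' ψ x' 0).det)),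
      hJ _ (Ideal.mul_mem_left _ _ (hn ψ x' 0)), ?_⟩
    have hval : (d.valueMatrix ψ x').det = algebraMap S (OrderExt R E S) y ^ a *
        (Matrix.of fun i j => (φ i).baseChange (OrderExt R E S)
          (lam.symm ((1 : OrderExt R E S) ⊗ₜ[S] x j))).det := by
      refine Eq.trans ?_ ((Matrix.det_smul _ _).trans (by rw [Fintype.card_fin]))
      congr 1
      ext i j
      rw [d.valueMatrix_apply, hψ, hx', Matrix.smul_apply, Matrix.of_apply, map_smul,
        LinearMap.smul_apply, Algebra.smul_def, smul_eq_mul]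
    have hCF := d.mul_det_borderedMatrix b b' ψ x' 0 ht
    rw [hval] at hCF
    beta_reduce
    rw [pairingDual_higherSpecialElement, Algebra.linearMap_apply, Algebra.smul_def,
      Algebra.smul_def]
    simp only [map_mul, map_pow, map_neg, map_one] at hCF ⊢
    have h1 : ((-1 : OrderExt R E S) ^ a) * (-1) ^ a = 1 := by
      rw [← mul_pow, neg_one_mul, neg_neg, one_pow]
    rw [pow_add, pow_add, pow_one]
    linear_combination ((-1) ^ a * algebraMap S (OrderExt R E S) g *
      algebraMap S (OrderExt R E S) s ^ n) * hCF + (algebraMap S (OrderExt R E S) g *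
      algebraMap S (OrderExt R E S) s ^ n * algebraMap S (OrderExt R E S) s *
      algebraMap S (OrderExt R E S) t * (b.toMatrix b' d.iso.toLinearMap).det *
      extMap R F E S (idemEq R F N a) * algebraMap S (OrderExt R E S) y ^ a * (Matrix.of fun i j =>
        (φ i).baseChange (OrderExt R E S)
          (lam.symm ((1 : OrderExt R E S) ⊗ₜ[S] x j))).det) * h1 -
      (algebraMap S (OrderExt R E S) s ^ n * algebraMap S (OrderExt R E S) s *
      algebraMap S (OrderExt R E S) t * extMap R F E S (idemEq R F N a) *
      algebraMap S (OrderExt R E S) y ^ a * (Matrix.of fun i j =>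
        (φ i).baseChange (OrderExt R E S)
          (lam.symm ((1 : OrderExt R E S) ⊗ₜ[S] x j))).det) * hg

end

/-! ### Separable tuples -/

section

open Matrix

variable {S N O V : Type*} [CommRing S] [AddCommGroup N] [Module S N] [AddCommGroup O]
  [Module S O] [AddCommGroup V] [Module S V] {s : S} {D a : ℕ}

/-- Up to a power of `s`, the minors of the relations of an arbitrary presentation of `N` are
combinations of bordered determinants, with a common border `z`. The idea is to join both
presentations: `N` is generated by the generators of both, with the relations of the second one and
those that express the generators of the first one by the second one. -/
theorem exists_pow_mul_minor_mem_span [Module.Projective S V] (diff : O →ₗ[S] V)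
    (proj : V →ₗ[S] N) (hex : Function.Exact diff proj) (hproj : Function.Surjective proj)
    (b : LocalBasis S s D O) (b' : LocalBasis S s D V) {n : ℕ} (hn : a ≤ n)
    (g : (Fin n → S) →ₗ[S] N) (hg : Function.Surjective g) (r : Fin (n - a) → LinearMap.ker g)
    (c : Fin (n - a) → Fin n) :
    ∃ (l : ℕ) (z : Fin a → V), s ^ l * (of fun i j => (r i : Fin n → S) (c j)).det ∈
      Ideal.span (Set.range fun p : (Fin a → Module.Dual S O) × Matrix (Fin a) (Fin a) S =>
        (borderedMatrix diff b b' p.1 z p.2).det) := by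
  classical
  by_cases hc : Function.Injective c
  swap
  · obtain ⟨i, j, hij, hne⟩ : ∃ i j, c i = c j ∧ i ≠ j := by
      simpa [Function.Injective] using hc
    refine ⟨0, 0, ?_⟩
    rw [det_zero_of_column_eq hne fun k => by simp [hij], mul_zero]
    exact zero_mem _
  have hcard : Fintype.card ((Set.range c)ᶜ : Set (Fin n)) = a := by
    rw [Fintype.card_compl_set, Set.card_range_of_injective hc, Fintype.card_fin,
      Fintype.card_fin]
    omega
  let ε : Fin (n - a) ⊕ Fin a ≃ Fin n := (Equiv.sumCongr (Equiv.ofInjective c hc)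
    (Fintype.equivFinOfCardEq hcard).symm).trans (Equiv.Set.sumCompl (Set.range c))
  have hεl : ∀ i, ε (Sum.inl i) = c i := fun i => rfl
  let γ : Fin a → Fin n := fun i => ε (Sum.inr i)
  have hcγ : ∀ i j, c i ≠ γ j := fun i j h => by
    rw [← hεl] at h
    simpa using ε.injective h
  have hγ : ∀ i j, γ i = γ j ↔ i = j := fun i j => by simp [γ]
  obtain ⟨k, hk⟩ := Module.projective_lifting_property g proj hg
  obtain ⟨g', hg'⟩ := Module.projective_lifting_property proj g hproj
  have hk' : ∀ v, g (k v) = proj v := fun v => LinearMap.congr_fun hk v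
  have hg'' : ∀ w, proj (g' w) = g w := fun w => LinearMap.congr_fun hg' w
  choose o ho using fun i => (hex (g' (r i))).mp (by rw [hg'']; exact (r i).2)
  choose o' ho' using fun i => (hex (g' (k (b'.vec i)) - b'.vec i)).mp
    (by rw [map_sub, hg'', hk', sub_self])
  have hcoord : ∀ (i : Fin D) (w : O), ∑ j, b'.coord i (diff (b.vec j)) * b.coord j w =
      s * b'.coord i (diff w) := fun i w => by
    rw [← smul_eq_mul, ← map_smul, ← map_smul, ← b.sum_coord, map_sum, map_sum]
    exact Finset.sum_congr rfl fun j _ => by rw [map_smul, map_smul, smul_eq_mul, mul_comm]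
  have hg'sum : ∀ (i : Fin D) (w : Fin n → S), ∑ j, b'.coord i (g' (Pi.single j 1)) * w j =
      b'.coord i (g' w) := fun i w => by
    conv_rhs => rw [pi_eq_sum_univ' w, map_sum, map_sum]
    exact Finset.sum_congr rfl fun j _ => by rw [map_smul, map_smul, smul_eq_mul, mul_comm]
  -- the columns of `G` are the relations of the joint presentation, those of `Z` the generators of
  -- the first presentation outside the range of `c`, and `Q` expresses the relations `r`, and the
  -- relations of the generators `b'` in terms of the first presentation, by the columns of `G`
  let G : Matrix (Fin n ⊕ Fin D) (Fin n ⊕ Fin D) S := fromBlocks 1 0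
    (of fun i j => -b'.coord i (g' (Pi.single j 1))) (of fun i j => b'.coord i (diff (b.vec j)))
  let Z : Matrix (Fin n ⊕ Fin D) (Fin a) S :=
    fromRows (of fun i j => (Pi.single (γ j) 1 : Fin n → S) i) 0
  let Q : Matrix (Fin n ⊕ Fin D) (Fin (n - a) ⊕ Fin D) S := fromBlocks
    (of fun i j => s * (r j : Fin n → S) i) (of fun i j => s * k (b'.vec j) i)
    (of fun i j => b.coord i (o j)) (of fun i j => b.coord i (o' j))
  have hGQ : G * Q = fromBlocks (of fun i j => s * (r j : Fin n → S) i)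
      (of fun i j => s * k (b'.vec j) i) 0 (-(s ^ 2) • (1 : Matrix (Fin D) (Fin D) S)) := by
    rw [fromBlocks_multiply]
    congr 1
    · simp
    · simp
    · ext i j
      simp only [Matrix.add_apply, Matrix.mul_apply, of_apply, hcoord, ho, neg_mul,
        Finset.sum_neg_distrib, mul_left_comm _ s, ← Finset.mul_sum, hg'sum]
      simp
    · ext i j
      simp only [Matrix.add_apply, Matrix.mul_apply, of_apply, hcoord, ho', neg_mul,
        Finset.sum_neg_distrib, mul_left_comm _ s, ← Finset.mul_sum, hg'sum, map_sub,
        b'.coord_vec, Matrix.smul_apply, Matrix.one_apply, smul_eq_mul]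
      split_ifs <;> ring
  let f : (Fin (n - a) ⊕ Fin D) ⊕ Fin a ≃ (Fin (n - a) ⊕ Fin a) ⊕ Fin D :=
    ((Equiv.sumAssoc _ _ _).trans (Equiv.sumCongr (Equiv.refl _) (Equiv.sumComm _ _))).trans
      (Equiv.sumAssoc _ _ _).symm
  have h := det_fromCols_mul_mem_span G Z Q (f.trans (Equiv.sumCongr ε (Equiv.refl _)))
  have hdet : ((fromCols (G * Q) Z).submatrix (f.trans (Equiv.sumCongr ε (Equiv.refl _))) id).det =
      s ^ (n - a) * (of fun i j => (r i : Fin n → S) (c j)).det * (-(s ^ 2)) ^ D := by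
    rw [← det_submatrix_equiv_self f.symm, hGQ]
    have h1 : (((fromCols (fromBlocks (of fun i j => s * (r j : Fin n → S) i)
      (of fun i j => s * k (b'.vec j) i) 0 (-(s ^ 2) • (1 : Matrix (Fin D) (Fin D) S))) Z).submatrix
        (f.trans (Equiv.sumCongr ε (Equiv.refl _))) id).submatrix f.symm f.symm) = fromBlocks
        (fromBlocks (s • (of fun i j => (r i : Fin n → S) (c j))ᵀ) 0
          (of fun i j => s * (r j : Fin n → S) (γ i)) 1)
        (of fun i j => s * k (b'.vec j) (ε i)) 0
        (-(s ^ 2) • (1 : Matrix (Fin D) (Fin D) S)) := by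
      ext i j
      rcases i with (i | i) | i <;> rcases j with (j | j) | j <;>
        simp [f, Z, hεl, hcγ, γ, Matrix.one_apply, Pi.single_apply]
    rw [h1, det_fromBlocks_zero₂₁, det_fromBlocks_zero₁₂, det_smul, det_smul, det_one, det_one,
      det_transpose, Fintype.card_fin, Fintype.card_fin, mul_one, mul_one]
  rw [hdet] at h
  let z : Fin a → V := fun j => g' (Pi.single (γ j) 1)
  refine ⟨a + (n - a) + 2 * D, z, ?_⟩
  have hspan : ∀ w ∈ Ideal.span (Set.range fun p : Matrix (Fin a) (Fin n ⊕ Fin D) S =>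
      (fromBlocks G Z p 0).det), s ^ a * w ∈ Ideal.span (Set.range
        fun p : (Fin a → Module.Dual S O) × Matrix (Fin a) (Fin a) S =>
        (borderedMatrix diff b b' p.1 z p.2).det) := by
    intro w hw
    induction hw using Submodule.span_induction with
    | zero => rw [mul_zero]; exact zero_mem _
    | add x y _ _ hx hy => rw [mul_add]; exact add_mem hx hy
    | smul c x _ hx => rw [smul_eq_mul, mul_left_comm]; exact Ideal.mul_mem_left _ _ hx
    | mem x hx =>
      obtain ⟨p, rfl⟩ := hx
      refine Ideal.subset_span ⟨⟨fun i => ∑ j, p i (Sum.inr j) • b.coord j,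
        of fun i j => -(s * p i (Sum.inl (γ j)))⟩, ?_⟩
      beta_reduce
      have h1 : (fromBlocks G Z p 0).submatrix (Equiv.sumAssoc _ _ _).symm
          (Equiv.sumAssoc _ _ _).symm = fromBlocks (1 : Matrix (Fin n) (Fin n) S)
          (fromCols (0 : Matrix (Fin n) (Fin D) S)
            (of fun i j => (Pi.single (γ j) 1 : Fin n → S) i))
          (fromRows (of fun i j => -b'.coord i (g' (Pi.single j 1)))
            (of fun i j => p i (Sum.inl j)))
          (fromBlocks (of fun i j => b'.coord i (diff (b.vec j))) 0
            (of fun i j => p i (Sum.inr j)) 0) := by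
        ext i j
        rcases i with i | i | i <;> rcases j with j | j | j <;> simp [G, Z]
      have h2 : borderedMatrix diff b b' (fun i => ∑ j, p i (Sum.inr j) • b.coord j) z
          (of fun i j => -(s * p i (Sum.inl (γ j)))) =
          fromBlocks 1 0 0 (s • (1 : Matrix (Fin a) (Fin a) S)) *
          (fromBlocks (of fun i j => b'.coord i (diff (b.vec j))) 0
            (of fun i j => p i (Sum.inr j)) 0 -
          fromRows (of fun i j => -b'.coord i (g' (Pi.single j 1)))
            (of fun i j => p i (Sum.inl j)) * fromCols (0 : Matrix (Fin n) (Fin D) S)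
            (of fun i j => (Pi.single (γ j) 1 : Fin n → S) i)) := by
        rw [fromRows_mul_fromCols, sub_eq_add_neg, fromBlocks_neg, fromBlocks_add,
          fromBlocks_multiply, borderedMatrix]
        congr 1
        · simp
        · ext i j
          simp [z, Matrix.mul_apply, Pi.single_apply]
        · ext i j
          simp [LinearMap.sum_apply, b.coord_vec, mul_comm s]
        · ext i j
          simp [Matrix.mul_apply, Pi.single_apply]
      rw [← det_submatrix_equiv_self (Equiv.sumAssoc _ _ _).symm (fromBlocks G Z p 0), h1,
        det_fromBlocks_one₁₁, h2, det_mul, det_fromBlocks_zero₂₁, det_smul, det_one, det_one,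
        Fintype.card_fin, one_mul, mul_one]
  have h3 := hspan _ h
  have h4 := Ideal.mul_mem_left _ ((-1) ^ D) h3
  convert h4 using 1
  rw [neg_pow (s ^ 2), ← pow_mul, pow_add, pow_add]
  have : ((-1 : S) ^ D) * (-1) ^ D = 1 := by
    rw [← mul_pow, neg_one_mul, neg_neg, one_pow]
  linear_combination -(s ^ a * s ^ (n - a) * s ^ (2 * D) *
    (of fun i j => (r i : Fin n → S) (c j)).det) * this

end

section

variable {S N : Type*} [CommRing S] [AddCommGroup N] [Module S N] {a : ℕ}

/-- The coordinates with respect to a separable tuple extend to functionals on the module. -/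
theorem IsSeparableTuple.exists_dual {x : Fin a → N} (hx : IsSeparableTuple S x) :
    ∃ ξ : Fin a → Module.Dual S N, ∀ i j, ξ i (x j) = if i = j then 1 else 0 := by
  obtain ⟨hli, K, hK⟩ := hx
  let bas := Module.Basis.span hli
  refine ⟨fun i => bas.coord i ∘ₗ Submodule.projectionOnto _ K hK, fun i j => ?_⟩
  have h1 : x j = (bas j : N) := (congrArg Subtype.val (Module.Basis.span_apply hli j)).symm
  rw [LinearMap.comp_apply, h1, Submodule.projectionOnto_apply_left, Module.Basis.coord_apply,
    Module.Basis.repr_self, Finsupp.single_apply]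
  simp [eq_comm]

variable {K : Type*} [Field K] [Algebra S K] {x : Fin a → N} {ξ : Fin a → Module.Dual S N}
  (hξ : ∀ i j, ξ i (x j) = if i = j then 1 else 0)
include hξ

theorem linearIndependent_one_tmul_of_dual :
    LinearIndependent K fun i => (1 : K) ⊗ₜ[S] x i := by
  rw [Fintype.linearIndependent_iff]
  intro c hc i
  have h := congrArg ((ξ i).baseChange K) hc
  simpa [hξ, Finset.sum_ite_eq] using h

theorem le_finrank_of_dual [Module.Finite S N] : a ≤ Module.finrank K (K ⊗[S] N) := by
  simpa using (linearIndependent_one_tmul_of_dual (K := K) hξ).fintype_card_le_finrank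

theorem one_tmul_eq_sum_of_dual [Module.Finite S N] (h : Module.finrank K (K ⊗[S] N) = a) (n : N) :
    (1 : K) ⊗ₜ[S] n = ∑ i, algebraMap S K (ξ i n) • (1 : K) ⊗ₜ[S] x i := by
  have htop := (linearIndependent_one_tmul_of_dual (K := K) hξ).span_eq_top_of_card_eq_finrank'
    (by rw [Fintype.card_fin, h])
  obtain ⟨c, hc⟩ := (Submodule.mem_span_range_iff_exists_fun K).mp
    (htop ▸ Submodule.mem_top : (1 : K) ⊗ₜ[S] n ∈ _)
  have hcξ : ∀ i, c i = algebraMap S K (ξ i n) := fun i => by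
    have h := congrArg ((ξ i).baseChange K) hc
    simpa [hξ, Finset.sum_ite_eq, Algebra.smul_def] using h
  rw [← hc]
  exact Finset.sum_congr rfl fun i _ => by rw [hcξ]

end

section

open Matrix

variable {R F E S : Type*} [CommRing R] [Field F] [Algebra R F] [IsFractionRing R F]
  [Field E] [Algebra R E] [Algebra F E] [IsScalarTower R F E]
  [CommRing S] [Algebra R S] [Module.Finite R S]
  {M N O V : Type*} [AddCommGroup M] [Module S M] [AddCommGroup N] [Module S N]
  [AddCommGroup O] [Module S O] [AddCommGroup V] [Module S V]
  {lam : (OrderExt R E S ⊗[S] M) ≃ₗ[OrderExt R E S] (OrderExt R E S ⊗[S] N)}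

/-- Where the rank of `N` is `a`, a separable tuple is a basis, so that values on other tuples
differ from those on the separable one by the determinant of the coordinates. -/
theorem idemEq_mul_det_eq_of_dual [IsReduced (OrderExt R F S)]
    [IsReduced (OrderExt R E S)] [Module.Finite S N] {a : ℕ} {x : Fin a → N}
    {ξ : Fin a → Module.Dual S N} (hξ : ∀ i j, ξ i (x j) = if i = j then 1 else 0)
    (φ : Fin a → Module.Dual S M) (n : Fin a → N) :
    extMap R F E S (idemEq R F N a) * (of fun i j => (φ i).baseChange (OrderExt R E S)
        (lam.symm ((1 : OrderExt R E S) ⊗ₜ[S] n j))).det =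
      algebraMap S (OrderExt R E S) (of fun i j => ξ i (n j)).det *
        (extMap R F E S (idemEq R F N a) * (of fun i j => (φ i).baseChange (OrderExt R E S)
          (lam.symm ((1 : OrderExt R E S) ⊗ₜ[S] x j))).det) := by
  rw [← sub_eq_zero]
  refine eq_zero_of_forall_residueField _ fun p _ => ?_
  let K := p.ResidueField
  let g : OrderExt R E S →ₐ[S] K := IsScalarTower.toAlgHom S _ _
  let f : OrderExt R F S →ₐ[S] K := g.comp (extMap R F E S)
  change g _ = 0
  rw [map_sub, sub_eq_zero, map_mul g, map_mul g, map_mul g,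
    show g (extMap R F E S (idemEq R F N a)) = _ from map_idemEq N a f]
  split_ifs with h
  swap
  · ring
  rw [one_mul, one_mul, AlgHom.commutes, AlgHom.map_det, AlgHom.map_det, RingHom.map_det, mul_comm,
    ← det_mul]
  congr 1
  ext i j
  rw [Matrix.mul_apply]
  have h1 : ∀ n : N, g ((φ i).baseChange (OrderExt R E S)
      (lam.symm ((1 : OrderExt R E S) ⊗ₜ[S] n))) =
      pointDual g ((φ i).baseChange (OrderExt R E S) ∘ₗ lam.symm.toLinearMap)
        ((1 : K) ⊗ₜ[S] n) := by
    intro n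
    have h2 := pointDual_pointEval g ((φ i).baseChange (OrderExt R E S) ∘ₗ lam.symm.toLinearMap)
      ((1 : OrderExt R E S) ⊗ₜ[S] n)
    rw [pointEval_tmul, map_one] at h2
    exact h2.symm
  simp only [AlgHom.mapMatrix_apply, RingHom.mapMatrix_apply, Matrix.map_apply, of_apply]
  rw [h1, one_tmul_eq_sum_of_dual hξ h (n j), map_sum]
  exact Finset.sum_congr rfl fun k _ => by rw [map_smul, smul_eq_mul, mul_comm, h1]

/-- For a separable tuple, the Fitting ideal is contained in the ideal of values of the higher
special element. -/
theorem TwoTermModel.map_fittingIdeal_le_evalIdeal [IsReduced (OrderExt R F S)]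
    [IsReduced (OrderExt R E S)] [Module.Finite S N]
    (hinj : Function.Injective (algebraMap S (OrderExt R E S)))
    [Module.Finite S O] [Module.Projective S O] [Module.Finite S V] [Module.Projective S V]
    (d : TwoTermModel lam O V)
    (e : (OrderExt R E S ⊗[S] O) ≃ₗ[OrderExt R E S] (OrderExt R E S ⊗[S] V))
    (he : IsNilpotent (e.symm.toLinearMap ∘ₗ d.iso.toLinearMap - LinearMap.id))
    (L : (OrderExt R E S)ˣ) (hL : detLattice e = Submodule.span S {(L : OrderExt R E S)})
    {a : ℕ} {x : Fin a → N} (hx : IsSeparableTuple S x)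
    (hid : idemGe R F N a = (1 : OrderExt R F S)) :
    Submodule.map (Algebra.linearMap S (OrderExt R E S)) (fittingIdeal S N a) ≤
      evalIdeal (higherSpecialElement R F E lam L x) := by
  obtain ⟨ξ, hξ⟩ := hx.exists_dual
  rw [Submodule.map_le_iff_le_comap, fittingIdeal]
  refine Ideal.span_le.mpr ?_
  rintro _ ⟨n, g, hg, r, c, rfl⟩
  refine mem_of_forall_isMaximal_exists_smul_mem _ _ fun m hm => ?_
  have : Nontrivial S := ⟨⟨0, 1, fun h => hm.ne_top (Ideal.eq_top_of_unit_mem m 0 0 m.zero_mem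
    (by rw [h, mul_one]))⟩⟩
  have hn : a ≤ n := by
    refine le_of_fin_surjective S (LinearMap.pi ξ ∘ₗ g) fun w => ?_
    obtain ⟨w', hw'⟩ := hg (∑ j, w j • x j)
    refine ⟨w', ?_⟩
    ext i
    simp [hw', hξ]
  obtain ⟨s, hs, D, b, b', k, -, g', -, hg'⟩ :=
    exists_localBasis_of_detLattice hinj e d.iso he L hL m
  obtain ⟨l, z, hz⟩ := exists_pow_mul_minor_mem_span d.diff d.proj d.exact_right
    d.proj_surjective b b' hn g hg r c
  refine ⟨s ^ (k + 1 + l), fun h => hs (hm.isPrime.mem_of_pow_mem _ h), ?_⟩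
  have key : ∀ w ∈ Ideal.span (Set.range
      fun p : (Fin a → Module.Dual S O) × Matrix (Fin a) (Fin a) S =>
        (borderedMatrix d.diff b b' p.1 z p.2).det),
      algebraMap S (OrderExt R E S) (s ^ (k + 1) * w) ∈
        evalIdeal (higherSpecialElement R F E lam L x) := by
    intro w hw
    induction hw using Submodule.span_induction with
    | zero => rw [mul_zero, map_zero]; exact zero_mem _
    | add x y _ _ hx hy => rw [mul_add, map_add]; exact add_mem hx hy
    | smul c x _ hx =>
      rw [smul_eq_mul, mul_left_comm, map_mul, ← Algebra.smul_def]
      exact Submodule.smul_mem _ _ hx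
    | mem w hw =>
      obtain ⟨⟨ψ, c⟩, rfl⟩ := hw
      have hCF := d.mul_det_borderedMatrix b b' ψ z c (t := 1) ⟨1, by rw [hid, map_one, one_mul]⟩
      have hval := idemEq_mul_det_eq_of_dual (lam := lam) (R := R) (F := F) hξ
        (fun i => ψ i ∘ₗ d.incl) (fun j => d.proj (z j))
      have hmat : d.valueMatrix ψ z = of fun i j => Module.Dual.baseChange (OrderExt R E S)
          (ψ i ∘ₗ d.incl) (lam.symm ((1 : OrderExt R E S) ⊗ₜ[S] d.proj (z j))) := by
        ext i j
        exact d.valueMatrix_apply ψ z i j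
      rw [hmat, hval] at hCF
      have hgen : exteriorPower.pairingDual (OrderExt R E S) (OrderExt R E S ⊗[S] M) a
          (exteriorPower.ιMulti (OrderExt R E S) a fun i =>
            Module.Dual.baseChange (OrderExt R E S) (ψ i ∘ₗ d.incl))
          (higherSpecialElement R F E lam L x) ∈
          evalIdeal (higherSpecialElement R F E lam L x) :=
        Submodule.subset_span (Set.mem_range_self (fun i => ψ i ∘ₗ d.incl))
      rw [pairingDual_higherSpecialElement] at hgen
      have hmem := Submodule.smul_mem _
        ((-1) ^ a * s * g' * (of fun i j => ξ i (d.proj (z j))).det) hgen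
      convert hmem using 1
      rw [Algebra.smul_def]
      simp only [mul_one, map_mul, map_pow, map_neg, map_one] at hCF ⊢
      linear_combination (algebraMap S (OrderExt R E S) s ^ k) * hCF +
        (algebraMap S (OrderExt R E S) s * (-1) ^ a *
          algebraMap S (OrderExt R E S) (of fun i j => ξ i (d.proj (z j))).det *
          (extMap R F E S (idemEq R F N a) * (of fun i j => Module.Dual.baseChange (OrderExt R E S)
            (ψ i ∘ₗ d.incl) (lam.symm ((1 : OrderExt R E S) ⊗ₜ[S] x j))).det)) * hg'
  have h2 := key _ hz
  rw [← mul_assoc, ← pow_add] at h2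
  exact h2

end

/-! ### Splitting injections between projective modules -/

/-- The localization of a Dedekind domain at a prime is principal, without localizing. -/
theorem exists_mul_dvd_of_isPrime {R : Type*} [CommRing R] [IsDedekindDomain R] (p : Ideal R)
    [hp : p.IsPrime] : ∃ c ∉ p, ∃ π ∈ p, ∀ q ∈ p, π ∣ c * q := by
  by_cases h0 : p = ⊥
  · refine ⟨1, fun h => hp.ne_top ((Ideal.eq_top_iff_one p).mpr h), 0, p.zero_mem, fun q hq => ?_⟩
    rw [h0, Ideal.mem_bot] at hq
    rw [hq, mul_zero]
  · obtain ⟨π, hπ, hπ2⟩ := Ideal.exists_mem_pow_notMem_pow_succ p h0 hp.ne_top 1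
    rw [pow_one] at hπ
    obtain ⟨J, hJ⟩ := Ideal.dvd_iff_le.mpr ((Ideal.span_singleton_le_iff_mem p).mpr hπ)
    have hnle : ¬ J ≤ p := fun hle => hπ2 (by
      rw [pow_succ, pow_one]
      exact Ideal.mul_mono_right hle (hJ ▸ Ideal.mem_span_singleton_self π))
    obtain ⟨c, hcJ, hcp⟩ := SetLike.not_le_iff_exists.mp hnle
    refine ⟨c, hcp, π, hπ, fun q hq => ?_⟩
    rw [← Ideal.mem_span_singleton, hJ, mul_comm c]
    exact Ideal.mul_mem_mul hq hcJ

/-- A maximal ideal of an order is associated to the reduction of the order modulo the prime below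
it. -/
theorem exists_forall_mul_mem_map_iff {R S : Type*} [CommRing R] [IsDedekindDomain R] [CommRing S]
    [Algebra R S] [Module.Finite R S] (m : Ideal S) [hm : m.IsMaximal] :
    ∃ σ : S, ∀ x, σ * x ∈ (m.comap (algebraMap R S)).map (algebraMap R S) ↔ x ∈ m := by
  set I := (m.comap (algebraMap R S)).map (algebraMap R S)
  have : IsNoetherianRing S := IsNoetherianRing.of_finite R S
  have hmin : m ∈ (Module.annihilator S (S ⧸ I)).minimalPrimes := by
    rw [Ideal.annihilator_quotient]
    refine ⟨⟨hm.isPrime, Ideal.map_comap_le⟩, fun q ⟨hq, hIq⟩ hqm => ?_⟩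
    have h1 : (m.comap (algebraMap R S)).IsMaximal :=
      Ideal.isMaximal_comap_of_isIntegral_of_isMaximal m
    have h2 : m.comap (algebraMap R S) = q.comap (algebraMap R S) :=
      h1.eq_of_le (hq.comap _).ne_top (Ideal.map_le_iff_le_comap.mp hIq)
    have h3 : q.IsMaximal := Ideal.isMaximal_of_isIntegral_of_isMaximal_comap (R := R) q (h2 ▸ h1)
    exact (h3.eq_of_le hm.ne_top hqm).ge
  obtain ⟨-, σ, hσ⟩ := (isAssociatedPrime_iff).mp
    (Module.associatedPrimes.minimalPrimes_annihilator_subset_associatedPrimes S (S ⧸ I) hmin)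
  obtain ⟨σ, rfl⟩ := Ideal.Quotient.mk_surjective σ
  refine ⟨σ, fun x => ?_⟩
  rw [hσ, Submodule.mem_colon_singleton, Submodule.mem_bot, Algebra.smul_def,
    Ideal.Quotient.algebraMap_eq, ← map_mul, Ideal.Quotient.eq_zero_iff_mem, mul_comm]

/-- An injection of finitely generated projective modules over an order splits if its cokernel is
torsion-free. It suffices that the injection stays injective modulo each maximal ideal `m` of `S`.
This holds since `m` is the annihilator of some `σ` modulo the prime `p` of `R` below `m`: if `f x`
lies in `m Y`, then `σ f x` lies in `p Y`, so that `σ x` lies in `p X` and `x` in `m X`. -/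
theorem exists_retraction_of_torsionFree_coker {R S X Y : Type*} [CommRing R] [IsDedekindDomain R]
    [CommRing S] [Algebra R S] [Module.Finite R S] [AddCommGroup X] [Module S X] [AddCommGroup Y]
    [Module S Y] [Module.Finite S X] [Module.Projective S X] [Module.Finite S Y]
    [Module.Projective S Y] (f : X →ₗ[S] Y) (hf : Function.Injective f)
    (htf : ∀ r : R, r ≠ 0 → ∀ y, algebraMap R S r • y ∈ LinearMap.range f →
      y ∈ LinearMap.range f) : ∃ g : Y →ₗ[S] X, g ∘ₗ f = LinearMap.id := by
  obtain ⟨n, u, v, -, -, huv⟩ := Module.Finite.exists_comp_eq_id_of_projective S X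
  let w : Fin n → Module.Dual S X := fun i => LinearMap.proj i ∘ₗ v
  have hw : ∀ x, ∑ i, w i x • u (Pi.single i 1) = x := fun x => by
    conv_rhs => rw [← LinearMap.id_apply (R := S) x, ← huv, LinearMap.comp_apply,
      pi_eq_sum_univ' (v x), map_sum]
    exact Finset.sum_congr rfl fun i _ => by rw [map_smul]; rfl
  -- `c` and `π` generate the prime below `m` locally: `c p ⊆ π R` with `c` outside `p`
  have hinj : ∀ (m : Ideal S) [m.IsMaximal] (x : X), f x ∈ m • (⊤ : Submodule S Y) →
      x ∈ m • (⊤ : Submodule S X) := by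
    intro m hm x hx
    obtain ⟨σ, hσ⟩ := exists_forall_mul_mem_map_iff (R := R) m
    have hp : (m.comap (algebraMap R S)).IsMaximal :=
      Ideal.isMaximal_comap_of_isIntegral_of_isMaximal m
    obtain ⟨c, hc, π, hπ, hdvd⟩ := exists_mul_dvd_of_isPrime (m.comap (algebraMap R S))
    have hI : ∀ i ∈ (m.comap (algebraMap R S)).map (algebraMap R S), ∃ j,
        algebraMap R S c * i = algebraMap R S π * j := by
      intro i hi
      induction hi using Submodule.span_induction with
      | zero => exact ⟨0, by simp⟩
      | add i j _ _ hi hj =>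
        obtain ⟨k, hk⟩ := hi
        obtain ⟨l, hl⟩ := hj
        exact ⟨k + l, by rw [mul_add, hk, hl, mul_add]⟩
      | smul b i _ hi =>
        obtain ⟨k, hk⟩ := hi
        exact ⟨b * k, by rw [smul_eq_mul, mul_left_comm, hk, mul_left_comm]⟩
      | mem i hi =>
        obtain ⟨q, hq, rfl⟩ := hi
        obtain ⟨k, hk⟩ := hdvd q hq
        exact ⟨algebraMap R S k, by rw [← map_mul, hk, map_mul]⟩
    have hle : m • (⊤ : Submodule S Y) ≤ (LinearMap.range (LinearMap.lsmul S Y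
        (algebraMap R S π))).comap (LinearMap.lsmul S Y (algebraMap R S c * σ)) := by
      refine Submodule.smul_le.mpr fun b hb y _ => ?_
      obtain ⟨j, hj⟩ := hI _ ((hσ b).mpr hb)
      refine ⟨j • y, ?_⟩
      rw [LinearMap.lsmul_apply, LinearMap.lsmul_apply, smul_smul, smul_smul, ← hj, mul_assoc]
    obtain ⟨y, hy⟩ := hle hx
    rw [LinearMap.lsmul_apply, LinearMap.lsmul_apply, ← map_smul] at hy
    obtain ⟨x', hx'⟩ : ∃ x', (algebraMap R S c * σ) • x = algebraMap R S π • x' := by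
      by_cases hπ0 : π = 0
      · rw [hπ0, map_zero, zero_smul] at hy
        exact ⟨0, by rw [smul_zero]; exact hf (hy.symm.trans (map_zero f).symm)⟩
      · obtain ⟨x', rfl⟩ := htf π hπ0 y (hy ▸ LinearMap.mem_range_self _ _)
        exact ⟨x', hf (by rw [← hy, map_smul])⟩
    have hwm : ∀ i, w i x ∈ m := by
      intro i
      rw [← hσ]
      obtain ⟨c', hc'⟩ := Ideal.Quotient.exists_inv (I := m.comap (algebraMap R S))
        (a := Ideal.Quotient.mk _ c) (mt Ideal.Quotient.eq_zero_iff_mem.mp hc)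
      obtain ⟨c', rfl⟩ := Ideal.Quotient.mk_surjective c'
      rw [← map_mul, ← map_one (Ideal.Quotient.mk _), Ideal.Quotient.eq] at hc'
      have h1 := Ideal.mul_mem_right (σ * w i x) _ (Ideal.mem_map_of_mem (algebraMap R S) hc')
      have h2 := congrArg (w i) hx'
      rw [map_smul, map_smul, smul_eq_mul, smul_eq_mul] at h2
      have h3 := Ideal.mul_mem_right (algebraMap R S c' * w i x') _
        (Ideal.mem_map_of_mem (algebraMap R S) hπ)
      have h4 := sub_mem h3 h1
      rw [map_sub, map_mul, map_one] at h4
      convert h4 using 1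
      linear_combination algebraMap R S c' * h2
    rw [← hw x]
    exact Submodule.sum_mem _ fun i _ => Submodule.smul_mem_smul (hwm i) trivial
  -- functionals on `X` extend to `Y` modulo `m`, hence locally by Nakayama
  have hmod : ∀ (m : Ideal S) [m.IsMaximal] (φ : Module.Dual S X), ∃ ψ : Module.Dual S Y,
      ∀ x, φ x - ψ (f x) ∈ m := by
    intro m hm φ
    let _ : Field (S ⧸ m) := Ideal.Quotient.field m
    let fm : (X ⧸ m • (⊤ : Submodule S X)) →ₗ[S ⧸ m] (Y ⧸ m • (⊤ : Submodule S Y)) :=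
      LinearMap.extendScalarsOfSurjective Ideal.Quotient.mk_surjective
        (Submodule.mapQ _ _ f (Submodule.smul_top_le_comap_smul_top m f))
    have hfm : Function.Injective fm := by
      rw [← LinearMap.ker_eq_bot, LinearMap.ker_eq_bot']
      intro x hx
      obtain ⟨x, rfl⟩ := Submodule.mkQ_surjective _ x
      exact (Submodule.Quotient.mk_eq_zero _).mpr
        (hinj m x ((Submodule.Quotient.mk_eq_zero _).mp hx))
    obtain ⟨gm, hgm⟩ := fm.exists_leftInverse_of_injective (LinearMap.ker_eq_bot.mpr hfm)
    let φm : (X ⧸ m • (⊤ : Submodule S X)) →ₗ[S] S ⧸ m := Submodule.liftQ _ (m.mkQ ∘ₗ φ) (by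
      refine Submodule.smul_le.mpr fun b hb x _ => ?_
      rw [LinearMap.mem_ker, LinearMap.comp_apply, map_smul, smul_eq_mul]
      exact (Submodule.Quotient.mk_eq_zero m).mpr (Ideal.mul_mem_right _ _ hb))
    obtain ⟨ψ, hψ⟩ := Module.projective_lifting_property m.mkQ
      (φm ∘ₗ gm.restrictScalars S ∘ₗ Submodule.mkQ _) m.mkQ_surjective
    refine ⟨ψ, fun x => ?_⟩
    have h1 := LinearMap.congr_fun hψ (f x)
    have h2 := LinearMap.congr_fun hgm (Submodule.mkQ _ x)
    have h3 : gm (Submodule.mkQ _ (f x)) = Submodule.mkQ _ x := h2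
    simp only [LinearMap.comp_apply, LinearMap.coe_restrictScalars, h3] at h1
    exact (Submodule.Quotient.eq m).mp h1.symm
  have hsurj : ∀ φ : Module.Dual S X, φ ∈ LinearMap.range f.dualMap := by
    intro φ
    refine mem_of_forall_isMaximal_exists_smul_mem _ _ fun m hm => ?_
    have hsup : (⊤ : Submodule S (Module.Dual S X)) ≤
        LinearMap.range f.dualMap ⊔ m • (⊤ : Submodule S (Module.Dual S X)) := by
      intro φ _
      obtain ⟨ψ, hψ⟩ := hmod m φ
      rw [← add_sub_cancel (f.dualMap ψ) φ]
      refine Submodule.add_mem_sup ⟨ψ, rfl⟩ ?_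
      have h1 : φ - f.dualMap ψ = ∑ i, (φ - f.dualMap ψ) (u (Pi.single i 1)) • w i := by
        ext x
        conv_lhs => rw [← hw x, map_sum]
        rw [LinearMap.sum_apply]
        exact Finset.sum_congr rfl fun i _ => by
          rw [map_smul, LinearMap.smul_apply, smul_eq_mul, smul_eq_mul, mul_comm]
      rw [h1]
      exact Submodule.sum_mem _ fun i _ => Submodule.smul_mem_smul (hψ _) trivial
    obtain ⟨r, hr, hrle⟩ := Submodule.exists_sub_one_mem_and_smul_le_of_fg_of_le_sup
      (Module.Finite.fg_top) le_rfl hsup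
    refine ⟨r, fun hrm => hm.ne_top ((Ideal.eq_top_iff_one m).mpr ?_), ?_⟩
    · simpa using sub_mem hrm hr
    · exact hrle (Submodule.smul_mem_pointwise_smul φ r ⊤ trivial)
  choose ψ hψ using fun i => hsurj (w i)
  refine ⟨∑ i, (ψ i).smulRight (u (Pi.single i 1)), ?_⟩
  ext x
  conv_rhs => rw [LinearMap.id_apply, ← hw x]
  rw [LinearMap.comp_apply, LinearMap.sum_apply]
  exact Finset.sum_congr rfl fun i _ => by rw [← hψ]; rfl

/-! ### Cocycles and cohomology classes -/

section

variable {S : Type u} [CommRing S] {P C : CochainComplex (ModuleCat.{u} S) ℤ} (q : P ⟶ C)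

theorem iCycles_injective (j : ℤ) : Function.Injective (P.iCycles j).hom :=
  (ModuleCat.mono_iff_injective _).mp inferInstance

theorem exact_iCycles {j k : ℤ} (hk : j + 1 = k) :
    Function.Exact (P.iCycles j).hom (P.d j k).hom := by
  have h := ShortComplex.exact_of_f_is_kernel (ShortComplex.mk _ _ (P.iCycles_d j k))
    (P.cyclesIsKernel j k (by simp [hk]))
  exact (ShortComplex.ShortExact.moduleCat_exact_iff_function_exact _).mp h

theorem cocycleClass_surjective [QuasiIso q] (j : ℤ) :
    Function.Surjective (cocycleClass q j) := by
  have : Epi (P.homologyπ j ≫ HomologicalComplex.homologyMap q j) := inferInstance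
  exact (ModuleCat.epi_iff_surjective _).mp this

theorem exact_toCycles_cocycleClass [QuasiIso q] {i j : ℤ} (hi : i + 1 = j) :
    Function.Exact (P.toCycles i j).hom (cocycleClass q j) := by
  have h := ShortComplex.exact_of_g_is_cokernel
    (ShortComplex.mk _ _ (P.toCycles_comp_homologyπ i j))
    (P.homologyIsCokernel i j (by simp [← hi]))
  have h1 := (ShortComplex.ShortExact.moduleCat_exact_iff_function_exact _).mp h
  have h2 : Function.Injective (HomologicalComplex.homologyMap q j).hom :=
    (ModuleCat.mono_iff_injective _).mp inferInstance
  intro z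
  rw [← h1 z]
  exact (map_eq_zero_iff _ h2)

theorem iCycles_toCycles (i j : ℤ) (w : P.X i) :
    (P.iCycles j).hom ((P.toCycles i j).hom w) = (P.d i j).hom w := by
  rw [← P.toCycles_i i j]
  rfl

theorem d_iCycles (j k : ℤ) (z : P.cycles j) : (P.d j k).hom ((P.iCycles j).hom z) = 0 := by
  rw [← LinearMap.comp_apply, ← ModuleCat.hom_comp, P.iCycles_d]
  rfl

theorem d_d_apply (i j k : ℤ) (x : P.X i) : (P.d j k).hom ((P.d i j).hom x) = 0 := by
  rw [← LinearMap.comp_apply, ← ModuleCat.hom_comp, P.d_comp_d]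
  rfl

/-- `P` is exact where the cohomology of `C` vanishes. -/
theorem exact_of_subsingleton_homology [QuasiIso q] {i j k : ℤ} (hi : i + 1 = j) (hk : j + 1 = k)
    [Subsingleton (C.homology j)] : Function.Exact (P.d i j).hom (P.d j k).hom := by
  intro y
  refine ⟨fun hy => ?_, ?_⟩
  · obtain ⟨z, rfl⟩ := (exact_iCycles hk y).mp hy
    obtain ⟨w, rfl⟩ := (exact_toCycles_cocycleClass q hi z).mp (Subsingleton.elim _ _)
    exact ⟨w, (iCycles_toCycles i j w).symm⟩
  · rintro ⟨w, rfl⟩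
    exact d_d_apply i j k w

end

/-! ### Integral splittings -/

section

variable {S X₀ X₁ X₂ : Type*} [CommRing S] [AddCommGroup X₀] [Module S X₀] [AddCommGroup X₁]
  [Module S X₁] [AddCommGroup X₂] [Module S X₂]

/-- Splittings propagate to the left along an exact complex of projective modules. -/
theorem exists_splitting_of_exact_of_right (d : X₀ →ₗ[S] X₁) (d' : X₁ →ₗ[S] X₂)
    [Module.Projective S X₁] (hex : Function.Exact d d') (h' : X₂ →ₗ[S] X₁)
    (hh' : d' ∘ₗ h' ∘ₗ d' = d') : ∃ h : X₁ →ₗ[S] X₀, d ∘ₗ h ∘ₗ d = d := by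
  have hr : ∀ x, x - h' (d' x) ∈ LinearMap.range d := fun x => (hex _).mp (by
    rw [map_sub, sub_eq_zero]
    exact (LinearMap.congr_fun hh' x).symm)
  obtain ⟨h, hh⟩ := Module.projective_lifting_property d.rangeRestrict
    ((LinearMap.id - h' ∘ₗ d').codRestrict _ hr) d.surjective_rangeRestrict
  refine ⟨h, LinearMap.ext fun x => ?_⟩
  have h1 := congrArg Subtype.val (LinearMap.congr_fun hh (d x))
  have h2 : d (h (d x)) = d x - h' (d' (d x)) := h1
  rw [LinearMap.comp_apply, LinearMap.comp_apply, h2, hex.apply_apply_eq_zero, map_zero, sub_zero]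

/-- Splittings propagate to the right along an exact complex of projective modules over an order,
if the cokernel is torsion-free. -/
theorem exists_splitting_of_exact_of_left {R : Type*} [CommRing R] [IsDedekindDomain R]
    [Algebra R S] [Module.Finite R S] (d : X₀ →ₗ[S] X₁) (d' : X₁ →ₗ[S] X₂)
    [Module.Finite S X₁] [Module.Projective S X₁] [Module.Finite S X₂] [Module.Projective S X₂]
    (hex : Function.Exact d d') (h : X₁ →ₗ[S] X₀) (hh : d ∘ₗ h ∘ₗ d = d)
    (htf : ∀ r : R, r ≠ 0 → ∀ y, algebraMap R S r • y ∈ LinearMap.range d' →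
      y ∈ LinearMap.range d') : ∃ h' : X₂ →ₗ[S] X₁, d' ∘ₗ h' ∘ₗ d' = d' := by
  let X := LinearMap.range (LinearMap.id - d ∘ₗ h)
  have hhd : ∀ x, d (h (d x)) = d x := LinearMap.congr_fun hh
  have hX : ∀ x ∈ X, d (h x) = 0 := by
    rintro _ ⟨x, rfl⟩
    rw [LinearMap.sub_apply, map_sub, map_sub, LinearMap.comp_apply, LinearMap.id_apply, hhd,
      sub_self]
  have hd' : ∀ x, d' (x - d (h x)) = d' x := fun x => by
    rw [map_sub, hex.apply_apply_eq_zero, sub_zero]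
  have : Module.Projective S X := Module.Projective.of_split X.subtype
    (LinearMap.rangeRestrict (LinearMap.id - d ∘ₗ h)) (LinearMap.ext fun x => Subtype.ext (by
      change (x : X₁) - d (h x) = x
      rw [hX x x.2, sub_zero]))
  have hrange : LinearMap.range (d' ∘ₗ X.subtype) = LinearMap.range d' := by
    refine le_antisymm (LinearMap.range_comp_le_range _ _) ?_
    rintro _ ⟨x, rfl⟩
    exact ⟨⟨x - d (h x), x, rfl⟩, hd' x⟩
  obtain ⟨r, hr⟩ := exists_retraction_of_torsionFree_coker (R := R) (d' ∘ₗ X.subtype) (by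
    rw [← LinearMap.ker_eq_bot, LinearMap.ker_eq_bot']
    intro x hx
    obtain ⟨w, hw⟩ := (hex _).mp hx
    refine Subtype.ext ?_
    rw [Submodule.coe_zero, ← hX x x.2]
    rw [show (x : X₁) = d w from hw.symm, hhd]) (hrange ▸ htf)
  refine ⟨X.subtype ∘ₗ r, LinearMap.ext fun x => ?_⟩
  have h1 := LinearMap.congr_fun hr ⟨x - d (h x), x, rfl⟩
  have h2 : r (d' x) = ⟨x - d (h x), x, rfl⟩ := by
    rw [← hd' x]
    exact h1
  rw [LinearMap.comp_apply, LinearMap.comp_apply, LinearMap.comp_apply, h2]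
  exact hd' x

theorem eq_zero_of_smul_eq_zero_of_projective {R : Type*} [CommRing R] [IsDomain R]
    [Algebra R S] [Module.IsTorsionFree R S] [Module.Projective S X₀] {r : R} (hr : r ≠ 0) (x : X₀)
    (hx : algebraMap R S r • x = 0) : x = 0 := by
  refine (Module.forall_dual_apply_eq_zero_iff S x).mp fun φ => ?_
  have h := congrArg φ hx
  rw [map_smul, map_zero, smul_eq_mul, ← Algebra.smul_def] at h
  exact (smul_eq_zero.mp h).resolve_left hr

end

section

variable {R : Type*} {S : Type u} [CommRing R] [IsDedekindDomain R] [CommRing S] [Algebra R S]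
  [Module.Finite R S] [Module.IsTorsionFree R S] {P C : CochainComplex (ModuleCat.{u} S) ℤ}

/-- The differentials with target in odd degree split integrally: those above degree two since
`P` is bounded above and exact there, the other ones since their cokernels are torsion-free. -/
theorem exists_splitting_of_odd (q : P ⟶ C) [QuasiIso q] (hP : IsStrictlyPerfect P)
    (hC : ∀ i, i ≠ 1 → i ≠ 2 → Subsingleton (C.homology i))
    (htf : ∀ r : R, r ≠ 0 → ∀ m : C.homology 1, algebraMap R S r • m = 0 → m = 0)
    {i j : ℤ} (hij : i + 1 = j) (hj : Odd j) :
    ∃ h : P.X j →ₗ[S] P.X i, (P.d i j).hom ∘ₗ h ∘ₗ (P.d i j).hom = (P.d i j).hom := by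
  obtain ⟨n, hn⟩ := hP.bounded
  have := hP.finite
  have := hP.projective
  by_cases h3 : 3 ≤ j
  · obtain ⟨k, hk⟩ : ∃ k : ℕ, (n : ℤ) < j + k := ⟨n, by omega⟩
    clear hj
    induction k generalizing i j with
    | zero =>
      have := hn j (lt_of_lt_of_le (by omega) (le_abs_self j))
      exact ⟨0, Subsingleton.elim _ _⟩
    | succ k ih =>
      obtain ⟨h', hh'⟩ := ih (i := j) (j := j + 1) rfl (by omega) (by push_cast at hk; omega)
      have := hC j (by omega) (by omega)
      exact exists_splitting_of_exact_of_right _ _ (exact_of_subsingleton_homology q hij rfl) h' hh'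
  · have h1 : j ≤ 1 := by
      obtain ⟨l, hl⟩ := hj
      omega
    obtain ⟨k, hk⟩ : ∃ k : ℕ, j - k < -(n : ℤ) := ⟨n + 2, by push_cast; omega⟩
    clear hj h3
    induction k generalizing i j with
    | zero =>
      have := hn j (lt_of_lt_of_le (by push_cast at hk; omega) (neg_le_abs j))
      exact ⟨0, Subsingleton.elim _ _⟩
    | succ k ih =>
      obtain ⟨h, hh⟩ := ih (i := i - 1) (j := i) (by omega) (by omega) (by push_cast at hk; omega)
      have := hC i (by omega) (by omega)
      refine exists_splitting_of_exact_of_left (R := R) _ _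
        (exact_of_subsingleton_homology q (by omega) hij) h hh fun r hr y hy => ?_
      obtain ⟨w, hw⟩ := hy
      have hdy : (P.d j (j + 1)).hom y = 0 :=
        eq_zero_of_smul_eq_zero_of_projective hr _ (by rw [← map_smul, ← hw, d_d_apply])
      obtain ⟨z, rfl⟩ := (exact_iCycles rfl y).mp hdy
      have hz : algebraMap R S r • z = (P.toCycles i j).hom w := iCycles_injective j (by
        rw [map_smul, ← hw, iCycles_toCycles])
      have hcls : algebraMap R S r • cocycleClass q j z = 0 := by
        rw [← map_smul, hz, (exact_toCycles_cocycleClass q hij).apply_apply_eq_zero]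
      have hcls0 : cocycleClass q j z = 0 := by
        by_cases hj1 : j = 1
        · subst hj1
          exact htf r hr _ hcls
        · have := hC j hj1 (by omega)
          exact Subsingleton.elim _ _
      obtain ⟨w', rfl⟩ := (exact_toCycles_cocycleClass q hij z).mp hcls0
      exact ⟨w', (iCycles_toCycles i j w').symm⟩

end

/-! ### The two-term complex of a strictly perfect complex -/

/-- Integral splittings of the differentials of `P` with target in odd degree. -/
structure OddSplitting {S : Type u} [CommRing S] (P : CochainComplex (ModuleCat.{u} S) ℤ) where
  /-- the splitting of the differential from degree `i` to degree `j` -/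
  h (j i : ℤ) : P.X j →ₗ[S] P.X i
  d_h_d {i j : ℤ} (hij : i + 1 = j) (hj : Odd j) (x : P.X i) :
    (P.d i j).hom (h j i ((P.d i j).hom x)) = (P.d i j).hom x
  h_d_h {i j : ℤ} (hij : i + 1 = j) (hj : Odd j) (x : P.X j) :
    h j i ((P.d i j).hom (h j i x)) = h j i x

section

variable {S : Type u} [CommRing S] {P : CochainComplex (ModuleCat.{u} S) ℤ}

theorem nonempty_oddSplitting (H : ∀ i j : ℤ, i + 1 = j → Odd j → ∃ h : P.X j →ₗ[S] P.X i,
    (P.d i j).hom ∘ₗ h ∘ₗ (P.d i j).hom = (P.d i j).hom) : Nonempty (OddSplitting P) := by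
  classical
  choose h hh using H
  refine ⟨⟨fun j i => if hij : i + 1 = j ∧ Odd j then
    h i j hij.1 hij.2 ∘ₗ (P.d i j).hom ∘ₗ h i j hij.1 hij.2 else 0, fun hij hj x => ?_,
    fun hij hj x => ?_⟩⟩ <;>
  simp only [dif_pos (And.intro hij hj), LinearMap.comp_apply]
  · have h1 := LinearMap.congr_fun (hh _ _ hij hj)
    simp only [LinearMap.comp_apply] at h1
    rw [h1, h1]
  · have h1 := LinearMap.congr_fun (hh _ _ hij hj)
    simp only [LinearMap.comp_apply] at h1
    rw [h1, h1]

/-- The term of odd degree `i` in the odd part. -/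
abbrev oddLof (P : CochainComplex (ModuleCat.{u} S) ℤ) (i : {i : ℤ // Odd i}) :
    P.X i →ₗ[S] OddPart P :=
  DirectSum.lof S {i : ℤ // Odd i} (fun i => P.X i) i

/-- The term of even degree `i` in the even part. -/
abbrev evenLof (P : CochainComplex (ModuleCat.{u} S) ℤ) (i : {i : ℤ // Even i}) :
    P.X i →ₗ[S] EvenPart P :=
  DirectSum.lof S {i : ℤ // Even i} (fun i => P.X i) i

variable (t : OddSplitting P)

/-- The sum of the differentials and of the splittings, from the odd to the even part. -/
def OddSplitting.diff : OddPart P →ₗ[S] EvenPart P :=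
  DirectSum.toModule S _ _ fun i : {i : ℤ // Odd i} =>
    evenLof P ⟨i + 1, i.2.add_one⟩ ∘ₗ (P.d i (i + 1)).hom +
      evenLof P ⟨i - 1, i.2.sub_odd odd_one⟩ ∘ₗ t.h i (i - 1)

theorem OddSplitting.diff_oddLof (i : {i : ℤ // Odd i}) (k l : {i : ℤ // Even i})
    (hk : (i : ℤ) + 1 = k) (hl : (l : ℤ) + 1 = i) (x : P.X i) :
    t.diff (oddLof P i x) = evenLof P k ((P.d i k).hom x) + evenLof P l (t.h i l x) := by
  obtain ⟨k, hk'⟩ := k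
  obtain ⟨l, hl'⟩ := l
  obtain rfl : (i : ℤ) + 1 = k := hk
  obtain rfl : l = (i : ℤ) - 1 := by change l + 1 = i at hl; omega
  rw [OddSplitting.diff, DirectSum.toModule_lof]
  rfl

theorem OddSplitting.diff_oddLof_sub (i : {i : ℤ // Odd i}) (k : {i : ℤ // Even i}) (l : ℤ)
    (hk : (i : ℤ) + 1 = k) (hl : l + 1 = i) (x : P.X i) :
    t.diff (oddLof P i (x - (P.d l i).hom (t.h i l x))) = evenLof P k ((P.d i k).hom x) := by
  have hl' : Even l := by
    rw [show l = i - 1 by omega]; exact i.2.sub_odd odd_one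
  rw [t.diff_oddLof i k ⟨l, hl'⟩ hk hl]
  have h1 : (P.d i k).hom (x - (P.d l i).hom (t.h i l x)) = (P.d i k).hom x := by
    rw [map_sub, d_d_apply, sub_zero]
  have h2 : t.h i l (x - (P.d l i).hom (t.h i l x)) = 0 := by
    rw [map_sub, t.h_d_h hl i.2, sub_self]
  exact (congrArg₂ (fun a b => evenLof P k a + evenLof P ⟨l, hl'⟩ b) h1 h2).trans
    (by rw [map_zero, add_zero])

theorem OddSplitting.diff_apply (k : {i : ℤ // Even i}) (l m : {i : ℤ // Odd i})
    (hl : (l : ℤ) + 1 = k) (hm : (k : ℤ) + 1 = m) (x : OddPart P) :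
    t.diff x k = (P.d l k).hom (x l) + t.h m k (x m) := by
  induction x using DirectSum.induction_on with
  | zero => simp
  | add x y hx hy =>
    rw [map_add, DirectSum.add_apply, hx, hy, DirectSum.add_apply, DirectSum.add_apply, map_add,
      map_add]
    abel
  | of i x =>
    change t.diff (oddLof P i x) k = (P.d l k).hom (oddLof P i x l) + t.h m k (oddLof P i x m)
    have hlm : l ≠ m := fun h => by rw [h] at hl; omega
    by_cases h1 : i = l
    · subst h1
      rw [t.diff_oddLof i k ⟨i - 1, i.2.sub_odd odd_one⟩ hl (by simp), DirectSum.add_apply,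
        DirectSum.lof_apply, DirectSum.lof_apply, DirectSum.lof_eq_of, DirectSum.lof_eq_of,
        DirectSum.of_eq_of_ne _ _ _
          (fun h => by have := congrArg Subtype.val h; simp at this; omega),
        DirectSum.of_eq_of_ne _ _ _ hlm.symm, map_zero]
    · by_cases h2 : i = m
      · subst h2
        rw [t.diff_oddLof i ⟨i + 1, i.2.add_one⟩ k rfl hm, DirectSum.add_apply,
          DirectSum.lof_apply, DirectSum.lof_apply, DirectSum.lof_eq_of, DirectSum.lof_eq_of,
          DirectSum.of_eq_of_ne _ _ _
            (fun h => by have := congrArg Subtype.val h; simp at this; omega),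
          DirectSum.of_eq_of_ne _ _ _ hlm, map_zero]
      · rw [t.diff_oddLof i ⟨i + 1, i.2.add_one⟩ ⟨i - 1, i.2.sub_odd odd_one⟩ rfl (by simp),
          DirectSum.add_apply, DirectSum.lof_eq_of, DirectSum.lof_eq_of, DirectSum.lof_eq_of,
          DirectSum.of_eq_of_ne _ _ _ (fun h => h1 (Subtype.ext (by
            have := congrArg Subtype.val h; simp at this; omega))),
          DirectSum.of_eq_of_ne _ _ _ (fun h => h2 (Subtype.ext (by
            have := congrArg Subtype.val h; simp at this; omega))),
          DirectSum.of_eq_of_ne _ _ _ (Ne.symm h1), DirectSum.of_eq_of_ne _ _ _ (Ne.symm h2),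
          map_zero, map_zero]

theorem exists_factor_of_surjective {A D G : Type*} [AddCommGroup A] [Module S A]
    [AddCommGroup D] [Module S D] [AddCommGroup G] [Module S G] (f : A →ₗ[S] D)
    (hf : Function.Surjective f) (g : A →ₗ[S] G) (hg : ∀ x, f x = 0 → g x = 0) :
    ∃ g' : D →ₗ[S] G, ∀ x, g' (f x) = g x := by
  refine ⟨(LinearMap.ker f).liftQ g hg ∘ₗ (f.quotKerEquivOfSurjective hf).symm.toLinearMap,
    fun x => ?_⟩
  have h1 : (f.quotKerEquivOfSurjective hf).symm (f x) = (LinearMap.ker f).mkQ x :=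
    (LinearEquiv.symm_apply_eq _).mpr rfl
  rw [LinearMap.comp_apply, LinearEquiv.coe_coe, h1]
  rfl

variable {C : CochainComplex (ModuleCat.{u} S) ℤ} (q : P ⟶ C) [QuasiIso q]

/-- The kernel of the differential of the two-term complex is `H^1(C)`. -/
theorem OddSplitting.exists_incl (hC : ∀ i, i ≠ 1 → i ≠ 2 → Subsingleton (C.homology i)) :
    ∃ incl : C.homology 1 →ₗ[S] OddPart P,
      (∀ z, incl (cocycleClass q 1 z) = oddLof P ⟨1, odd_one⟩ ((P.iCycles 1).hom z -
        (P.d 0 1).hom (t.h 1 0 ((P.iCycles 1).hom z)))) ∧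
      Function.Injective incl ∧ Function.Exact incl t.diff := by
  have hinj : Function.Injective (oddLof P ⟨1, odd_one⟩) := DirectSum.of_injective _
  obtain ⟨incl, hincl⟩ := exists_factor_of_surjective (cocycleClass q 1)
    (cocycleClass_surjective q 1) (oddLof P ⟨1, odd_one⟩ ∘ₗ
      (LinearMap.id - (P.d 0 1).hom ∘ₗ t.h 1 0) ∘ₗ (P.iCycles 1).hom) (fun z hz => by
    obtain ⟨w, rfl⟩ := (exact_toCycles_cocycleClass q (zero_add 1) z).mp hz
    rw [LinearMap.comp_apply, LinearMap.comp_apply, iCycles_toCycles, LinearMap.sub_apply,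
      LinearMap.comp_apply, t.d_h_d (zero_add 1) odd_one, LinearMap.id_apply, sub_self, map_zero])
  have hincl' : ∀ z, incl (cocycleClass q 1 z) = oddLof P ⟨1, odd_one⟩ ((P.iCycles 1).hom z -
        (P.d 0 1).hom (t.h 1 0 ((P.iCycles 1).hom z))) := hincl
  refine ⟨incl, hincl', ?_, fun x => ⟨fun hx => ?_, ?_⟩⟩
  · rw [← LinearMap.ker_eq_bot, LinearMap.ker_eq_bot']
    intro n hn
    obtain ⟨z, rfl⟩ := cocycleClass_surjective q 1 n
    rw [hincl', map_eq_zero_iff _ hinj, sub_eq_zero] at hn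
    refine (exact_toCycles_cocycleClass q (zero_add 1) z).mpr
      ⟨t.h 1 0 ((P.iCycles 1).hom z), iCycles_injective 1 ?_⟩
    rw [iCycles_toCycles, ← hn]
  · have key : ∀ (k : {i : ℤ // Even i}) (l m : {i : ℤ // Odd i}), (l : ℤ) + 1 = k →
        (k : ℤ) + 1 = m → (P.d l k).hom (x l) = 0 ∧ t.h m k (x m) = 0 := by
      intro k l m hl hm
      have h1 : (P.d l k).hom (x l) + t.h m k (x m) = 0 := by
        rw [← t.diff_apply k l m hl hm, hx, DirectSum.zero_apply]
      have h2 := congrArg (P.d k m).hom h1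
      rw [map_add, d_d_apply, zero_add, map_zero] at h2
      have h3 := t.h_d_h hm m.2 (x m)
      rw [h2, map_zero] at h3
      rw [← h3, add_zero] at h1
      exact ⟨h1, h3.symm⟩
    have hd : ∀ (i : {i : ℤ // Odd i}) (k : ℤ), (i : ℤ) + 1 = k → (P.d i k).hom (x i) = 0 := by
      rintro i k rfl
      exact (key ⟨i + 1, i.2.add_one⟩ i ⟨i + 1 + 1, i.2.add_one.add_one⟩ rfl rfl).1
    have hh : ∀ (i : {i : ℤ // Odd i}) (k : ℤ), k + 1 = (i : ℤ) → t.h i k (x i) = 0 := by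
      intro i k hk
      have hk2 : Even k := by
        have : k = i - 1 := by omega
        rw [this]; exact i.2.sub_odd odd_one
      exact (key ⟨k, hk2⟩ ⟨k - 1, hk2.sub_odd odd_one⟩ i (by simp) hk).2
    obtain ⟨z, hz⟩ := (exact_iCycles (P := P) (j := 1) (k := 2) rfl (x ⟨1, odd_one⟩)).mp
      (hd ⟨1, odd_one⟩ 2 rfl)
    refine ⟨cocycleClass q 1 z, ?_⟩
    rw [hincl', hz, hh ⟨1, odd_one⟩ 0 rfl, map_zero, sub_zero]
    refine DFinsupp.ext fun i => ?_
    by_cases hi : i = ⟨1, odd_one⟩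
    · subst hi
      exact DirectSum.lof_apply _ _ _
    · refine (DirectSum.of_eq_of_ne _ _ _ hi).trans ?_
      have := hC i (fun h => hi (Subtype.ext h)) (fun h => by
        have := i.2; rw [h] at this; exact absurd this (by decide))
      obtain ⟨w, hw⟩ := (exact_of_subsingleton_homology q (i := i - 1) (j := i) (k := i + 1)
        (by omega) rfl (x i)).mp (hd i _ rfl)
      have h1 := t.d_h_d (i := i - 1) (j := i) (by omega) i.2 w
      rw [hw, hh i (i - 1) (by omega), map_zero] at h1
      exact h1
  · rintro ⟨n, rfl⟩
    obtain ⟨z, rfl⟩ := cocycleClass_surjective q 1 n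
    have h1 := t.diff_oddLof_sub ⟨1, odd_one⟩ ⟨2, even_two⟩ 0 rfl rfl ((P.iCycles 1).hom z)
    rw [d_iCycles, map_zero] at h1
    rw [hincl']
    exact h1

/-- The cokernel of the differential of the two-term complex is `H^2(C)`. -/
theorem OddSplitting.exists_proj (hC : ∀ i, i ≠ 1 → i ≠ 2 → Subsingleton (C.homology i)) :
    ∃ proj : EvenPart P →ₗ[S] C.homology 2,
      (∀ k : {i : ℤ // Even i}, (k : ℤ) ≠ 2 → proj ∘ₗ evenLof P k = 0) ∧
      (proj ∘ₗ evenLof P ⟨2, even_two⟩ ∘ₗ (P.iCycles 2).hom = cocycleClass q 2) ∧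
      (proj ∘ₗ evenLof P ⟨2, even_two⟩ ∘ₗ t.h 3 2 = 0) ∧
      Function.Exact t.diff proj ∧ Function.Surjective proj := by
  have odd_three : Odd (3 : ℤ) := by decide
  have h23 : (2 : ℤ) + 1 = 3 := rfl
  let f : P.X 2 →ₗ[S] P.X 2 := LinearMap.id - t.h 3 2 ∘ₗ (P.d 2 3).hom
  have hf : ModuleCat.ofHom f ≫ P.d 2 3 = 0 := by
    ext x
    change (P.d 2 3).hom (x - t.h 3 2 ((P.d 2 3).hom x)) = 0
    rw [map_sub, t.d_h_d h23 odd_three, sub_self]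
  let p : P.X 2 →ₗ[S] P.cycles 2 := (P.liftCycles (ModuleCat.ofHom f) 3 (by simp) hf).hom
  have hp : ∀ x, (P.iCycles 2).hom (p x) = x - t.h 3 2 ((P.d 2 3).hom x) := fun x => by
    have h1 : P.liftCycles (ModuleCat.ofHom f) 3 (by simp) hf ≫ P.iCycles 2 = ModuleCat.ofHom f :=
      P.liftCycles_i _ _ _ _
    exact LinearMap.congr_fun (congrArg ModuleCat.Hom.hom h1) x
  let proj : EvenPart P →ₗ[S] C.homology 2 := cocycleClass q 2 ∘ₗ p ∘ₗ
    DirectSum.component S {i : ℤ // Even i} (fun i => P.X i) ⟨2, even_two⟩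
  have hproj : ∀ x, proj x = cocycleClass q 2 (p (x ⟨2, even_two⟩)) := fun x => rfl
  have hproj2 : ∀ x, proj (evenLof P ⟨2, even_two⟩ x) = cocycleClass q 2 (p x) := fun x => by
    rw [hproj, DirectSum.lof_apply]
  have h1 : ∀ k : {i : ℤ // Even i}, (k : ℤ) ≠ 2 → proj ∘ₗ evenLof P k = 0 := fun k hk => by
    ext x
    rw [LinearMap.comp_apply, hproj, DirectSum.lof_eq_of,
      DirectSum.of_eq_of_ne _ _ _ (fun h => hk (by rw [← h])), map_zero, map_zero,
      LinearMap.zero_apply]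
  have h2 : ∀ z, proj (evenLof P ⟨2, even_two⟩ ((P.iCycles 2).hom z)) = cocycleClass q 2 z := by
    intro z
    rw [hproj2]
    congr 1
    refine iCycles_injective 2 ?_
    rw [hp, d_iCycles, map_zero, sub_zero]
  have h3 : ∀ y, proj (evenLof P ⟨2, even_two⟩ (t.h 3 2 y)) = 0 := fun y => by
    have : p (t.h 3 2 y) = 0 := iCycles_injective 2 (by
      rw [hp, t.h_d_h h23 odd_three, sub_self, map_zero])
    rw [hproj2, this, map_zero]
  refine ⟨proj, h1, LinearMap.ext h2, LinearMap.ext h3, fun x => ⟨fun hx => ?_, ?_⟩, fun n => ?_⟩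
  · -- boundaries and the images of the splittings lie in the range of the differential
    have hdr : ∀ (k : {i : ℤ // Even i}) (l : ℤ), l + 1 = k → ∀ w,
        evenLof P k ((P.d l k).hom w) ∈ LinearMap.range t.diff := by
      intro k l hl w
      have hl' : Odd l := by
        rw [show l = k - 1 by omega]; exact k.2.sub_odd odd_one
      have h0 : l - 1 + 1 = l := by omega
      exact ⟨_, t.diff_oddLof_sub ⟨l, hl'⟩ k (l - 1) hl h0 w⟩
    have hhr : ∀ (k : {i : ℤ // Even i}) (m : ℤ), (k : ℤ) + 1 = m → ∀ y,
        evenLof P k (t.h m k y) ∈ LinearMap.range t.diff := by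
      intro k m hm y
      have hm' : Odd m := by rw [← hm]; exact k.2.add_one
      refine ⟨oddLof P ⟨m, hm'⟩ ((P.d k m).hom (t.h m k y)), ?_⟩
      rw [t.diff_oddLof ⟨m, hm'⟩ ⟨m + 1, hm'.add_one⟩ k rfl hm, d_d_apply, t.h_d_h hm hm',
        map_zero, zero_add]
    have hne : ∀ k : {i : ℤ // Even i}, (k : ℤ) ≠ 2 → ∀ y,
        evenLof P k y ∈ LinearMap.range t.diff := by
      intro k hk y
      have := hC k (fun h => by have := k.2; rw [h] at this; exact absurd this (by decide)) hk
      have hm : Odd ((k : ℤ) + 1) := k.2.add_one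
      have hcyc : (P.d k (k + 1)).hom (y - t.h (k + 1) k ((P.d k (k + 1)).hom y)) = 0 := by
        rw [map_sub, t.d_h_d rfl hm, sub_self]
      obtain ⟨w, hw⟩ := (exact_of_subsingleton_homology q (i := k - 1) (j := k) (k := k + 1)
        (by omega) rfl _).mp hcyc
      have : evenLof P k y = evenLof P k ((P.d (k - 1) k).hom w) +
          evenLof P k (t.h (k + 1) k ((P.d k (k + 1)).hom y)) := by
        rw [hw, map_sub, sub_add_cancel]
      rw [this]
      exact add_mem (hdr k _ (by omega) w) (hhr k _ rfl _)
    have hx2 : evenLof P ⟨2, even_two⟩ (x ⟨2, even_two⟩) ∈ LinearMap.range t.diff := by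
      rw [hproj] at hx
      obtain ⟨w, hw⟩ := (exact_toCycles_cocycleClass q (i := 1) (j := 2) rfl _).mp hx
      have h4 := congrArg (P.iCycles 2).hom hw
      rw [iCycles_toCycles, hp] at h4
      have : evenLof P ⟨2, even_two⟩ (x ⟨2, even_two⟩) =
          evenLof P ⟨2, even_two⟩ ((P.d 1 2).hom w) + evenLof P ⟨2, even_two⟩
            (t.h 3 2 ((P.d 2 3).hom (x ⟨2, even_two⟩))) := by
        rw [h4, map_sub, sub_add_cancel]
      rw [this]
      exact add_mem (hdr ⟨2, even_two⟩ 1 rfl w) (hhr ⟨2, even_two⟩ 3 rfl _)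
    have hdiff : ∀ x : EvenPart P, x - evenLof P ⟨2, even_two⟩ (x ⟨2, even_two⟩) ∈
        LinearMap.range t.diff := by
      intro x
      induction x using DirectSum.induction_on with
      | zero => simp
      | add x y hx hy =>
        rw [DirectSum.add_apply, map_add, add_sub_add_comm]
        exact add_mem hx hy
      | of k y =>
        by_cases hk : k = ⟨2, even_two⟩
        · subst hk
          rw [DirectSum.of_eq_same, DirectSum.lof_eq_of, sub_self]
          exact zero_mem _
        · rw [DirectSum.of_eq_of_ne _ _ _ (Ne.symm hk), map_zero, sub_zero]
          exact hne k (fun h => hk (Subtype.ext h)) y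
    have := add_mem (hdiff x) hx2
    rwa [sub_add_cancel] at this
  · rintro ⟨y, rfl⟩
    have hdx : t.diff y ⟨2, even_two⟩ = (P.d 1 2).hom (y ⟨1, odd_one⟩) +
        t.h 3 2 (y ⟨3, odd_three⟩) :=
      t.diff_apply ⟨2, even_two⟩ ⟨1, odd_one⟩ ⟨3, odd_three⟩ rfl rfl y
    have h4 := h2 ((P.toCycles 1 2).hom (y ⟨1, odd_one⟩))
    rw [iCycles_toCycles, (exact_toCycles_cocycleClass q (i := 1) (j := 2)
      rfl).apply_apply_eq_zero] at h4
    rw [hproj, hdx, ← hproj2, map_add, map_add, h3, add_zero, h4]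
  · obtain ⟨z, rfl⟩ := cocycleClass_surjective q 2 n
    exact ⟨_, h2 z⟩

end

/-! ### Comparison with the isomorphism that is induced by a splitting -/

section

/-- An endomorphism that lowers a finite filtration by two steps is nilpotent. -/
theorem isNilpotent_of_forall_map_le {B W : Type*} [CommRing B] [AddCommGroup W] [Module B W]
    (T : ℤ → Submodule B W) (f : Module.End B W) (a c : ℤ) (ha : T a = ⊤)
    (hc : ∀ n, n < c → T n = ⊥) (h : ∀ n, ∀ x ∈ T n, f x ∈ T (n - 2)) : IsNilpotent f := by
  have h1 : ∀ k : ℕ, ∀ x, (f ^ k) x ∈ T (a - 2 * k) := by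
    intro k
    induction k with
    | zero => intro x; simp [ha]
    | succ k ih =>
      intro x
      rw [pow_succ', Module.End.mul_apply]
      have := h _ _ (ih x)
      convert this using 2
      push_cast
      ring
  refine ⟨(a - c + 1).toNat, LinearMap.ext fun x => ?_⟩
  have := h1 (a - c + 1).toNat x
  by_cases hac : 0 ≤ a - c + 1
  · rwa [hc _ (by omega), Submodule.mem_bot] at this
  · have h0 := h1 0 ((f ^ (a - c + 1).toNat) x)
    rw [hc _ (by push_cast; omega), Submodule.mem_bot] at h0
    exact h0

variable {S : Type u} [CommRing S] {B : Type v} [CommRing B] [Algebra S B] [Module.Flat S B]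
  {P C : CochainComplex (ModuleCat.{u} S) ℤ} {q : P ⟶ C} [QuasiIso q]

omit [Module.Flat S B] [QuasiIso q] in
theorem baseChange_d_d (i j k : ℤ) (x : B ⊗[S] P.X i) :
    (P.d j k).hom.baseChange B ((P.d i j).hom.baseChange B x) = 0 := by
  rw [← LinearMap.comp_apply, ← LinearMap.baseChange_comp, ← ModuleCat.hom_comp, P.d_comp_d,
    ModuleCat.hom_zero, LinearMap.baseChange_zero, LinearMap.zero_apply]

omit [Module.Flat S B] [QuasiIso q] in
theorem baseChange_d_of_mem (i j k : ℤ) {x : B ⊗[S] P.X j} (hx : x ∈ boundaries B P i j) :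
    (P.d j k).hom.baseChange B x = 0 := by
  obtain ⟨w, rfl⟩ := hx
  exact baseChange_d_d i j k w

omit [Module.Flat S B] [QuasiIso q] in
theorem baseChange_d_iCycles (j k : ℤ) (z : B ⊗[S] P.cycles j) :
    (P.d j k).hom.baseChange B ((P.iCycles j).hom.baseChange B z) = 0 := by
  rw [← LinearMap.comp_apply, ← LinearMap.baseChange_comp, ← ModuleCat.hom_comp, P.iCycles_d,
    ModuleCat.hom_zero, LinearMap.baseChange_zero, LinearMap.zero_apply]

omit [Module.Flat S B] [QuasiIso q] in
theorem baseChange_iCycles_toCycles (i j : ℤ) (w : B ⊗[S] P.X i) :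
    (P.iCycles j).hom.baseChange B ((P.toCycles i j).hom.baseChange B w) =
      (P.d i j).hom.baseChange B w := by
  rw [← LinearMap.comp_apply, ← LinearMap.baseChange_comp, ← ModuleCat.hom_comp, P.toCycles_i]

/-- A cocycle over `B` is a boundary up to the representative of its class. -/
theorem Splitting.exists_sub_rep_mem (s : Splitting B q) {i j k : ℤ} (hi : i + 1 = j)
    (hk : j + 1 = k) (x : B ⊗[S] P.X j) (hx : (P.d j k).hom.baseChange B x = 0) :
    ∃ n, x - s.rep j n ∈ boundaries B P i j := by
  obtain ⟨z, rfl⟩ := (Module.Flat.lTensor_exact B (exact_iCycles hk) x).mp hx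
  obtain ⟨w, hw⟩ := (Module.Flat.lTensor_exact B (exact_toCycles_cocycleClass q hi)
    (z - s.sigma j ((cocycleClass q j).baseChange B z))).mp (by
      change (cocycleClass q j).baseChange B _ = 0
      rw [map_sub, s.class_sigma, sub_self])
  refine ⟨(cocycleClass q j).baseChange B z, w, ?_⟩
  rw [← baseChange_iCycles_toCycles]
  change (P.toCycles i j).hom.baseChange B w = _ at hw
  rw [hw, map_sub]
  rfl

omit [Module.Flat S B] [QuasiIso q] in
theorem Splitting.d_rep (s : Splitting B q) (j k : ℤ) (n : B ⊗[S] C.homology j) :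
    (P.d j k).hom.baseChange B (s.rep j n) = 0 :=
  baseChange_d_iCycles j k _

end

section

variable {S : Type u} [CommRing S] {B : Type v} [CommRing B] [Algebra S B]
  {P C : CochainComplex (ModuleCat.{u} S) ℤ} {q : P ⟶ C}

theorem OddSplitting.baseChange_d_h_d (t : OddSplitting P) {i j : ℤ} (hij : i + 1 = j)
    (hj : Odd j) (x : B ⊗[S] P.X i) :
    (P.d i j).hom.baseChange B ((t.h j i).baseChange B ((P.d i j).hom.baseChange B x)) =
      (P.d i j).hom.baseChange B x := by
  have h : (P.d i j).hom ∘ₗ t.h j i ∘ₗ (P.d i j).hom = (P.d i j).hom :=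
    LinearMap.ext (t.d_h_d hij hj)
  conv_rhs => rw [← h, LinearMap.baseChange_comp, LinearMap.baseChange_comp]
  rfl

theorem OddSplitting.baseChange_diff_oddIncl (t : OddSplitting P) (i : {i : ℤ // Odd i})
    (k l : {i : ℤ // Even i}) (hk : (i : ℤ) + 1 = k) (hl : (l : ℤ) + 1 = i)
    (x : B ⊗[S] P.X i) :
    t.diff.baseChange B (oddIncl B P i x) = evenIncl B P k ((P.d i k).hom.baseChange B x) +
      evenIncl B P l ((t.h i l).baseChange B x) := by
  have h : t.diff ∘ₗ oddLof P i = evenLof P k ∘ₗ (P.d i k).hom + evenLof P l ∘ₗ t.h i l :=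
    LinearMap.ext (t.diff_oddLof i k l hk hl)
  have h1 := LinearMap.congr_fun (congrArg (LinearMap.baseChange B) h) x
  rw [LinearMap.baseChange_comp, LinearMap.baseChange_add, LinearMap.baseChange_comp,
    LinearMap.baseChange_comp] at h1
  exact h1

/-- The projection to `H^2(C)` that `OddSplitting.exists_proj` provides. -/
structure IsEvenProj (t : OddSplitting P) (q : P ⟶ C) (proj : EvenPart P →ₗ[S] C.homology 2) :
    Prop where
  comp_lof (k : {i : ℤ // Even i}) (hk : (k : ℤ) ≠ 2) : proj ∘ₗ evenLof P k = 0
  comp_iCycles : proj ∘ₗ evenLof P ⟨2, even_two⟩ ∘ₗ (P.iCycles 2).hom = cocycleClass q 2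
  comp_h : proj ∘ₗ evenLof P ⟨2, even_two⟩ ∘ₗ t.h 3 2 = 0

variable {t : OddSplitting P} {proj : EvenPart P →ₗ[S] C.homology 2} (hp : IsEvenProj t q proj)
include hp

theorem IsEvenProj.evenIncl_eq_zero (k : {i : ℤ // Even i}) (hk : (k : ℤ) ≠ 2)
    (x : B ⊗[S] P.X k) : proj.baseChange B (evenIncl B P k x) = 0 := by
  rw [evenIncl, ← LinearMap.comp_apply, ← LinearMap.baseChange_comp, hp.comp_lof k hk,
    LinearMap.baseChange_zero, LinearMap.zero_apply]

theorem IsEvenProj.evenIncl_iCycles (z : B ⊗[S] P.cycles 2) :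
    proj.baseChange B (evenIncl B P ⟨2, even_two⟩ ((P.iCycles 2).hom.baseChange B z)) =
      (cocycleClass q 2).baseChange B z := by
  rw [← hp.comp_iCycles, LinearMap.baseChange_comp, LinearMap.baseChange_comp]
  rfl

theorem IsEvenProj.evenIncl_rep (s : Splitting B q) (n : B ⊗[S] C.homology 2) :
    proj.baseChange B (evenIncl B P ⟨2, even_two⟩ (s.rep 2 n)) = n :=
  (hp.evenIncl_iCycles _).trans (s.class_sigma 2 n)

theorem IsEvenProj.evenIncl_h (x : B ⊗[S] P.X 3) :
    proj.baseChange B (evenIncl B P ⟨2, even_two⟩ ((t.h 3 2).baseChange B x)) = 0 := by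
  have h := LinearMap.congr_fun (congrArg (LinearMap.baseChange B) hp.comp_h) x
  rw [LinearMap.baseChange_comp, LinearMap.baseChange_comp, LinearMap.baseChange_zero] at h
  exact h

theorem IsEvenProj.evenIncl_of_mem [QuasiIso q] {i : ℤ} (k : {i : ℤ // Even i}) (hi : i + 1 = k)
    {x : B ⊗[S] P.X k} (hx : x ∈ boundaries B P i k) :
    proj.baseChange B (evenIncl B P k x) = 0 := by
  by_cases hk : (k : ℤ) = 2
  · obtain ⟨k, hk'⟩ := k
    obtain rfl : k = 2 := hk
    obtain ⟨w, rfl⟩ := hx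
    have h1 := hp.evenIncl_iCycles ((P.toCycles i 2).hom.baseChange B w)
    rw [baseChange_iCycles_toCycles] at h1
    refine h1.trans ?_
    have h2 : cocycleClass q 2 ∘ₗ (P.toCycles i 2).hom = 0 :=
      (exact_toCycles_cocycleClass q hi).linearMap_comp_eq_zero
    rw [← LinearMap.comp_apply, ← LinearMap.baseChange_comp, h2, LinearMap.baseChange_zero,
      LinearMap.zero_apply]
  · exact hp.evenIncl_eq_zero k hk x

end

section

variable {S : Type u} [CommRing S] {B : Type v} [CommRing B] [Algebra S B] [Module.Flat S B]
  {P C : CochainComplex (ModuleCat.{u} S) ℤ} {q : P ⟶ C} [QuasiIso q]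
  {lam : (B ⊗[S] C.homology 1) ≃ₗ[B] (B ⊗[S] C.homology 2)} {s : Splitting B q}
  {Φ : (B ⊗[S] OddPart P) ≃ₗ[B] (B ⊗[S] EvenPart P)} {t : OddSplitting P}
  {proj : EvenPart P →ₗ[S] C.homology 2}

variable (s Φ t proj) in
/-- The differential of the two-term complex, completed to an isomorphism by the action of `Φ` on
cohomology. -/
def completedDiff : (B ⊗[S] OddPart P) →ₗ[B] (B ⊗[S] EvenPart P) :=
  t.diff.baseChange B +
    evenIncl B P ⟨2, even_two⟩ ∘ₗ s.rep 2 ∘ₗ proj.baseChange B ∘ₗ Φ.toLinearMap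

variable (s Φ t proj) in
/-- The difference between the automorphism `Φ⁻¹ ∘ completedDiff` and the identity. -/
def unipotentPart : Module.End B (B ⊗[S] OddPart P) :=
  Φ.symm.toLinearMap ∘ₗ completedDiff s Φ t proj - LinearMap.id

variable (hC : ∀ i, i ≠ 1 → i ≠ 2 → Subsingleton (C.homology i))
  (hΦ : IsInducedIso s lam Φ) (hp : IsEvenProj t q proj)
include hC hΦ

/-- `Φ⁻¹` maps even degree `k` to the boundaries in degree `k + 1` and to degree `k - 1`. -/
theorem IsInducedIso.symm_evenIncl_mem (k : {i : ℤ // Even i}) (l m : {i : ℤ // Odd i})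
    (hl : (l : ℤ) + 1 = k) (hm : (k : ℤ) + 1 = m) (x : B ⊗[S] P.X k) :
    Φ.symm (evenIncl B P k x) ∈ (boundaries B P k m).map (oddIncl B P m) ⊔
      LinearMap.range (oddIncl B P l) := by
  let b : boundaries B P k m := ⟨(P.d k m).hom.baseChange B x, LinearMap.mem_range_self _ _⟩
  obtain ⟨n, hn⟩ := s.exists_sub_rep_mem hl hm (x - s.rho k m b) (by
    rw [map_sub, s.d_rho, sub_self])
  have h1 : Φ.symm (evenIncl B P k (s.rho k m b)) = oddIncl B P m b :=
    (LinearEquiv.symm_apply_eq _).mpr (hΦ.map_boundary k m b).symm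
  have h2 := (LinearEquiv.symm_apply_eq Φ).mpr (hΦ.map_section l k ⟨_, hn⟩).symm
  have h3 : Φ.symm (evenIncl B P k (s.rep k n)) ∈ LinearMap.range (oddIncl B P l) := by
    by_cases hk : (k : ℤ) = 2
    · obtain ⟨k, hk'⟩ := k
      obtain ⟨l, hl'⟩ := l
      obtain rfl : k = 2 := hk
      obtain rfl : l = 1 := by change l + 1 = 2 at hl; omega
      have h4 := hΦ.map_cohomology (lam.symm n)
      rw [lam.apply_symm_apply] at h4
      exact ⟨_, ((LinearEquiv.symm_apply_eq Φ).mpr h4.symm).symm⟩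
    · have := hC k (fun h => by have := k.2; rw [h] at this; exact absurd this (by decide)) hk
      rw [Subsingleton.elim n 0, map_zero, map_zero, map_zero]
      exact zero_mem _
  have h4 : x = s.rho k m b + ((x - s.rho k m b - s.rep k n) + s.rep k n) := by abel
  rw [h4, map_add, map_add, h1, map_add, map_add]
  refine add_mem (Submodule.mem_sup_left ⟨b, b.2, rfl⟩) (Submodule.mem_sup_right ?_)
  exact add_mem ⟨_, h2.symm⟩ h3

include hp

/-- On boundaries the unipotent part lowers the degree by two. -/
theorem IsInducedIso.unipotentPart_of_mem (i : {i : ℤ // Odd i}) (k : {i : ℤ // Even i})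
    (l : {i : ℤ // Odd i}) (hk : (k : ℤ) + 1 = i) (hl : (l : ℤ) + 1 = k) (b : B ⊗[S] P.X i)
    (hb : b ∈ boundaries B P k i) :
    unipotentPart s Φ t proj (oddIncl B P i b) ∈ LinearMap.range (oddIncl B P l) := by
  have h1 := hΦ.map_boundary k i ⟨b, hb⟩
  have hhb : (P.d k i).hom.baseChange B ((t.h i k).baseChange B b) = b := by
    obtain ⟨w, rfl⟩ := hb
    exact t.baseChange_d_h_d hk i.2 w
  set ρ := s.rho k i ⟨b, hb⟩ with hρ
  set w := (t.h i k).baseChange B b - ρ with hw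
  obtain ⟨n, hn⟩ := s.exists_sub_rep_mem hl hk w (by rw [hw, map_sub, s.d_rho, hhb, sub_self])
  have h2 : completedDiff s Φ t proj (oddIncl B P i b) - evenIncl B P k ρ =
      evenIncl B P k (w - s.rep k n) := by
    rw [completedDiff, LinearMap.add_apply,
      t.baseChange_diff_oddIncl i ⟨i + 1, i.2.add_one⟩ k rfl hk, baseChange_d_of_mem k i _ hb,
      map_zero, zero_add, LinearMap.comp_apply, LinearMap.comp_apply, LinearMap.comp_apply,
      LinearEquiv.coe_coe, h1]
    by_cases hk2 : (k : ℤ) = 2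
    · obtain ⟨k, hk'⟩ := k
      obtain ⟨i, hi'⟩ := i
      obtain rfl : k = 2 := hk2
      obtain rfl : i = 3 := by change 2 + 1 = i at hk; omega
      have h3 : proj.baseChange B (evenIncl B P ⟨2, even_two⟩ ρ) = -n := by
        have h4 : ρ = (t.h 3 2).baseChange B b - ((w - s.rep 2 n) + s.rep 2 n) := by
          rw [hw]; abel
        rw [h4, map_sub, map_sub, hp.evenIncl_h, map_add, map_add, hp.evenIncl_rep,
          hp.evenIncl_of_mem ⟨2, even_two⟩ hl hn, zero_add, zero_sub]
      rw [h3, map_neg, map_neg, hw, map_sub, map_sub]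
      abel
    · have := hC k (fun h => by have := k.2; rw [h] at this; exact absurd this (by decide)) hk2
      rw [Subsingleton.elim n 0, map_zero, sub_zero, hp.evenIncl_eq_zero k hk2, map_zero, map_zero,
        add_zero, hw, map_sub]
  have h5 : unipotentPart s Φ t proj (oddIncl B P i b) =
      Φ.symm (evenIncl B P k (w - s.rep k n)) := by
    rw [← h2, ← h1, map_sub, Φ.symm_apply_apply]
    rfl
  rw [h5]
  exact ⟨_, ((LinearEquiv.symm_apply_eq Φ).mpr (hΦ.map_section l k ⟨_, hn⟩).symm).symm⟩

/-- The unipotent part maps degree `i` to the boundaries in degree `i` and to degree `i - 2`. -/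
theorem IsInducedIso.unipotentPart_mem (i : {i : ℤ // Odd i}) (k : {i : ℤ // Even i})
    (l : {i : ℤ // Odd i}) (hk : (k : ℤ) + 1 = i) (hl : (l : ℤ) + 1 = k) (x : B ⊗[S] P.X i) :
    unipotentPart s Φ t proj (oddIncl B P i x) ∈
      (boundaries B P k i).map (oddIncl B P i) ⊔ LinearMap.range (oddIncl B P l) := by
  let m : {i : ℤ // Even i} := ⟨i + 1, i.2.add_one⟩
  let b : boundaries B P i m := ⟨(P.d i m).hom.baseChange B x, LinearMap.mem_range_self _ _⟩
  obtain ⟨n, hn⟩ := s.exists_sub_rep_mem hk (k := m) rfl (x - s.rho i m b) (by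
    rw [map_sub, s.d_rho, sub_self])
  -- outside the boundaries, `Φ` and the completed differential differ by a splitting
  have key : ∀ w : B ⊗[S] P.X i, completedDiff s Φ t proj (oddIncl B P i w) =
      Φ (oddIncl B P i w) + evenIncl B P k ((t.h i k).baseChange B w) →
      unipotentPart s Φ t proj (oddIncl B P i w) ∈
        (boundaries B P k i).map (oddIncl B P i) ⊔ LinearMap.range (oddIncl B P l) := by
    intro w hw
    have h1 : unipotentPart s Φ t proj (oddIncl B P i w) =
        Φ.symm (evenIncl B P k ((t.h i k).baseChange B w)) := by
      rw [unipotentPart, LinearMap.sub_apply, LinearMap.comp_apply, hw, LinearEquiv.coe_coe,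
        map_add, Φ.symm_apply_apply, LinearMap.id_apply, add_sub_cancel_left]
    rw [h1]
    exact hΦ.symm_evenIncl_mem hC k l i hl hk _
  have h2 : unipotentPart s Φ t proj (oddIncl B P i (s.rho i m b)) ∈
      (boundaries B P k i).map (oddIncl B P i) ⊔ LinearMap.range (oddIncl B P l) := by
    refine key _ ?_
    rw [completedDiff, LinearMap.add_apply, t.baseChange_diff_oddIncl i m k rfl hk, s.d_rho,
      LinearMap.comp_apply, LinearMap.comp_apply, LinearMap.comp_apply, LinearEquiv.coe_coe,
      hΦ.map_section i m b, hp.evenIncl_of_mem (i := i) m rfl b.2, map_zero, map_zero, add_zero]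
  have h3 : unipotentPart s Φ t proj (oddIncl B P i (s.rep i n)) ∈
      (boundaries B P k i).map (oddIncl B P i) ⊔ LinearMap.range (oddIncl B P l) := by
    by_cases hi : (i : ℤ) = 1
    · refine key _ ?_
      obtain ⟨i, hi'⟩ := i
      obtain rfl : i = 1 := hi
      rw [completedDiff, LinearMap.add_apply,
        t.baseChange_diff_oddIncl ⟨1, hi'⟩ m k rfl hk, s.d_rep, map_zero,
        LinearMap.comp_apply, LinearMap.comp_apply, LinearMap.comp_apply, LinearEquiv.coe_coe,
        hΦ.map_cohomology, hp.evenIncl_rep, zero_add, add_comm]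
    · have := hC i hi (fun h => by have := i.2; rw [h] at this; exact absurd this (by decide))
      rw [Subsingleton.elim n 0, map_zero, map_zero, map_zero]
      exact zero_mem _
  have h4 := hΦ.unipotentPart_of_mem hC hp i k l hk hl _ hn
  have h5 : x = s.rho i m b + ((x - s.rho i m b - s.rep i n) + s.rep i n) := by abel
  rw [h5, map_add, map_add, map_add, map_add]
  exact add_mem h2 (add_mem (Submodule.mem_sup_right h4) h3)

/-- The completed differential differs from `Φ` by a unipotent automorphism: the
square of the difference to the identity lowers the filtration by degree. -/
theorem IsInducedIso.isNilpotent_unipotentPart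
    (hb : ∃ n : ℕ, ∀ i : ℤ, (n : ℤ) < |i| → Subsingleton (P.X i)) :
    IsNilpotent (unipotentPart s Φ t proj) := by
  obtain ⟨n, hn⟩ := hb
  set N := unipotentPart s Φ t proj
  let T : ℤ → Submodule B (B ⊗[S] OddPart P) := fun n =>
    ⨆ (i : {i : ℤ // Odd i}) (_ : (i : ℤ) ≤ n), LinearMap.range (oddIncl B P i)
  have hT : ∀ (i : {i : ℤ // Odd i}) (n : ℤ), (i : ℤ) ≤ n → ∀ x, oddIncl B P i x ∈ T n :=
    fun i n hi x => Submodule.mem_iSup_of_mem i (Submodule.mem_iSup_of_mem hi ⟨x, rfl⟩)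
  have hmono : ∀ m n : ℤ, m ≤ n → T m ≤ T n := fun m n hmn =>
    iSup_mono fun i => iSup_mono' fun hi => ⟨hi.trans hmn, le_rfl⟩
  have hind : ∀ (n : ℤ) (f : Module.End B (B ⊗[S] OddPart P)) (W : Submodule B (B ⊗[S] OddPart P)),
      (∀ (i : {i : ℤ // Odd i}), (i : ℤ) ≤ n → ∀ x, f (oddIncl B P i x) ∈ W) →
      ∀ x ∈ T n, f x ∈ W := by
    intro n f W h
    have : T n ≤ W.comap f := iSup_le fun i => iSup_le fun hi => by
      rintro _ ⟨x, rfl⟩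
      exact h i hi x
    exact this
  have hpred : ∀ i : {i : ℤ // Odd i}, ∃ (k : {i : ℤ // Even i}) (l : {i : ℤ // Odd i}),
      (k : ℤ) + 1 = i ∧ (l : ℤ) + 1 = k := fun i =>
    ⟨⟨i - 1, i.2.sub_odd odd_one⟩, ⟨i - 1 - 1, (i.2.sub_odd odd_one).sub_odd odd_one⟩,
      by simp, by simp⟩
  have hN : ∀ n, ∀ x ∈ T n, N x ∈ T n := fun n => hind n N (T n) fun i hi x => by
    obtain ⟨k, l, hk, hl⟩ := hpred i
    obtain ⟨_, ⟨b, -, rfl⟩, _, ⟨y, rfl⟩, hby⟩ :=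
      Submodule.mem_sup.mp (hΦ.unipotentPart_mem hC hp i k l hk hl x)
    rw [show N (oddIncl B P i x) = _ from hby.symm]
    exact add_mem (hT i n hi b) (hT l n (by omega) y)
  have hN2 : ∀ n, ∀ x ∈ T n, (N ^ 2) x ∈ T (n - 2) := fun n => hind n (N ^ 2) _ fun i hi x => by
    obtain ⟨k, l, hk, hl⟩ := hpred i
    obtain ⟨_, ⟨b, hbb, rfl⟩, _, ⟨y, rfl⟩, hby⟩ :=
      Submodule.mem_sup.mp (hΦ.unipotentPart_mem hC hp i k l hk hl x)
    rw [sq, Module.End.mul_apply, show N (oddIncl B P i x) = _ from hby.symm, map_add]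
    obtain ⟨y', hy'⟩ := hΦ.unipotentPart_of_mem hC hp i k l hk hl b hbb
    refine add_mem ?_ (hN _ _ (hT l _ (by omega) y))
    rw [show N (oddIncl B P i b) = _ from hy'.symm]
    exact hT l _ (by omega) y'
  have hnil : IsNilpotent (N ^ 2) := by
    refine isNilpotent_of_forall_map_le T (N ^ 2) n (-n) ?_ (fun m hm => ?_) hN2
    · rw [eq_top_iff]
      rintro x -
      induction x using TensorProduct.induction_on with
      | zero => exact zero_mem _
      | add x y hx hy => exact add_mem hx hy
      | tmul c x =>
        induction x using DirectSum.induction_on with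
        | zero => rw [TensorProduct.tmul_zero]; exact zero_mem _
        | add x y hx hy => rw [TensorProduct.tmul_add]; exact add_mem hx hy
        | of i x =>
          by_cases hi : (i : ℤ) ≤ n
          · exact hT i n hi (c ⊗ₜ x)
          · have := hn i (lt_of_lt_of_le (by omega) (le_abs_self _))
            rw [Subsingleton.elim x 0, map_zero, TensorProduct.tmul_zero]
            exact zero_mem _
    · rw [eq_bot_iff]
      refine iSup_le fun i => iSup_le fun hi => ?_
      rintro _ ⟨x, rfl⟩
      have := hn i (lt_of_lt_of_le (by omega) (neg_le_abs _))
      rw [Submodule.mem_bot, Subsingleton.elim x 0, map_zero]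
  obtain ⟨k, hk⟩ := hnil
  exact ⟨2 * k, by rw [pow_mul, hk]⟩

end

/-! ### The two-term model of a strictly perfect complex -/

theorem bijective_one_add_of_isNilpotent {B W : Type*} [CommRing B] [AddCommGroup W] [Module B W]
    (f : Module.End B W) (hf : IsNilpotent f) : Function.Bijective (1 + f : Module.End B W) :=
  (Module.End.isUnit_iff (1 + f : Module.End B W)).mp (IsNilpotent.isUnit_one_add hf)

section

variable {S : Type u} [CommRing S] {P C : CochainComplex (ModuleCat.{u} S) ℤ}

theorem IsStrictlyPerfect.finite_directSum (hP : IsStrictlyPerfect P) (p : ℤ → Prop) :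
    Module.Finite S (DirectSum {i : ℤ // p i} fun i => P.X i) := by
  classical
  have := hP.finite
  obtain ⟨n, hn⟩ := hP.bounded
  have hfin : {i : {i : ℤ // p i} | |(i : ℤ)| ≤ n}.Finite :=
    ((Set.finite_Icc (-n : ℤ) n).preimage Subtype.val_injective.injOn).subset
      fun i hi => abs_le.mp hi
  have htop : (⊤ : Submodule S (DirectSum {i : ℤ // p i} fun i => P.X i)) =
      ⨆ i ∈ hfin.toFinset,
        LinearMap.range (DirectSum.lof S {i : ℤ // p i} (fun i => P.X i) i) := by
    symm
    rw [eq_top_iff]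
    rintro x -
    induction x using DirectSum.induction_on with
    | zero => exact zero_mem _
    | add x y hx hy => exact add_mem hx hy
    | of i x =>
      by_cases hi : |(i : ℤ)| ≤ n
      · exact Submodule.mem_iSup_of_mem i (Submodule.mem_iSup_of_mem (by simpa using hi) ⟨x, rfl⟩)
      · have := hn i (not_le.mp hi)
        rw [Subsingleton.elim x 0, map_zero]
        exact zero_mem _
  refine ⟨htop ▸ Submodule.fg_biSup _ _ fun i _ => ?_⟩
  rw [LinearMap.range_eq_map]
  exact Module.Finite.fg_top.map _

variable {B : Type v} [CommRing B] [Algebra S B] [Module.Flat S B] {q : P ⟶ C} [QuasiIso q]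
  {lam : (B ⊗[S] C.homology 1) ≃ₗ[B] (B ⊗[S] C.homology 2)} {s : Splitting B q}
  {Φ : (B ⊗[S] OddPart P) ≃ₗ[B] (B ⊗[S] EvenPart P)}

/-- The complex `P` and the isomorphism `Φ` give rise to a two-term complex, the isomorphism of
which differs from `Φ` by a unipotent automorphism. -/
theorem IsInducedIso.exists_twoTermModel (hΦ : IsInducedIso s lam Φ) (hP : IsStrictlyPerfect P)
    (hC : ∀ i, i ≠ 1 → i ≠ 2 → Subsingleton (C.homology i)) (t : OddSplitting P) :
    ∃ d : TwoTermModel lam (OddPart P) (EvenPart P),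
      IsNilpotent (Φ.symm.toLinearMap ∘ₗ d.iso.toLinearMap - LinearMap.id) := by
  obtain ⟨incl, hincl, hinj, hexl⟩ := t.exists_incl q hC
  obtain ⟨proj, hproj1, hproj2, hproj3, hexr, hsurj⟩ := t.exists_proj q hC
  have hp : IsEvenProj t q proj := ⟨hproj1, hproj2, hproj3⟩
  have hnil : IsNilpotent (unipotentPart s Φ t proj) :=
    hΦ.isNilpotent_unipotentPart hC hp hP.bounded
  have hbij : Function.Bijective (completedDiff s Φ t proj) := by
    have h1 := bijective_one_add_of_isNilpotent _ hnil
    have h2 : completedDiff s Φ t proj = Φ.toLinearMap ∘ₗ (1 + unipotentPart s Φ t proj) := by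
      refine LinearMap.ext fun x => ?_
      change _ = Φ (x + (Φ.symm (completedDiff s Φ t proj x) - x))
      rw [add_sub_cancel, Φ.apply_symm_apply]
    rw [h2]
    exact Φ.bijective.comp h1
  have hinclB : ∀ n, incl.baseChange B n = oddIncl B P ⟨1, odd_one⟩ (s.rep 1 n) -
      oddIncl B P ⟨1, odd_one⟩ ((P.d 0 1).hom.baseChange B
        ((t.h 1 0).baseChange B (s.rep 1 n))) := by
    intro n
    have h1 : incl ∘ₗ cocycleClass q 1 = oddLof P ⟨1, odd_one⟩ ∘ₗ
        (LinearMap.id - (P.d 0 1).hom ∘ₗ t.h 1 0) ∘ₗ (P.iCycles 1).hom := LinearMap.ext hincl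
    have h2 := LinearMap.congr_fun (congrArg (LinearMap.baseChange B) h1) (s.sigma 1 n)
    rw [LinearMap.baseChange_comp, LinearMap.comp_apply, s.class_sigma, LinearMap.baseChange_comp,
      LinearMap.baseChange_comp, LinearMap.baseChange_sub, LinearMap.baseChange_comp,
      LinearMap.baseChange_id] at h2
    rw [h2, ← map_sub]
    rfl
  have hlam : ∀ n, proj.baseChange B (Φ (incl.baseChange B n)) = lam n := by
    intro n
    have h1 := hΦ.map_boundary ⟨0, Even.zero⟩ ⟨1, odd_one⟩
      ⟨_, LinearMap.mem_range_self _ ((t.h 1 0).baseChange B (s.rep 1 n))⟩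
    have h2 : Φ (oddIncl B P ⟨1, odd_one⟩ ((P.d 0 1).hom.baseChange B
        ((t.h 1 0).baseChange B (s.rep 1 n)))) = _ := h1
    rw [hinclB, map_sub, map_sub, hΦ.map_cohomology, hp.evenIncl_rep, h2,
      hp.evenIncl_eq_zero ⟨0, Even.zero⟩ (by decide), sub_zero]
  have hdiff : t.diff.baseChange B ∘ₗ incl.baseChange B = 0 := by
    rw [← LinearMap.baseChange_comp, hexl.linearMap_comp_eq_zero, LinearMap.baseChange_zero]
  have hpd : proj.baseChange B ∘ₗ t.diff.baseChange B = 0 := by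
    rw [← LinearMap.baseChange_comp, hexr.linearMap_comp_eq_zero, LinearMap.baseChange_zero]
  refine ⟨{ diff := t.diff, incl := incl, proj := proj
            incl_injective := hinj, exact_left := hexl, exact_right := hexr
            proj_surjective := hsurj
            retr := lam.symm.toLinearMap ∘ₗ proj.baseChange B ∘ₗ Φ.toLinearMap
            iso := LinearEquiv.ofBijective _ hbij
            diff_eq := ?_, retr_incl := ?_, proj_iso := ?_ }, hnil⟩
  · refine LinearMap.ext fun x => ?_
    change _ = completedDiff s Φ t proj (x - incl.baseChange B (lam.symm (proj.baseChange B (Φ x))))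
    have h1 := LinearMap.congr_fun hdiff (lam.symm (proj.baseChange B (Φ x)))
    rw [LinearMap.comp_apply, LinearMap.zero_apply] at h1
    rw [map_sub]
    simp only [completedDiff, LinearMap.add_apply, LinearMap.comp_apply, LinearEquiv.coe_coe]
    rw [h1, hlam, lam.apply_symm_apply, zero_add, add_sub_cancel_right]
  · refine LinearMap.ext fun n => ?_
    change lam.symm (proj.baseChange B (Φ (incl.baseChange B n))) = n
    rw [hlam, lam.symm_apply_apply]
  · refine LinearMap.ext fun x => ?_
    change proj.baseChange B (completedDiff s Φ t proj x) =
      lam (lam.symm (proj.baseChange B (Φ x)))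
    have h1 := LinearMap.congr_fun hpd x
    rw [LinearMap.comp_apply, LinearMap.zero_apply] at h1
    rw [lam.apply_symm_apply, completedDiff, LinearMap.add_apply, map_add, h1, zero_add]
    exact hp.evenIncl_rep s _

end

/-! ### The obstruction in `Ext²` to the extension of functionals -/

section

open Abelian

variable {S : Type u} [CommRing S] {M N O V : Type u} [AddCommGroup M] [Module S M]
  [AddCommGroup N] [Module S N] [AddCommGroup O] [Module S O] [AddCommGroup V] [Module S V]

theorem exists_shortExact (f : M →ₗ[S] O) (g : O →ₗ[S] N) (hf : Function.Injective f)
    (hfg : Function.Exact f g) (hg : Function.Surjective g) :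
    ∃ h : ModuleCat.ofHom f ≫ ModuleCat.ofHom g = 0,
      (ShortComplex.mk (ModuleCat.ofHom f) (ModuleCat.ofHom g) h).ShortExact := by
  refine ⟨by rw [← ModuleCat.ofHom_comp, hfg.linearMap_comp_eq_zero]; rfl, ?_⟩
  have h1 : Mono (ModuleCat.ofHom f) := (ModuleCat.mono_iff_injective _).mpr hf
  have h2 : Epi (ModuleCat.ofHom g) := (ModuleCat.epi_iff_surjective _).mpr hg
  exact { exact := (ShortComplex.ShortExact.moduleCat_exact_iff_function_exact _).mpr hfg
          mono_f := h1
          epi_g := h2 }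

/-- If `O` and `V` are projective, the class of `Ext²(N, S)` that a functional on `M` defines is
the obstruction to extending it to `O`. -/
theorem exists_extension_of_mem_annExtTwo [Module.Projective S O] [Module.Projective S V]
    (i : M →ₗ[S] O) (d : O →ₗ[S] V) (p : V →ₗ[S] N) (hi : Function.Injective i)
    (hid : Function.Exact i d) (hdp : Function.Exact d p) (hp : Function.Surjective p) {y : S}
    (hy : y ∈ annExtTwo S N) (φ : Module.Dual S M) : ∃ ψ : Module.Dual S O, ψ ∘ₗ i = y • φ := by
  obtain ⟨h₁, hS₁⟩ := exists_shortExact i d.rangeRestrict hi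
    (fun x => by rw [← hid x, Subtype.ext_iff]; rfl) d.surjective_rangeRestrict
  obtain ⟨h₂, hS₂⟩ := exists_shortExact (LinearMap.range d).subtype p
    (Submodule.subtype_injective _) (fun x => by rw [hdp x]; simp) hp
  have hO : Projective (ModuleCat.of S O) := inferInstance
  have hV : Projective (ModuleCat.of S V) := inferInstance
  let x₀ : Ext (ModuleCat.of S M) (ModuleCat.of S S) 0 := Ext.mk₀ (ModuleCat.ofHom φ)
  let x₁ : Ext (ModuleCat.of S (LinearMap.range d)) (ModuleCat.of S S) 1 :=
    hS₁.extClass.comp x₀ (add_zero 1)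
  have hx₁ : hS₂.extClass.comp (y • x₁) (show 1 + 1 = 2 from rfl) = 0 := by
    rw [Ext.comp_smul]
    exact Module.mem_annihilator.mp hy _
  obtain ⟨x₂, hx₂⟩ := Ext.contravariant_sequence_exact₁ hS₂ (ModuleCat.of S S) (y • x₁) _ hx₁
  have hx₂0 : x₂ = 0 := Ext.eq_zero_of_projective (P := ModuleCat.of S V) x₂
  rw [hx₂0, Ext.comp_zero] at hx₂
  have hx₀ : hS₁.extClass.comp (y • x₀) (add_zero 1) = 0 := by
    rw [Ext.comp_smul, hx₂]
  obtain ⟨w, hw⟩ := Ext.contravariant_sequence_exact₁ hS₁ (ModuleCat.of S S) (y • x₀) _ hx₀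
  obtain ⟨w, rfl⟩ := (Ext.mk₀_bijective _ _).2 w
  rw [Ext.mk₀_comp_mk₀, ← Ext.mk₀_smul] at hw
  exact ⟨w.hom, congrArg ModuleCat.Hom.hom ((Ext.mk₀_bijective _ _).1 hw)⟩

end

/-! ### Characteristic elements -/

section

variable {R F E : Type*} [CommRing R] [IsDedekindDomain R] [Field F] [Algebra R F]
  [IsFractionRing R F] [Field E] [Algebra R E] [Algebra F E] [IsScalarTower R F E]

/-- A characteristic element is the determinant of a two-term complex of projective modules with
cohomology `H^1(C)` and `H^2(C)`. -/
theorem IsCharacteristicElement.exists_twoTermModel {S : Type u} [CommRing S] [Algebra R S]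
    [Module.Finite R S] [Module.IsTorsionFree R S] {C : CochainComplex (ModuleCat.{u} S) ℤ}
    (hC : IsStrictlyAdmissible R F C)
    {lam : (OrderExt R E S ⊗[S] C.homology 1) ≃ₗ[OrderExt R E S]
      (OrderExt R E S ⊗[S] C.homology 2)}
    {L : (OrderExt R E S)ˣ} (hL : IsCharacteristicElement R E C lam L) :
    ∃ (P : CochainComplex (ModuleCat.{u} S) ℤ) (d : TwoTermModel lam (OddPart P) (EvenPart P))
      (Φ : (OrderExt R E S ⊗[S] OddPart P) ≃ₗ[OrderExt R E S] (OrderExt R E S ⊗[S] EvenPart P)),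
      IsStrictlyPerfect P ∧
      IsNilpotent (Φ.symm.toLinearMap ∘ₗ d.iso.toLinearMap - LinearMap.id) ∧
      detLattice Φ = Submodule.span S {(L : OrderExt R E S)} := by
  obtain ⟨P, q, s, Φ, hq, hP, hΦ, hdet⟩ := hL
  have hflat : Module.Flat S (OrderExt R E S) := flat_orderExt_of_field R F E S
  have hH : ∀ i, i ≠ 1 → i ≠ 2 → Subsingleton (C.homology i) := fun i h1 h2 =>
    ModuleCat.subsingleton_of_isZero
      (HomologicalComplex.exactAt_iff_isZero_homology C i |>.mp (hC.acyclic i h1 h2))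
  have htf : ∀ r : R, r ≠ 0 → ∀ m : C.homology 1, algebraMap R S r • m = 0 → m = 0 := by
    intro r hr m hm
    have h : m ∈ rTorsion R S (C.homology 1) := (Submodule.mem_torsion'_iff _ _).mpr
      ⟨⟨_, r, mem_nonZeroDivisors_of_ne_zero hr, rfl⟩, hm⟩
    rwa [hC.torsionFree, Submodule.mem_bot] at h
  obtain ⟨τ⟩ := nonempty_oddSplitting fun i j hij hj => exists_splitting_of_odd q hP hH htf hij hj
  obtain ⟨d, hd⟩ := hΦ.exists_twoTermModel hP hH τ
  exact ⟨P, d, Φ, hP, hd, hdet⟩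

/-- The theorem for an arbitrary two-term model whose isomorphism agrees, up to a unipotent
automorphism, with an isomorphism `e` of which `L` generates the lattice. -/
theorem TwoTermModel.mem_and_eq_of_mem_annExtTwo {S : Type u} [CommRing S] [Algebra R S]
    [Module.Finite R S] [Module.IsTorsionFree R S] [Algebra.IsSeparable F (F ⊗[R] S)]
    {M N O V : Type u} [AddCommGroup M] [Module S M] [AddCommGroup N] [Module S N]
    [AddCommGroup O] [Module S O] [AddCommGroup V] [Module S V]
    [Module.Finite S O] [Module.Projective S O] [Module.Finite S V] [Module.Projective S V]
    {lam : (OrderExt R E S ⊗[S] M) ≃ₗ[OrderExt R E S] (OrderExt R E S ⊗[S] N)}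
    (d : TwoTermModel lam O V)
    (e : (OrderExt R E S ⊗[S] O) ≃ₗ[OrderExt R E S] (OrderExt R E S ⊗[S] V))
    (he : IsNilpotent (e.symm.toLinearMap ∘ₗ d.iso.toLinearMap - LinearMap.id))
    (L : (OrderExt R E S)ˣ) (hL : detLattice e = Submodule.span S {(L : OrderExt R E S)})
    {a : ℕ} (x : Fin a → N) {y : S} (hy : y ∈ annExtTwo S N) :
    (∀ (U : Submodule S N) (K : Submodule S U),
      (∀ e : OrderExt R F S, IsPrimitiveIdem e → e * idemGe R F N a = e →
        a ≤ rankAt R F e (U ⧸ K)) →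
      ∀ t : S, (∃ b : S, algebraMap S (OrderExt R F S) t =
          algebraMap S (OrderExt R F S) b * idemGe R F N a) →
        ∀ z ∈ evalIdeal (higherSpecialElement R F E lam L x), (t * y ^ a) • z ∈
          Submodule.map (Algebra.linearMap S (OrderExt R E S))
            (fittingIdeal S N a ⊓ Module.annihilator S (rTorsion R S (U ⧸ K)))) ∧
    (IsSeparableTuple S x →
      idemGe R F N a = (1 : OrderExt R F S) ∧
      (∀ z ∈ evalIdeal (higherSpecialElement R F E lam L x), y ^ a • z ∈
        Submodule.map (Algebra.linearMap S (OrderExt R E S)) (fittingIdeal S N a)) ∧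
      Submodule.map (Algebra.linearMap S (OrderExt R E S)) (fittingIdeal S N a) ≤
        evalIdeal (higherSpecialElement R F E lam L x)) := by
  have hred : IsReduced (OrderExt R E S) := isReduced_orderExt R F E S
  have hredF : IsReduced (OrderExt R F S) := isReduced_orderExt R F F S
  have hinj := algebraMap_orderExt_injective R F E S
  have : Module.Finite S N := Module.Finite.of_surjective d.proj d.proj_surjective
  have hext := exists_extension_of_mem_annExtTwo d.incl d.diff d.proj d.incl_injective
    d.exact_left d.exact_right d.proj_surjective hy
  refine ⟨fun U K hrk t ht z hz => ?_, fun hx => ?_⟩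
  · exact d.smul_mem_map_of_fittingIdeal hinj e he L hL x hext ht _ (fun u hu =>
      Submodule.mem_inf.mpr ⟨Ideal.mul_mem_left _ _ hu,
        mul_mem_annihilator_rTorsion U K hrk ht hu⟩) z hz
  · obtain ⟨ξ, hξ⟩ := hx.exists_dual
    have hid : idemGe R F N a = (1 : OrderExt R F S) :=
      idemGe_eq_one_of_forall_le _ _ fun p _ => le_finrank_of_dual hξ
    refine ⟨hid, fun z hz => ?_, d.map_fittingIdeal_le_evalIdeal hinj e he L hL hx hid⟩
    have h := d.smul_mem_map_of_fittingIdeal hinj e he L hL x hext (t := 1)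
      ⟨1, by rw [hid, map_one, one_mul]⟩ (fittingIdeal S N a) (fun u hu => by rwa [one_mul]) z hz
    rwa [one_mul] at h

end

end HigherSpecial

end

theorem mainTheorem1
    {R F E : Type*} {S : Type u} [CommRing R] [IsDedekindDomain R] [CharZero R]
    [Field F] [Algebra R F] [IsFractionRing R F]
    [Field E] [Algebra R E] [Algebra F E] [IsScalarTower R F E]
    [CommRing S] [Algebra R S] [Module.Finite R S] [Module.IsTorsionFree R S]
    [Algebra.IsSeparable F (F ⊗[R] S)]
    (C : CochainComplex (ModuleCat.{u} S) ℤ) (hC : IsStrictlyAdmissible R F C)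
    (lam : (OrderExt R E S ⊗[S] C.homology 1) ≃ₗ[OrderExt R E S]
      (OrderExt R E S ⊗[S] C.homology 2))
    (L : (OrderExt R E S)ˣ) (hL : IsCharacteristicElement R E C lam L)
    (a : ℕ) (x : Fin a → C.homology 2)
    (η : ⋀[OrderExt R E S]^a (OrderExt R E S ⊗[S] C.homology 1))
    (hη : η = higherSpecialElement R F E lam L x)
    (y : S)
    (hy : y ∈ annExtTwo S (C.homology 2) *
      annExtTwoIdem R F (idemGe R F (C.homology 2) a) (C.homology 2)) :
    (∀ (N : Submodule S (C.homology 2)) (K : Submodule S N),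
      (∀ e : OrderExt R F S, IsPrimitiveIdem e → e * idemGe R F (C.homology 2) a = e →
        a ≤ rankAt R F e (N ⧸ K)) →
      ∀ t : S, (∃ b : S, algebraMap S (OrderExt R F S) t =
          algebraMap S (OrderExt R F S) b * idemGe R F (C.homology 2) a) →
        ∀ z ∈ evalIdeal η, (t * y ^ a) • z ∈
          Submodule.map (Algebra.linearMap S (OrderExt R E S))
            (fittingIdeal S (C.homology 2) a ⊓ Module.annihilator S (rTorsion R S (N ⧸ K)))) ∧
    (IsSeparableTuple S x →
      idemGe R F (C.homology 2) a = (1 : OrderExt R F S) ∧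
      (∀ z ∈ evalIdeal η, y ^ a • z ∈
        Submodule.map (Algebra.linearMap S (OrderExt R E S))
          (fittingIdeal S (C.homology 2) a)) ∧
      Submodule.map (Algebra.linearMap S (OrderExt R E S))
        (fittingIdeal S (C.homology 2) a) ≤ evalIdeal η) := by
  obtain ⟨P, d, Φ, hP, hd, hdet⟩ := hL.exists_twoTermModel hC
  have := hP.projective
  have : Module.Finite S (OddPart P) := hP.finite_directSum _
  have : Module.Finite S (EvenPart P) := hP.finite_directSum _
  subst hη
  exact d.mem_and_eq_of_mem_annExtTwo Φ hd L hdet x (Ideal.mul_le_left hy)
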